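/- Fix $\sigma>0$ and real numbers $\sigma_1,m_4$. For $N\ge 1$ let $W_N$ be a random $N\times N$ matrix of one of the following two kinds (its entries need not be identically distributed). (Real symmetric.) $W_N$ is real symmetric, the entries $(W_N)_{jk}$, $1\le j\le k\le N$, are independent, $\mathbb E (W_N)_{jk}=0$ and $\mathbb V (W_N)_{jk}=\sigma^2$ and $\mathbb E (W_N)_{jk}^4\le m_4$ for $j<k$, and $\mathbb E (W_N)_{ii}=0$, $\mathbb E (W_N)_{ii}^2\le\sigma_1^2$. (Hermitian.) $W_N$ is Hermitian, the random variables $\Re (W_N)_{jk}$, $\Im (W_N)_{jk}$ ($1\le j<k\le N$), $(W_N)_{ii}$ ($1\le i\le N$) are independent, $\mathbb E\,\Re (W_N)_{jk}=\mathbb E\,\Im (W_N)_{jk}=0$, $\mathbb V\,\Re (W_N)_{jk}=\mathbb V\,\Im (W_N)_{jk}=\sigma^2/2$ and $\mathbb E |(W_N)_{jk}|^4\le m_4$ for $j<k$, and $\mathbb E (W_N)_{ii}=0$, $\mathbb E |(W_N)_{ii}|^2\le\sigma_1^2$. Let $X_N=N^{-1/2}W_N$, let $R(z)=(zI_N-X_N)^{-1}$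 for $z\in\mathbb C\setminus\mathbb R$, and let $$g_\sigma(z)=\int_{-2\sigma}^{2\sigma}\frac{1}{z-x}\,\frac{\sqrt{4\sigma^2-x^2}}{2\pi\sigma^2}\,dx .$$ For a complex random variable $\xi$ write $\mathbb V\xi=\mathbb E|\xi-\mathbb E\xi|^2$. Then every $R_{ij}(z)$ is square integrable, and the following bounds hold for all such $W_N$ and all $N\ge1$. 1. For every bounded set $B\subset\mathbb C\setminus\mathbb R$ there is a constant $C$, depending only on $B,\sigma,\sigma_1,m_4$, such that $$\bigl|\mathbb E R_{ii}(z)-g_\sigma(z)\bigr|\le \frac{C}{|\Im z|^{6}N},\qquad 1\le i\le N,\ z\in B .$$ 2. There is a polynomial $P_5$ of degree $5$ with positive coefficients, depending only on $\sigma,\sigma_1,m_4$, such that $$|\mathbb E R_{ij}(z)|\le \frac{P_5(|\Im z|^{-1})}{N},\qquad 1\le i\ne j\le N,\ z\in\mathbb C\setminus\mathbb R .$$ 3. There is a polynomial $P_6$ of degree $6$ with positive coefficients, depending only on $\sigma,\sigma_1,m_4$, such that $$\mathbb V R_{ij}(z)\le \frac{P_6(|\Im z|^{-1})}{N},\qquad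 1\le i,j\le N,\ z\in\mathbb C\setminus\mathbb R .$$ 4. For all real $m_5,m_3$ there is a polynomial $P_9$ of degree $9$ with positive coefficients, depending only on $\sigma,\sigma_1,m_4,m_5,m_3$, such that, if in addition $\mathbb E|(W_N)_{ij}|^5\le m_5$ for all $i\ne j$ and $\mathbb E|(W_N)_{ii}|^3\le m_3$ for all $i$, then $$|\mathbb E R_{ij}(z)|\le \frac{P_9(|\Im z|^{-1})}{N^{3/2}},\qquad 1\le i\ne j\le N,\ z\in\mathbb C\setminus\mathbb R .$$ -/

import Mathlib

open MeasureTheory ProbabilityTheory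

universe u

noncomputable section

/-- A random real symmetric `N × N` matrix `W` whose entries on and above the diagonal are
independent and centered, whose off-diagonal entries have variance `σ ^ 2` and fourth moment at
most `m₄`, and whose diagonal entries have second moment at most `σ₁ ^ 2`. The entries need not be
identically distributed. (The `MemLp` fields say that the moments in question are finite.) -/
structure IsRealSymmetricWigner {N : ℕ} {Ω : Type u} [MeasurableSpace Ω] (μ : Measure Ω)
    (W : Ω → Matrix (Fin N) (Fin N) ℝ) (σ σ₁ m₄ : ℝ) : Prop where
  isSymm : ∀ ω, (W ω).IsSymm
  measurable_entry : ∀ j k, Measurable fun ω => W ω j k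
  indep : iIndepFun
    (fun (p : {p : Fin N × Fin N // p.1 ≤ p.2}) (ω : Ω) => W ω p.1.1 p.1.2) μ
  offdiag_memLp : ∀ j k, j < k → MemLp (fun ω => W ω j k) 4 μ
  offdiag_mean : ∀ j k, j < k → ∫ ω, W ω j k ∂μ = 0
  offdiag_variance : ∀ j k, j < k → variance (fun ω => W ω j k) μ = σ ^ 2
  offdiag_fourth : ∀ j k, j < k → ∫ ω, |W ω j k| ^ 4 ∂μ ≤ m₄
  diag_memLp : ∀ i, MemLp (fun ω => W ω i i) 2 μ
  diag_mean : ∀ i, ∫ ω, W ω i i ∂μ = 0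
  diag_second : ∀ i, ∫ ω, |W ω i i| ^ 2 ∂μ ≤ σ₁ ^ 2

/-- A random Hermitian `N × N` matrix `W` for which the real parts and the imaginary parts of the
entries above the diagonal, together with the (real) diagonal entries, form an independent family of
centered random variables; the real and the imaginary part of an off-diagonal entry have variance
`σ ^ 2 / 2` each, the fourth absolute moment of an off-diagonal entry is at most `m₄`, and the
second moment of a diagonal entry is at most `σ₁ ^ 2`. -/
structure IsHermitianWigner {N : ℕ} {Ω : Type u} [MeasurableSpace Ω] (μ : Measure Ω)
    (W : Ω → Matrix (Fin N) (Fin N) ℂ) (σ σ₁ m₄ : ℝ) : Prop where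
  isHermitian : ∀ ω, (W ω).IsHermitian
  measurable_entry : ∀ j k, Measurable fun ω => W ω j k
  indep : iIndepFun
    (Sum.elim
      (fun (p : {p : Fin N × Fin N // p.1 < p.2}) (ω : Ω) => (W ω p.1.1 p.1.2).re)
      (Sum.elim
        (fun (p : {p : Fin N × Fin N // p.1 < p.2}) (ω : Ω) => (W ω p.1.1 p.1.2).im)
        (fun (i : Fin N) (ω : Ω) => (W ω i i).re))) μ
  offdiag_memLp : ∀ j k, j < k → MemLp (fun ω => W ω j k) 4 μ
  offdiag_mean_re : ∀ j k, j < k → ∫ ω, (W ω j k).re ∂μ = 0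
  offdiag_mean_im : ∀ j k, j < k → ∫ ω, (W ω j k).im ∂μ = 0
  offdiag_variance_re : ∀ j k, j < k → variance (fun ω => (W ω j k).re) μ = σ ^ 2 / 2
  offdiag_variance_im : ∀ j k, j < k → variance (fun ω => (W ω j k).im) μ = σ ^ 2 / 2
  offdiag_fourth : ∀ j k, j < k → ∫ ω, ‖W ω j k‖ ^ 4 ∂μ ≤ m₄
  diag_memLp : ∀ i, MemLp (fun ω => W ω i i) 2 μ
  diag_mean : ∀ i, ∫ ω, W ω i i ∂μ = 0
  diag_second : ∀ i, ∫ ω, ‖W ω i i‖ ^ 2 ∂μ ≤ σ₁ ^ 2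

/-- `W` is a real symmetric or a Hermitian Wigner matrix (a real one being regarded as a complex
matrix through the inclusion of `ℝ` in `ℂ`). -/
def IsWigner {N : ℕ} {Ω : Type u} [MeasurableSpace Ω] (μ : Measure Ω)
    (W : Ω → Matrix (Fin N) (Fin N) ℂ) (σ σ₁ m₄ : ℝ) : Prop :=
  (∃ V : Ω → Matrix (Fin N) (Fin N) ℝ, IsRealSymmetricWigner μ V σ σ₁ m₄ ∧
    ∀ ω, W ω = (V ω).map (fun x : ℝ => (x : ℂ))) ∨
  IsHermitianWigner μ W σ σ₁ m₄

/-- The resolvent `(z I - X)⁻¹` of `X = N ^ (-1/2) W`. -/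
def wignerResolvent {N : ℕ} (W : Matrix (Fin N) (Fin N) ℂ) (z : ℂ) :
    Matrix (Fin N) (Fin N) ℂ :=
  (z • (1 : Matrix (Fin N) (Fin N) ℂ) - ((1 / Real.sqrt (N : ℝ) : ℝ) : ℂ) • W)⁻¹

/-- The variance `𝔼 |ξ - 𝔼 ξ| ^ 2` of a complex random variable. -/
def complexVariance {Ω : Type u} [MeasurableSpace Ω] (ξ : Ω → ℂ) (μ : Measure Ω) : ℝ :=
  ∫ ω, ‖ξ ω - ∫ ω', ξ ω' ∂μ‖ ^ 2 ∂μ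

/-- The density of the semicircle law on `[-2σ, 2σ]`. -/
def semicircleDensity (σ x : ℝ) : ℝ :=
  (Set.Icc (-2 * σ) (2 * σ)).indicator
    (fun t => 1 / (2 * Real.pi * σ ^ 2) * Real.sqrt (4 * σ ^ 2 - t ^ 2)) x

/-- The Wigner semicircle law with variance `σ ^ 2`. -/
def semicircleLaw (σ : ℝ) : Measure ℝ :=
  volume.withDensity fun x => ENNReal.ofReal (semicircleDensity σ x)

/-- The Stieltjes transform `g_σ(z) = ∫ (z - x)⁻¹ μ_sc(dx)` of the semicircle law. -/
def semicircleStieltjes (σ : ℝ) (z : ℂ) : ℂ :=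
  ∫ x, (z - (x : ℂ))⁻¹ ∂(semicircleLaw σ)

/-- `P` is a polynomial of degree `l` with positive coefficients. -/
def IsPositivePolynomial (l : ℕ) (P : Polynomial ℝ) : Prop :=
  P.natDegree = l ∧ ∀ k ≤ l, 0 < P.coeff k

end

noncomputable section

set_option linter.unusedSectionVars false

/-! The entries of `X = N ^ (-1/2) W` have size `r = c / √N`, so that `r ^ 2` in a bound means `1 /
N`; throughout, `t` dominates both `|Im z|⁻¹` and `1`. The method is to freeze everything except one
row. Let `R^(k)` be the resolvent after row and column `k` are set to zero. Schur's formula gives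
`R_kk = 1 / (D - E)`, where `D = z - ∑ v_a R^(k)_aa` does not involve row `k`, and `E` is `X_kk`
plus a centred quadratic form in that row. Also `R_kj = R_kk Y` with `Y` a linear form in row `k`.
The Ward identity bounds the rows of `R^(k)` in `ℓ²`, so `E` and `Y` are of order `r` in `L²`;
positivity of imaginary parts gives `|D⁻¹| ≤ |Im z|⁻¹`.

Off-diagonal means (`norm_integral_resolvent_offdiag_le`): in `R_kj = D⁻¹ Y + D⁻¹ E R_kk Y` the
first term has mean zero and Cauchy–Schwarz makes the second `O(r ^ 2)`.

Variances (`variance_resolvent_le`): by Efron–Stein it suffices to compare `R_ij` with a quantity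
free of row `k`, for each `k`. The difference `R_ij - R^(k)_ij` is `R_kk` times two linear forms,
hence of mean square `O(r ^ 4)`, and there are `N` of them; the indices `k = i, j` cost `O(r ^ 2)`
each.

Diagonal means (`norm_integral_resolvent_diag_sub_le`, `norm_sub_semicircle_le`): the weighted trace
concentrates, so every `𝔼 R_kk` is close to `1 / (z - σ² m)` with `m` the average of the `𝔼 R_bb`.
Thus `m` nearly solves the equation that the semicircle transform `g` solves exactly. The equation
is stable because `1 - σ |g|` is at least of order `|Im z|`, which costs one more factor `|Im z|⁻¹`.

Improved off-diagonal bound (`norm_integral_resolvent_offdiag_le_of_fifth`): the expansion is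
carried one order further. The new term has mean `∑_a κ_a 𝔼 [D⁻² R^(k)_aa R^(k)_aj]` with `κ_a` the
third moments of row `k`. For `a ≠ j` each expectation is `O(r ^ 2)` by the variance bounds, so the
sum is `O(N r ^ 5) = O(r ^ 3)`. The remainder `D⁻² E ^ 2 R_kk Y` is `O(r ^ 3)` directly, by means of
fifth moments. -/

/-! ### Resolvents of Hermitian matrices -/

section Resolvent

variable {n : Type*} [Fintype n] [DecidableEq n]

/-- The resolvent `(z I - X)⁻¹`. -/
def resolventMatrix (X : Matrix n n ℂ) (z : ℂ) : Matrix n n ℂ :=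
  (z • (1 : Matrix n n ℂ) - X)⁻¹

/-- The matrix `X` with row `k` and column `k` replaced by zero. -/
def zeroOut (k : n) (X : Matrix n n ℂ) : Matrix n n ℂ :=
  Matrix.of fun a b => if a = k ∨ b = k then 0 else X a b

lemma isHermitian_zeroOut {X : Matrix n n ℂ} (hX : X.IsHermitian) (k : n) :
    (zeroOut k X).IsHermitian := by
  ext a b
  simp only [zeroOut, Matrix.conjTranspose_apply, Matrix.of_apply]
  by_cases h : a = k ∨ b = k
  · rw [if_pos h, if_pos (Or.symm h), star_zero]
  · rw [if_neg h, if_neg (fun h' => h (Or.symm h')), hX.apply]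

/-- A null vector `v` would satisfy `v* X v = z v* v`, whose left side is real. -/
lemma isUnit_det_sub {X : Matrix n n ℂ} (hX : X.IsHermitian) {z : ℂ} (hz : z.im ≠ 0) :
    IsUnit (z • (1 : Matrix n n ℂ) - X).det := by
  rw [isUnit_iff_ne_zero]
  intro h
  obtain ⟨v, hv, hv0⟩ := Matrix.exists_mulVec_eq_zero_iff.mpr h
  rw [Matrix.sub_mulVec, Matrix.smul_mulVec, Matrix.one_mulVec, sub_eq_zero] at hv0
  have h1 : star v ⬝ᵥ (X.mulVec v) = z * (star v ⬝ᵥ v) := by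
    rw [← hv0, dotProduct_smul, smul_eq_mul]
  have h2 : (star v ⬝ᵥ (X.mulVec v)).im = 0 := hX.im_star_dotProduct_mulVec_self v
  have h3 : (star v ⬝ᵥ v) = ((∑ i, ‖v i‖ ^ 2 : ℝ) : ℂ) := by
    simp [dotProduct, Complex.conj_mul']
  rw [h1, h3, Complex.im_mul_ofReal] at h2
  have h4 : (∑ i, ‖v i‖ ^ 2 : ℝ) = 0 := (mul_eq_zero.mp h2).resolve_left hz
  rw [Finset.sum_eq_zero_iff_of_nonneg (fun _ _ => by positivity)] at h4
  exact hv (funext fun i => by simpa using h4 i (Finset.mem_univ i))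

lemma sub_mul_resolvent {X : Matrix n n ℂ} (hX : X.IsHermitian) {z : ℂ} (hz : z.im ≠ 0) :
    (z • (1 : Matrix n n ℂ) - X) * resolventMatrix X z = 1 :=
  Matrix.mul_nonsing_inv _ (isUnit_det_sub hX hz)

lemma resolvent_mul_sub {X : Matrix n n ℂ} (hX : X.IsHermitian) {z : ℂ} (hz : z.im ≠ 0) :
    resolventMatrix X z * (z • (1 : Matrix n n ℂ) - X) = 1 :=
  Matrix.nonsing_inv_mul _ (isUnit_det_sub hX hz)

lemma resolvent_sub_resolvent {X Y : Matrix n n ℂ} (hX : X.IsHermitian) (hY : Y.IsHermitian)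
    {z w : ℂ} (hz : z.im ≠ 0) (hw : w.im ≠ 0) :
    resolventMatrix X z - resolventMatrix Y w
      = resolventMatrix X z * ((w • (1 : Matrix n n ℂ) - Y) - (z • (1 : Matrix n n ℂ) - X))
        * resolventMatrix Y w := by
  rw [mul_sub, sub_mul, mul_assoc, sub_mul_resolvent hY hw, resolvent_mul_sub hX hz, mul_one,
    one_mul]

lemma conjTranspose_resolvent {X : Matrix n n ℂ} (hX : X.IsHermitian) (z : ℂ) :
    (resolventMatrix X z).conjTranspose = resolventMatrix X (star z) := by
  simp [resolventMatrix, Matrix.conjTranspose_nonsing_inv, hX.eq]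

lemma star_resolvent_apply {X : Matrix n n ℂ} (hX : X.IsHermitian) (z : ℂ) (a b : n) :
    resolventMatrix X (star z) a b = star (resolventMatrix X z b a) := by
  rw [← conjTranspose_resolvent hX, Matrix.conjTranspose_apply]

/-- The Ward identity for rows. -/
lemma im_resolvent_diag {X : Matrix n n ℂ} (hX : X.IsHermitian) {z : ℂ} (hz : z.im ≠ 0) (a : n) :
    (resolventMatrix X z a a).im = -z.im * ∑ b, ‖resolventMatrix X z a b‖ ^ 2 := by
  have hz' : (star z).im ≠ 0 := by simpa using hz
  have h := congrFun (congrFun (resolvent_sub_resolvent hX hX hz hz') a) a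
  have e : (star z • (1 : Matrix n n ℂ) - X) - (z • (1 : Matrix n n ℂ) - X)
      = (star z - z) • (1 : Matrix n n ℂ) := by rw [sub_smul]; abel
  rw [e, mul_smul_comm, mul_one, smul_mul_assoc, Matrix.smul_apply, Matrix.mul_apply,
    Matrix.sub_apply, star_resolvent_apply hX] at h
  simp_rw [star_resolvent_apply hX, Complex.star_def, Complex.mul_conj'] at h
  have e2 : (∑ b, ((‖resolventMatrix X z a b‖ : ℂ)) ^ 2)
      = ((∑ b, ‖resolventMatrix X z a b‖ ^ 2 : ℝ) : ℂ) := by push_cast; rfl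
  rw [e2] at h
  have h' := congrArg Complex.im h
  simp only [Complex.sub_im, Complex.conj_im, smul_eq_mul, Complex.im_mul_ofReal] at h'
  linarith

/-- The Ward identity for columns. -/
lemma im_resolvent_diag' {X : Matrix n n ℂ} (hX : X.IsHermitian) {z : ℂ} (hz : z.im ≠ 0) (a : n) :
    (resolventMatrix X z a a).im = -z.im * ∑ b, ‖resolventMatrix X z b a‖ ^ 2 := by
  have hz' : (star z).im ≠ 0 := by simpa using hz
  have h := im_resolvent_diag hX hz' a
  simp_rw [star_resolvent_apply hX, norm_star] at h
  simp only [Complex.star_def, Complex.conj_im] at h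
  linarith

/-- The factor `‖R_aa‖` is kept on the right, not replaced by `|Im z|⁻¹`: it cancels an `R_kk⁻¹`
when a row and a column are removed from a trace. -/
lemma sum_row_sq_le_diag {X : Matrix n n ℂ} (hX : X.IsHermitian) {z : ℂ} (hz : z.im ≠ 0) (a : n) :
    ∑ b, ‖resolventMatrix X z a b‖ ^ 2 ≤ |z.im|⁻¹ * ‖resolventMatrix X z a a‖ := by
  have h := congrArg abs (im_resolvent_diag hX hz a)
  rw [abs_mul, abs_neg, abs_of_nonneg (Finset.sum_nonneg fun b _ => by positivity :
    0 ≤ ∑ b, ‖resolventMatrix X z a b‖ ^ 2)] at h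
  have := Complex.abs_im_le_norm (resolventMatrix X z a a)
  rw [inv_mul_eq_div, le_div_iff₀' (abs_pos.mpr hz)]
  linarith

lemma sum_col_sq_le_diag {X : Matrix n n ℂ} (hX : X.IsHermitian) {z : ℂ} (hz : z.im ≠ 0) (a : n) :
    ∑ b, ‖resolventMatrix X z b a‖ ^ 2 ≤ |z.im|⁻¹ * ‖resolventMatrix X z a a‖ := by
  have h1 := im_resolvent_diag hX hz a
  have h2 := im_resolvent_diag' hX hz a
  have h3 := mul_left_cancel₀ (neg_ne_zero.mpr hz) (h1.symm.trans h2)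
  rw [← h3]
  exact sum_row_sq_le_diag hX hz a

/-- The term `b = a` of the Ward sum gives `‖R_aa‖² ≤ |Im z|⁻¹ ‖R_aa‖`. -/
lemma norm_resolvent_diag_le {X : Matrix n n ℂ} (hX : X.IsHermitian) {z : ℂ} (hz : z.im ≠ 0)
    (a : n) : ‖resolventMatrix X z a a‖ ≤ |z.im|⁻¹ := by
  have h1 := sum_row_sq_le_diag hX hz a
  have h2 : ‖resolventMatrix X z a a‖ ^ 2 ≤ ∑ b, ‖resolventMatrix X z a b‖ ^ 2 :=
    Finset.single_le_sum (f := fun b => ‖resolventMatrix X z a b‖ ^ 2)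
      (fun _ _ => by positivity) (Finset.mem_univ a)
  have h3 : 0 ≤ |z.im|⁻¹ := by positivity
  by_contra! h
  have : 0 < ‖resolventMatrix X z a a‖ := h3.trans_lt h
  nlinarith

lemma sum_row_sq_le {X : Matrix n n ℂ} (hX : X.IsHermitian) {z : ℂ} (hz : z.im ≠ 0) (a : n) :
    ∑ b, ‖resolventMatrix X z a b‖ ^ 2 ≤ |z.im|⁻¹ ^ 2 :=
  (sum_row_sq_le_diag hX hz a).trans (by
    rw [sq]; exact mul_le_mul_of_nonneg_left (norm_resolvent_diag_le hX hz a) (by positivity))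

lemma sum_col_sq_le {X : Matrix n n ℂ} (hX : X.IsHermitian) {z : ℂ} (hz : z.im ≠ 0) (a : n) :
    ∑ b, ‖resolventMatrix X z b a‖ ^ 2 ≤ |z.im|⁻¹ ^ 2 :=
  (sum_col_sq_le_diag hX hz a).trans (by
    rw [sq]; exact mul_le_mul_of_nonneg_left (norm_resolvent_diag_le hX hz a) (by positivity))

lemma norm_resolvent_le {X : Matrix n n ℂ} (hX : X.IsHermitian) {z : ℂ} (hz : z.im ≠ 0)
    (a b : n) : ‖resolventMatrix X z a b‖ ≤ |z.im|⁻¹ := by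
  have h2 : ‖resolventMatrix X z a b‖ ^ 2 ≤ ∑ b, ‖resolventMatrix X z a b‖ ^ 2 :=
    Finset.single_le_sum (f := fun b => ‖resolventMatrix X z a b‖ ^ 2)
      (fun _ _ => by positivity) (Finset.mem_univ b)
  exact le_of_sq_le_sq (h2.trans (sum_row_sq_le hX hz a)) (by positivity)

/-- The imaginary part of a diagonal resolvent entry has the sign opposite to that of `Im z`. -/
lemma im_mul_im_resolvent_diag_nonpos {X : Matrix n n ℂ} (hX : X.IsHermitian) {z : ℂ}
    (hz : z.im ≠ 0) (a : n) : z.im * (resolventMatrix X z a a).im ≤ 0 := by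
  rw [im_resolvent_diag hX hz]
  have : 0 ≤ ∑ b, ‖resolventMatrix X z a b‖ ^ 2 := Finset.sum_nonneg fun b _ => by positivity
  nlinarith [mul_nonneg (mul_self_nonneg z.im) this]

/-- If `Im z` and `Im w` have opposite signs then `|z - w|⁻¹ ≤ |Im z|⁻¹`. -/
lemma norm_inv_sub_le {z w : ℂ} (hz : z.im ≠ 0) (hw : z.im * w.im ≤ 0) :
    ‖(z - w)⁻¹‖ ≤ |z.im|⁻¹ := by
  rw [norm_inv]
  apply inv_anti₀ (abs_pos.mpr hz)
  refine le_trans ?_ (Complex.abs_im_le_norm _)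
  rw [Complex.sub_im]
  apply sq_le_sq.mp
  nlinarith [sq_nonneg w.im]

lemma sub_ne_zero_of_im {z w : ℂ} (hz : z.im ≠ 0) (hw : z.im * w.im ≤ 0) : z - w ≠ 0 := by
  intro h
  have : z.im = w.im := by rw [sub_eq_zero.mp h]
  rw [← this] at hw
  exact hz (by nlinarith [sq_nonneg z.im, pow_eq_zero_iff (two_ne_zero) (a := z.im)])

/-! ### Removing a row and a column -/

lemma zeroOut_row {X : Matrix n n ℂ} (k b : n) : zeroOut k X k b = 0 := by simp [zeroOut]

lemma zeroOut_col {X : Matrix n n ℂ} (k a : n) : zeroOut k X a k = 0 := by simp [zeroOut]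

lemma zeroOut_apply {X : Matrix n n ℂ} {k a b : n} (ha : a ≠ k) (hb : b ≠ k) :
    zeroOut k X a b = X a b := by simp [zeroOut, ha, hb]

/-- Zeroing row and column `k` instead of deleting them keeps the index type. The matrix becomes
block diagonal, with a `1 × 1` zero block at `k`, so its resolvent does not couple `k` to other
indices; its entry at `(k, k)` is `z⁻¹`. -/
lemma resolvent_zeroOut_row {X : Matrix n n ℂ} (hX : X.IsHermitian) {z : ℂ} (hz : z.im ≠ 0)
    {k j : n} (hj : j ≠ k) : resolventMatrix (zeroOut k X) z k j = 0 := by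
  have h := congrFun (congrFun (sub_mul_resolvent (isHermitian_zeroOut hX k) hz) k) j
  rw [sub_mul, smul_mul_assoc, one_mul, Matrix.sub_apply, Matrix.mul_apply] at h
  simp only [zeroOut_row, zero_mul, Finset.sum_const_zero, sub_zero, Matrix.smul_apply,
    smul_eq_mul, Matrix.one_apply_ne hj.symm] at h
  exact (mul_eq_zero.mp h).resolve_left (fun h0 => hz (by simp [h0]))

lemma resolvent_zeroOut_col {X : Matrix n n ℂ} (hX : X.IsHermitian) {z : ℂ} (hz : z.im ≠ 0)
    {k j : n} (hj : j ≠ k) : resolventMatrix (zeroOut k X) z j k = 0 := by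
  have h := congrFun (congrFun (resolvent_mul_sub (isHermitian_zeroOut hX k) hz) j) k
  rw [mul_sub, mul_smul_comm, mul_one, Matrix.sub_apply, Matrix.mul_apply] at h
  simp only [zeroOut_col, mul_zero, Finset.sum_const_zero, sub_zero, Matrix.smul_apply,
    smul_eq_mul, Matrix.one_apply_ne hj] at h
  exact (mul_eq_zero.mp h).resolve_left (fun h0 => hz (by simp [h0]))

/-- Row `k` of `X` with its diagonal entry replaced by zero. -/
def offRow (k : n) (X : Matrix n n ℂ) : n → ℂ := Function.update (X k) k 0

/-- The linear form `∑_b X_kb R^{(k)}_bj` in row `k`. -/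
def rowForm (k : n) (X : Matrix n n ℂ) (z : ℂ) (j : n) : ℂ :=
  ∑ b, offRow k X b * resolventMatrix (zeroOut k X) z b j

/-- The linear form `∑_b R^{(k)}_ib X_bk` in column `k`. -/
def colForm (k : n) (X : Matrix n n ℂ) (z : ℂ) (i : n) : ℂ :=
  ∑ b, star (offRow k X b) * resolventMatrix (zeroOut k X) z i b

lemma offRow_mul {X : Matrix n n ℂ} (hX : X.IsHermitian) {z : ℂ} (hz : z.im ≠ 0)
    {k j : n} (hj : j ≠ k) (b : n) :
    X k b * resolventMatrix (zeroOut k X) z b j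
      = offRow k X b * resolventMatrix (zeroOut k X) z b j := by
  by_cases hb : b = k
  · subst hb; rw [resolvent_zeroOut_row hX hz hj]; simp
  · rw [offRow, Function.update_of_ne hb]

lemma offRow_mul' {X : Matrix n n ℂ} (hX : X.IsHermitian) {z : ℂ} (hz : z.im ≠ 0)
    {k j : n} (hj : j ≠ k) (b : n) :
    resolventMatrix (zeroOut k X) z j b * X b k
      = star (offRow k X b) * resolventMatrix (zeroOut k X) z j b := by
  by_cases hb : b = k
  · subst hb; rw [resolvent_zeroOut_col hX hz hj]; simp
  · rw [offRow, Function.update_of_ne hb, hX.apply, mul_comm]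

lemma sub_zeroOut_mul {X : Matrix n n ℂ} (hX : X.IsHermitian) {z : ℂ} (hz : z.im ≠ 0)
    {k j : n} (hj : j ≠ k) (a : n) :
    ((X - zeroOut k X) * resolventMatrix (zeroOut k X) z) a j
      = if a = k then rowForm k X z j else 0 := by
  rw [Matrix.mul_apply]
  split_ifs with h
  · subst h
    refine Finset.sum_congr rfl fun b _ => ?_
    rw [Matrix.sub_apply, zeroOut_row, sub_zero, offRow_mul hX hz hj]
  · refine Finset.sum_eq_zero fun b _ => ?_
    by_cases hb : b = k
    · rw [hb, resolvent_zeroOut_row hX hz hj, mul_zero]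
    · rw [Matrix.sub_apply, zeroOut_apply h hb, sub_self, zero_mul]

lemma mul_sub_zeroOut {X : Matrix n n ℂ} (hX : X.IsHermitian) {z : ℂ} (hz : z.im ≠ 0)
    {k i : n} (hi : i ≠ k) (b : n) :
    (resolventMatrix (zeroOut k X) z * (X - zeroOut k X)) i b
      = if b = k then colForm k X z i else 0 := by
  rw [Matrix.mul_apply]
  split_ifs with h
  · subst h
    refine Finset.sum_congr rfl fun a _ => ?_
    rw [Matrix.sub_apply, zeroOut_col, sub_zero, offRow_mul' hX hz hi]
  · refine Finset.sum_eq_zero fun a _ => ?_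
    by_cases ha : a = k
    · rw [ha, resolvent_zeroOut_col hX hz hi, zero_mul]
    · rw [Matrix.sub_apply, zeroOut_apply ha h, sub_self, mul_zero]

/-- By the resolvent identity the difference is `R (X - X^(k)) R^(k)`, and column `j ≠ k` of `(X -
X^(k)) R^(k)` lives in row `k` only. -/
lemma resolvent_sub_minor {X : Matrix n n ℂ} (hX : X.IsHermitian) {z : ℂ} (hz : z.im ≠ 0)
    {k j : n} (hj : j ≠ k) (i : n) :
    resolventMatrix X z i j - resolventMatrix (zeroOut k X) z i j
      = resolventMatrix X z i k * rowForm k X z j := by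
  have h := congrFun (congrFun
    (resolvent_sub_resolvent hX (isHermitian_zeroOut hX k) hz hz) i) j
  rw [sub_sub_sub_cancel_left, mul_assoc, Matrix.mul_apply, Matrix.sub_apply] at h
  simp_rw [sub_zeroOut_mul hX hz hj] at h
  simpa using h

lemma resolvent_row {X : Matrix n n ℂ} (hX : X.IsHermitian) {z : ℂ} (hz : z.im ≠ 0)
    {k j : n} (hj : j ≠ k) :
    resolventMatrix X z k j = resolventMatrix X z k k * rowForm k X z j := by
  rw [← resolvent_sub_minor hX hz hj, resolvent_zeroOut_row hX hz hj, sub_zero]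

lemma resolvent_col {X : Matrix n n ℂ} (hX : X.IsHermitian) {z : ℂ} (hz : z.im ≠ 0)
    {k i : n} (hi : i ≠ k) :
    resolventMatrix X z i k = resolventMatrix X z k k * colForm k X z i := by
  have h := congrFun (congrFun
    (resolvent_sub_resolvent (isHermitian_zeroOut hX k) hX hz hz) i) k
  rw [sub_sub_sub_cancel_left, Matrix.mul_apply, Matrix.sub_apply,
    resolvent_zeroOut_col hX hz hi] at h
  rw [← neg_sub X, mul_neg] at h
  simp_rw [Matrix.neg_apply, mul_sub_zeroOut hX hz hi] at h
  simp only [zero_sub, neg_mul, ite_mul, zero_mul, Finset.sum_neg_distrib,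
    Finset.sum_ite_eq', Finset.mem_univ, if_true, neg_inj] at h
  rw [h, mul_comm]

/-- The quadratic form `∑ y_a M_ab conj(y_b)`. -/
def quadForm (M : Matrix n n ℂ) (y : n → ℂ) : ℂ := ∑ a, ∑ b, y a * M a b * star (y b)

/-- Schur's complement formula. -/
lemma resolvent_diag_mul {X : Matrix n n ℂ} (hX : X.IsHermitian) {z : ℂ} (hz : z.im ≠ 0) (k : n) :
    resolventMatrix X z k k
      * (z - X k k - quadForm (resolventMatrix (zeroOut k X) z) (offRow k X)) = 1 := by
  have h := congrFun (congrFun (sub_mul_resolvent hX hz) k) k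
  rw [sub_mul, smul_mul_assoc, one_mul, Matrix.sub_apply, Matrix.mul_apply,
    Matrix.one_apply_eq, Matrix.smul_apply, smul_eq_mul] at h
  have e : ∑ a, X k a * resolventMatrix X z a k = resolventMatrix X z k k *
      (X k k + quadForm (resolventMatrix (zeroOut k X) z) (offRow k X)) := by
    -- `R^(k)_kk` is not zero; the term `a = k` is absent because `offRow` vanishes at `k`.
    have e0 : ∑ b, offRow k X k * resolventMatrix (zeroOut k X) z k b * star (offRow k X b) = 0 :=
      Finset.sum_eq_zero fun b _ => by simp [offRow]
    have e1 : quadForm (resolventMatrix (zeroOut k X) z) (offRow k X)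
        = ∑ a ∈ Finset.univ.erase k,
          ∑ b, offRow k X a * resolventMatrix (zeroOut k X) z a b * star (offRow k X b) := by
      unfold quadForm
      rw [← Finset.add_sum_erase _ _ (Finset.mem_univ k), e0, zero_add]
    rw [← Finset.add_sum_erase _ _ (Finset.mem_univ k), mul_add, mul_comm (X k k), e1,
      Finset.mul_sum]
    congr 1
    refine Finset.sum_congr rfl fun a ha => ?_
    have hak := Finset.ne_of_mem_erase ha
    rw [resolvent_col hX hz hak, colForm, Finset.mul_sum, Finset.mul_sum, Finset.mul_sum]
    refine Finset.sum_congr rfl fun b _ => ?_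
    rw [offRow, Function.update_of_ne hak]
    ring
  rw [e] at h
  linear_combination h

lemma resolvent_diag_ne_zero {X : Matrix n n ℂ} (hX : X.IsHermitian) {z : ℂ} (hz : z.im ≠ 0)
    (k : n) : resolventMatrix X z k k ≠ 0 :=
  left_ne_zero_of_mul_eq_one (resolvent_diag_mul hX hz k)

/-- Removing a row and a column changes a weighted trace of the resolvent by a bounded amount. -/
lemma norm_weighted_trace_sub_le {X : Matrix n n ℂ} (hX : X.IsHermitian) {z : ℂ} (hz : z.im ≠ 0)
    (k : n) (v : n → ℝ) {r : ℝ} (hv0 : ∀ a, 0 ≤ v a) (hv : ∀ a, v a ≤ r) :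
    ‖∑ a, (v a : ℂ) * resolventMatrix X z a a
      - ∑ a ∈ Finset.univ.erase k, (v a : ℂ) * resolventMatrix (zeroOut k X) z a a‖
      ≤ r * |z.im|⁻¹ := by
  set R := resolventMatrix X z with hR
  have hk : R k k ≠ 0 := resolvent_diag_ne_zero hX hz k
  have hr : 0 ≤ r := (hv0 k).trans (hv k)
  -- For `a ≠ k` one has `R_aa - R^(k)_aa = R_ak R_ka / R_kk`, and the unmatched term `R_kk` has the
  -- same shape. By the Ward identity the sum on the right is at most `r |Im z|⁻¹ ‖R_kk‖`, which
  -- absorbs `R_kk⁻¹`.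
  have e : ∑ a, (v a : ℂ) * R a a
      - ∑ a ∈ Finset.univ.erase k, (v a : ℂ) * resolventMatrix (zeroOut k X) z a a
      = (R k k)⁻¹ * ∑ a, (v a : ℂ) * (R a k * R k a) := by
    rw [← Finset.add_sum_erase _ _ (Finset.mem_univ k), add_sub_assoc, ← Finset.sum_sub_distrib,
      Finset.mul_sum, ← Finset.add_sum_erase (Finset.univ : Finset n) _ (Finset.mem_univ k)]
    congr 1
    · field_simp
    · refine Finset.sum_congr rfl fun a ha => ?_
      have hak := Finset.ne_of_mem_erase ha
      rw [← mul_sub, resolvent_sub_minor hX hz hak, hR, resolvent_row hX hz hak, ← hR]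
      field_simp
  rw [e, norm_mul, norm_inv, inv_mul_le_iff₀ (norm_pos_iff.mpr hk)]
  calc ‖∑ a, (v a : ℂ) * (R a k * R k a)‖ ≤ ∑ a, r * ((‖R a k‖ ^ 2 + ‖R k a‖ ^ 2) / 2) := by
        refine norm_sum_le_of_le _ fun a _ => ?_
        rw [norm_mul, norm_mul, Complex.norm_real, Real.norm_of_nonneg (hv0 a)]
        exact mul_le_mul (hv a) (by nlinarith [sq_nonneg (‖R a k‖ - ‖R k a‖)]) (by positivity) hr
    _ = r * ((∑ a, ‖R a k‖ ^ 2 + ∑ a, ‖R k a‖ ^ 2) / 2) := by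
        rw [← Finset.mul_sum, ← Finset.sum_div, Finset.sum_add_distrib]
    _ ≤ ‖R k k‖ * (r * |z.im|⁻¹) := by
        have h1 := sum_row_sq_le_diag hX hz k
        have h2 := sum_col_sq_le_diag hX hz k
        rw [← hR] at h1 h2
        nlinarith

end Resolvent

/-! ### Moment inequalities -/

section Moments

variable {Ω : Type*} [MeasurableSpace Ω] {μ : Measure Ω}

/-- Cauchy–Schwarz through the weighted inequality between arithmetic and geometric means. The
weights contain `A / B`, so both numbers are shifted by `ε > 0` to allow zero. -/
lemma integral_mul_le_of_sq_le {f g : Ω → ℝ} (hf : MemLp f 2 μ) (hg : MemLp g 2 μ) {A B : ℝ}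
    (hA : 0 ≤ A) (hB : 0 ≤ B) (hfA : ∫ ω, f ω ^ 2 ∂μ ≤ A ^ 2) (hgB : ∫ ω, g ω ^ 2 ∂μ ≤ B ^ 2) :
    ∫ ω, f ω * g ω ∂μ ≤ A * B := by
  have key : ∀ ε : ℝ, 0 < ε → ∫ ω, f ω * g ω ∂μ ≤ (A + ε) * (B + ε) := by
    intro ε hε
    have ha : 0 < A + ε := by linarith
    have hb : 0 < B + ε := by linarith
    have h1 : ∀ ω, f ω * g ω ≤ (B + ε) / (2 * (A + ε)) * f ω ^ 2
        + (A + ε) / (2 * (B + ε)) * g ω ^ 2 := by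
      intro ω
      have h2 : (B + ε) / (2 * (A + ε)) * f ω ^ 2 + (A + ε) / (2 * (B + ε)) * g ω ^ 2
          - f ω * g ω = ((B + ε) * f ω - (A + ε) * g ω) ^ 2 / (2 * (A + ε) * (B + ε)) := by
        field_simp
        ring
      have h3 : 0 ≤ ((B + ε) * f ω - (A + ε) * g ω) ^ 2 / (2 * (A + ε) * (B + ε)) := by positivity
      linarith
    calc ∫ ω, f ω * g ω ∂μ ≤ ∫ ω, ((B + ε) / (2 * (A + ε)) * f ω ^ 2
          + (A + ε) / (2 * (B + ε)) * g ω ^ 2) ∂μ :=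
          integral_mono (hf.integrable_mul hg)
            ((hf.integrable_sq.const_mul _).add (hg.integrable_sq.const_mul _)) h1
      _ = (B + ε) / (2 * (A + ε)) * ∫ ω, f ω ^ 2 ∂μ
          + (A + ε) / (2 * (B + ε)) * ∫ ω, g ω ^ 2 ∂μ := by
          rw [integral_add (hf.integrable_sq.const_mul _) (hg.integrable_sq.const_mul _),
            integral_const_mul, integral_const_mul]
      _ ≤ (B + ε) / (2 * (A + ε)) * (A + ε) ^ 2 + (A + ε) / (2 * (B + ε)) * (B + ε) ^ 2 := by
          gcongr
          · exact hfA.trans (by gcongr; linarith)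
          · exact hgB.trans (by gcongr; linarith)
      _ = (A + ε) * (B + ε) := by field_simp; ring
  have lim : Filter.Tendsto (fun ε : ℝ => (A + ε) * (B + ε)) (nhdsWithin 0 (Set.Ioi 0))
      (nhds (A * B)) := by
    have : Continuous fun ε : ℝ => (A + ε) * (B + ε) := by fun_prop
    simpa using (this.tendsto 0).mono_left nhdsWithin_le_nhds
  exact ge_of_tendsto lim (eventually_nhdsWithin_of_forall key)

lemma integral_le_of_sq_le [IsProbabilityMeasure μ] {f : Ω → ℝ} (hf : MemLp f 2 μ) {A : ℝ}
    (hA : 0 ≤ A) (hfA : ∫ ω, f ω ^ 2 ∂μ ≤ A ^ 2) : ∫ ω, f ω ∂μ ≤ A := by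
  simpa using integral_mul_le_of_sq_le hf (memLp_const (1 : ℝ)) hA zero_le_one hfA (by simp)

lemma integrable_norm_pow_four {f : Ω → ℂ} (hf : MemLp f 4 μ) :
    Integrable (fun ω => ‖f ω‖ ^ 4) μ :=
  MemLp.integrable_norm_pow (p := 4) (by exact_mod_cast hf) (by norm_num)

lemma memLp_two_mul {f g : Ω → ℂ} (hf : MemLp f 4 μ) (hg : MemLp g 4 μ) :
    MemLp (fun ω => f ω * g ω) 2 μ := by
  refine (memLp_two_iff_integrable_sq_norm (f := fun ω => f ω * g ω) (hf.1.mul hg.1)).2 ?_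
  refine ((integrable_norm_pow_four hf).add (integrable_norm_pow_four hg)).mono'
    ((hf.1.mul hg.1).norm.pow 2) (ae_of_all _ fun ω => ?_)
  rw [norm_pow, norm_norm, norm_mul, Pi.add_apply]
  nlinarith [sq_nonneg (‖f ω‖ ^ 2 - ‖g ω‖ ^ 2), sq_nonneg (‖f ω‖ ^ 2 + ‖g ω‖ ^ 2)]

lemma memLp_two_norm_sq {f : Ω → ℂ} (hf : MemLp f 4 μ) : MemLp (fun ω => ‖f ω‖ ^ 2) 2 μ := by
  have := (memLp_two_mul hf hf).norm
  simpa [sq] using this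

end Moments

/-! ### Linear and quadratic forms in independent random variables -/

/-- The entries of `y` are independent and centered, with fourth moments at most `r ^ 4`. -/
structure IsCenteredFamily {ι : Type*} [Fintype ι] {Ω : Type*} [MeasurableSpace Ω] (μ : Measure Ω)
    (y : Ω → ι → ℂ) (r : ℝ) : Prop where
  nonneg : 0 ≤ r
  measurable : Measurable y
  indep : iIndepFun (fun a ω => y ω a) μ
  mean : ∀ a, ∫ ω, y ω a ∂μ = 0
  memLp : ∀ a, MemLp (fun ω => y ω a) 4 μ
  fourth : ∀ a, ∫ ω, ‖y ω a‖ ^ 4 ∂μ ≤ r ^ 4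

/-- The linear form with coefficients `c`. -/
def linForm {ι : Type*} [Fintype ι] (c y : ι → ℂ) : ℂ := ∑ b, y b * c b

lemma measurable_linForm {ι : Type*} [Fintype ι] (c : ι → ℂ) : Measurable (linForm c) := by
  unfold linForm; fun_prop

lemma measurable_quadForm {ι : Type*} [Fintype ι] (M : Matrix ι ι ℂ) :
    Measurable (quadForm M) := by
  unfold quadForm
  refine Finset.measurable_sum _ fun a _ => Finset.measurable_sum _ fun b _ => ?_
  have : Continuous (star : ℂ → ℂ) := continuous_star
  have := this.measurable
  fun_prop

lemma linForm_update {ι : Type*} [Fintype ι] [DecidableEq ι] (c y : ι → ℂ) (a : ι) :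
    linForm c (Function.update y a 0) = linForm (Function.update c a 0) y := by
  unfold linForm
  refine Finset.sum_congr rfl fun b _ => ?_
  by_cases h : b = a
  · subst h; simp
  · simp [h]

lemma linForm_eq_add {ι : Type*} [Fintype ι] [DecidableEq ι] (c y : ι → ℂ) (a : ι) :
    linForm c y = y a * c a + linForm c (Function.update y a 0) := by
  unfold linForm
  rw [← Finset.add_sum_erase _ _ (Finset.mem_univ a),
    ← Finset.add_sum_erase Finset.univ (fun b => Function.update y a 0 b * c b)
      (Finset.mem_univ a)]
  have : ∑ x ∈ Finset.univ.erase a, Function.update y a 0 x * c x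
      = ∑ x ∈ Finset.univ.erase a, y x * c x :=
    Finset.sum_congr rfl fun b hb => by rw [Function.update_of_ne (Finset.ne_of_mem_erase hb)]
  simp [this]

lemma sum_update_sq_le {ι : Type*} [Fintype ι] [DecidableEq ι] (c : ι → ℂ) (a : ι) :
    ∑ b, ‖Function.update c a 0 b‖ ^ 2 ≤ ∑ b, ‖c b‖ ^ 2 := by
  refine Finset.sum_le_sum fun b _ => ?_
  by_cases h : b = a
  · subst h; simp
  · simp [h]

/-- Each row `a` is split into its diagonal term and a product of `y a` with a linear form in the
other coordinates. The split is not triangular: both `(a, b)` and `(b, a)` remain, each in its own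
row. -/
lemma quadForm_eq_sum {ι : Type*} [Fintype ι] [DecidableEq ι] (M : Matrix ι ι ℂ) (y : ι → ℂ) :
    quadForm M y = ∑ a, ((‖y a‖ ^ 2 : ℝ) * M a a
      + y a * star (linForm (fun b => star (M a b)) (Function.update y a 0))) := by
  unfold quadForm
  refine Finset.sum_congr rfl fun a _ => ?_
  have h := linForm_eq_add (fun b => star (M a b)) y a
  have h1 : ∑ b, y a * M a b * star (y b) = y a * star (linForm (fun b => star (M a b)) y) := by
    unfold linForm
    rw [star_sum, Finset.mul_sum]
    refine Finset.sum_congr rfl fun b _ => ?_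
    simp only [star_mul', star_star]; ring
  have h2 : ((‖y a‖ ^ 2 : ℝ) : ℂ) = y a * star (y a) := by
    rw [Complex.star_def, Complex.mul_conj']; push_cast; rfl
  rw [h1, h, h2, star_add, star_mul', star_star]
  ring

lemma quadForm_update {ι : Type*} [Fintype ι] [DecidableEq ι] (M : Matrix ι ι ℂ) (y : ι → ℂ)
    (a : ι) :
    quadForm M y - quadForm M (Function.update y a 0) = (‖y a‖ ^ 2 : ℝ) * M a a
      + y a * star (linForm (fun b => star (M a b)) (Function.update y a 0))
      + star (y a) * linForm (fun b => M b a) (Function.update y a 0) := by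
  have key : ∀ y : ι → ℂ, quadForm M y = ∑ b, y b * star (linForm (fun d => star (M b d)) y) := by
    intro y
    unfold quadForm linForm
    refine Finset.sum_congr rfl fun a _ => ?_
    rw [star_sum, Finset.mul_sum]
    refine Finset.sum_congr rfl fun b _ => ?_
    simp only [star_mul', star_star]; ring
  have h2 : ((‖y a‖ ^ 2 : ℝ) : ℂ) = y a * star (y a) := by
    rw [Complex.star_def, Complex.mul_conj']; push_cast; rfl
  rw [key y, key (Function.update y a 0), h2]
  have h3 : ∀ b, y b * star (linForm (fun d => star (M b d)) y)
      = y b * (star (y a) * M b a)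
        + y b * star (linForm (fun d => star (M b d)) (Function.update y a 0)) := by
    intro b
    rw [linForm_eq_add _ y a, star_add, star_mul', star_star]; ring
  simp_rw [h3]
  rw [Finset.sum_add_distrib]
  have h4 : ∑ b, y b * (star (y a) * M b a) = star (y a) * linForm (fun b => M b a) y := by
    unfold linForm; rw [Finset.mul_sum]; exact Finset.sum_congr rfl fun b _ => by ring
  have h5 := linForm_eq_add (fun b => star (linForm (fun d => star (M b d))
    (Function.update y a 0))) y a
  unfold linForm at h5 h4 ⊢
  rw [h4, h5]
  have h6 := linForm_eq_add (fun b => M b a) y a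
  unfold linForm at h6
  rw [h6]
  ring

/-! ### Leaving out one coordinate of an independent family -/

section Chaos

variable {ι : Type*} [Fintype ι] [DecidableEq ι] {Ω : Type*} [MeasurableSpace Ω] {μ : Measure Ω}
  [IsProbabilityMeasure μ] {y : Ω → ι → ℂ} {r : ℝ}

namespace IsCenteredFamily

lemma measurable_coord (h : IsCenteredFamily μ y r) (a : ι) : Measurable fun ω => y ω a :=
  (measurable_pi_apply a).comp h.measurable

lemma measurable_update (h : IsCenteredFamily μ y r) (a : ι) :
    Measurable fun ω => Function.update (y ω) a 0 := by
  refine measurable_pi_lambda _ fun b => ?_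
  by_cases hb : b = a
  · subst hb; simp
  · simpa [hb] using h.measurable_coord b

end IsCenteredFamily

/-- The vector with coordinate `a` set to zero is a function of the remaining coordinates, while
still indexed by all of `ι`. -/
lemma indepFun_update {y : Ω → ι → ℂ} (hm : Measurable y) (h : iIndepFun (fun a ω => y ω a) μ)
    (a : ι) : IndepFun (fun ω => y ω a) (fun ω => Function.update (y ω) a 0) μ := by
  have h1 := h.indepFun_finset {a} (Finset.univ.erase a) (by simp)
    (fun b => (measurable_pi_apply b).comp hm)
  have hφ : Measurable fun w : (↥({a} : Finset ι) → ℂ) => w ⟨a, by simp⟩ := measurable_pi_apply _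
  have hψ : Measurable fun (w : ↥(Finset.univ.erase a) → ℂ) (b : ι) =>
      if hb : b ∈ Finset.univ.erase a then w ⟨b, hb⟩ else 0 := by
    refine measurable_pi_lambda _ fun b => ?_
    by_cases hb : b ∈ Finset.univ.erase a
    · simp only [hb, dif_pos]; exact measurable_pi_apply _
    · simp only [hb, dif_neg, not_false_eq_true]; exact measurable_const
  have h2 := h1.comp hφ hψ
  refine h2.congr (ae_of_all _ fun ω => rfl) (ae_of_all _ fun ω => ?_)
  funext b
  by_cases hb : b = a
  · subst hb; simp
  · simp [hb]

namespace IsCenteredFamily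

variable {𝕜 : Type*} [RCLike 𝕜]

lemma integrable_mul_update (h : IsCenteredFamily μ y r) (a : ι) {v : ℂ → 𝕜} {w : (ι → ℂ) → 𝕜}
    (hv : Measurable v) (hw : Measurable w) (iv : Integrable (fun ω => v (y ω a)) μ)
    (iw : Integrable (fun ω => w (Function.update (y ω) a 0)) μ) :
    Integrable (fun ω => v (y ω a) * w (Function.update (y ω) a 0)) μ :=
  ((indepFun_update h.measurable h.indep a).comp hv hw).integrable_mul iv iw

lemma integral_mul_update (h : IsCenteredFamily μ y r) (a : ι) {v : ℂ → 𝕜} {w : (ι → ℂ) → 𝕜}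
    (hv : Measurable v) (hw : Measurable w) :
    ∫ ω, v (y ω a) * w (Function.update (y ω) a 0) ∂μ
      = (∫ ω, v (y ω a) ∂μ) * ∫ ω, w (Function.update (y ω) a 0) ∂μ :=
  (indepFun_update h.measurable h.indep a).integral_fun_comp_mul_comp
    (h.measurable_coord a).aemeasurable (h.measurable_update a).aemeasurable
    hv.aestronglyMeasurable hw.aestronglyMeasurable

lemma memLp_two (h : IsCenteredFamily μ y r) (a : ι) : MemLp (fun ω => y ω a) 2 μ :=
  (h.memLp a).mono_exponent (by norm_num)

lemma integrable_coord (h : IsCenteredFamily μ y r) (a : ι) : Integrable (fun ω => y ω a) μ :=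
  (h.memLp_two a).integrable one_le_two

lemma integrable_sq (h : IsCenteredFamily μ y r) (a : ι) :
    Integrable (fun ω => ‖y ω a‖ ^ 2) μ := (h.memLp_two a).norm.integrable_sq

lemma second (h : IsCenteredFamily μ y r) (a : ι) : ∫ ω, ‖y ω a‖ ^ 2 ∂μ ≤ r ^ 2 := by
  refine integral_le_of_sq_le (memLp_two_norm_sq (h.memLp a)) (by positivity) ?_
  simp_rw [← pow_mul]
  exact h.fourth a

lemma first (h : IsCenteredFamily μ y r) (a : ι) : ∫ ω, ‖y ω a‖ ∂μ ≤ r :=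
  integral_le_of_sq_le (h.memLp_two a).norm h.nonneg (h.second a)

lemma integrable_third (h : IsCenteredFamily μ y r) (a : ι) :
    Integrable (fun ω => ‖y ω a‖ ^ 3) μ := by
  have := (h.memLp_two a).norm.integrable_mul (memLp_two_norm_sq (h.memLp a))
  refine this.congr (ae_of_all _ fun ω => ?_)
  simp only [Pi.mul_apply]; ring

lemma third (h : IsCenteredFamily μ y r) (a : ι) : ∫ ω, ‖y ω a‖ ^ 3 ∂μ ≤ r ^ 3 := by
  have := integral_mul_le_of_sq_le (h.memLp_two a).norm (memLp_two_norm_sq (h.memLp a))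
    h.nonneg (sq_nonneg r) (h.second a) (by simp_rw [← pow_mul]; exact h.fourth a)
  calc ∫ ω, ‖y ω a‖ ^ 3 ∂μ = ∫ ω, ‖y ω a‖ * ‖y ω a‖ ^ 2 ∂μ := by congr 1; ext ω; ring
    _ ≤ r * r ^ 2 := this
    _ = r ^ 3 := by ring

lemma memLp_linForm (h : IsCenteredFamily μ y r) (c : ι → ℂ) :
    MemLp (fun ω => linForm c (y ω)) 4 μ := by
  unfold linForm
  exact memLp_finsetSum _ fun b _ => (h.memLp b).mul_const _

lemma memLp_linForm_update (h : IsCenteredFamily μ y r) (c : ι → ℂ) (a : ι) :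
    MemLp (fun ω => linForm c (Function.update (y ω) a 0)) 4 μ := by
  simp_rw [linForm_update]; exact h.memLp_linForm _

lemma memLp_quadForm (h : IsCenteredFamily μ y r) (M : Matrix ι ι ℂ) :
    MemLp (fun ω => quadForm M (y ω)) 2 μ := by
  unfold quadForm
  exact memLp_finsetSum _ fun a _ => memLp_finsetSum _ fun b _ =>
    memLp_two_mul ((h.memLp a).mul_const _) (h.memLp b).star

end IsCenteredFamily

/-- The leave-one-out bound: if `d a` is orthogonal to `K' a` for every `a`, then
`𝔼 (∑ d a) K` is controlled by the differences `K - K' a`. -/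
lemma norm_integral_sum_mul_le {d K' : ι → Ω → ℂ} {K : Ω → ℂ}
    (hK : ∀ a, Integrable (fun ω => d a ω * K ω) μ)
    (hK' : ∀ a, Integrable (fun ω => d a ω * K' a ω) μ)
    (h0 : ∀ a, ∫ ω, d a ω * K' a ω ∂μ = 0) :
    ‖∫ ω, (∑ a, d a ω) * K ω ∂μ‖ ≤ ∑ a, ∫ ω, ‖d a ω‖ * ‖K ω - K' a ω‖ ∂μ := by
  simp_rw [Finset.sum_mul]
  rw [integral_finsetSum _ fun a _ => hK a]
  refine norm_sum_le_of_le _ fun a _ => ?_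
  have : ∫ ω, d a ω * K ω ∂μ = ∫ ω, d a ω * (K ω - K' a ω) ∂μ := by
    simp_rw [mul_sub]
    rw [integral_sub (hK a) (hK' a), h0, sub_zero]
  rw [this]
  refine (norm_integral_le_integral_norm _).trans (le_of_eq ?_)
  simp_rw [norm_mul]

end Chaos

/-! ### Second moments of quadratic forms and fourth moments of linear forms -/

section QuadraticChaos

variable {ι : Type*} [Fintype ι] [DecidableEq ι]

/-- The quadratic form `quadForm M` minus its mean, when the entries have variances `v`. -/
def centeredQuad (v : ι → ℝ) (M : Matrix ι ι ℂ) (y : ι → ℂ) : ℂ :=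
  quadForm M y - ∑ a, (v a : ℂ) * M a a

/-- The part of `centeredQuad` which is attached to row `a`. -/
def chaosTerm (v : ι → ℝ) (M : Matrix ι ι ℂ) (a : ι) (y : ι → ℂ) : ℂ :=
  ((‖y a‖ ^ 2 - v a : ℝ) : ℂ) * M a a
    + y a * star (linForm (fun b => star (M a b)) (Function.update y a 0))

/-- A bound for `chaosTerm` and for the effect of the coordinate `a` on `centeredQuad`. -/
def chaosMajorant (v : ι → ℝ) (M : Matrix ι ι ℂ) (a : ι) (y : ι → ℂ) : ℝ :=
  (‖y a‖ ^ 2 + v a) * ‖M a a‖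
    + ‖y a‖ * (‖linForm (fun b => star (M a b)) (Function.update y a 0)‖
      + ‖linForm (fun b => M b a) (Function.update y a 0)‖)

lemma centeredQuad_eq_sum (v : ι → ℝ) (M : Matrix ι ι ℂ) (y : ι → ℂ) :
    centeredQuad v M y = ∑ a, chaosTerm v M a y := by
  unfold centeredQuad chaosTerm
  rw [quadForm_eq_sum, ← Finset.sum_sub_distrib]
  refine Finset.sum_congr rfl fun a _ => ?_
  push_cast
  ring

lemma chaosMajorant_nonneg {v : ι → ℝ} (hv : ∀ a, 0 ≤ v a) (M : Matrix ι ι ℂ) (a : ι) (y : ι → ℂ) :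
    0 ≤ chaosMajorant v M a y := by
  have := hv a
  unfold chaosMajorant
  positivity

lemma norm_chaosTerm_le {v : ι → ℝ} (hv : ∀ a, 0 ≤ v a) (M : Matrix ι ι ℂ) (a : ι) (y : ι → ℂ) :
    ‖chaosTerm v M a y‖ ≤ chaosMajorant v M a y := by
  unfold chaosTerm chaosMajorant
  refine (norm_add_le _ _).trans (add_le_add ?_ ?_)
  · rw [norm_mul, Complex.norm_real]
    gcongr
    rw [Real.norm_eq_abs, abs_le]
    have := hv a
    constructor <;> nlinarith [sq_nonneg ‖y a‖]
  · rw [norm_mul, norm_star]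
    gcongr
    exact le_add_of_nonneg_right (norm_nonneg _)

lemma norm_centeredQuad_sub_update_le {v : ι → ℝ} (hv : ∀ a, 0 ≤ v a) (M : Matrix ι ι ℂ) (a : ι)
    (y : ι → ℂ) :
    ‖centeredQuad v M y - centeredQuad v M (Function.update y a 0)‖ ≤ chaosMajorant v M a y := by
  unfold centeredQuad chaosMajorant
  rw [sub_sub_sub_cancel_right, quadForm_update]
  refine (norm_add_le _ _).trans ((add_le_add_left (norm_add_le _ _) _).trans ?_)
  rw [norm_mul, norm_mul, norm_mul, norm_star, norm_star, Complex.norm_real,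
    Real.norm_of_nonneg (by positivity), add_assoc, ← mul_add]
  gcongr
  exact le_add_of_nonneg_right (hv a)

lemma measurable_update_zero (a : ι) : Measurable fun y : ι → ℂ => Function.update y a 0 := by
  refine measurable_pi_lambda _ fun b => ?_
  by_cases hb : b = a
  · subst hb; simp
  · simpa [hb] using measurable_pi_apply b

lemma measurable_centeredQuad (v : ι → ℝ) (M : Matrix ι ι ℂ) : Measurable (centeredQuad v M) :=
  (measurable_quadForm M).sub_const _

lemma measurable_star_complex : Measurable (star : ℂ → ℂ) := continuous_star.measurable

lemma measurable_chaosTerm (v : ι → ℝ) (M : Matrix ι ι ℂ) (a : ι) :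
    Measurable (chaosTerm v M a) := by
  unfold chaosTerm
  have h1 := measurable_star_complex.comp
    ((measurable_linForm (fun b => star (M a b))).comp (measurable_update_zero a))
  have h2 : Measurable fun y : ι → ℂ => ((‖y a‖ ^ 2 - v a : ℝ) : ℂ) :=
    Complex.measurable_ofReal.comp (by fun_prop)
  exact (h2.mul_const _).add ((measurable_pi_apply a).mul h1)

namespace IsCenteredFamily

variable {Ω : Type*} [MeasurableSpace Ω] {μ : Measure Ω}
  [IsProbabilityMeasure μ] {y : Ω → ι → ℂ} {r : ℝ}

/-- `norm_integral_sum_mul_le` with `K` the conjugate of the form itself: removing coordinate `a`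
changes `K` by the conjugate of `y a * c a`, so only the diagonal terms `𝔼 ‖y a * c a‖²` are left.
-/
lemma integral_sq_linForm_le (h : IsCenteredFamily μ y r) (c : ι → ℂ) :
    ∫ ω, ‖linForm c (y ω)‖ ^ 2 ∂μ ≤ r ^ 2 * ∑ b, ‖c b‖ ^ 2 := by
  have hY : MemLp (fun ω => linForm c (y ω)) 2 μ :=
    (h.memLp_linForm c).mono_exponent (by norm_num)
  have hYa : ∀ a, MemLp (fun ω => linForm c (Function.update (y ω) a 0)) 2 μ := fun a =>
    (h.memLp_linForm_update c a).mono_exponent (by norm_num)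
  have hd : ∀ a, MemLp (fun ω => y ω a * c a) 2 μ := fun a => (h.memLp_two a).mul_const _
  have key := norm_integral_sum_mul_le (μ := μ) (d := fun a ω => y ω a * c a)
    (K := fun ω => star (linForm c (y ω)))
    (K' := fun a ω => star (linForm c (Function.update (y ω) a 0)))
    (fun a => (hd a).integrable_mul hY.star) (fun a => (hd a).integrable_mul (hYa a).star)
    (fun a => by
      rw [h.integral_mul_update a (v := fun x => x * c a) (w := fun x => star (linForm c x))
        (by fun_prop) (measurable_star_complex.comp (measurable_linForm c)), integral_mul_const,
        h.mean, zero_mul, zero_mul])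
  have e : ∫ ω, (∑ a, y ω a * c a) * star (linForm c (y ω)) ∂μ
      = ((∫ ω, ‖linForm c (y ω)‖ ^ 2 ∂μ : ℝ) : ℂ) := by
    rw [← integral_complex_ofReal]
    congr 1; ext ω
    change linForm c (y ω) * _ = _
    rw [Complex.star_def, Complex.mul_conj']; push_cast; rfl
  rw [e, Complex.norm_real] at key
  refine (Real.le_norm_self _).trans (key.trans ?_)
  rw [Finset.mul_sum]
  refine Finset.sum_le_sum fun a _ => ?_
  calc ∫ ω, ‖y ω a * c a‖ * ‖star (linForm c (y ω))
        - star (linForm c (Function.update (y ω) a 0))‖ ∂μ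
      = ∫ ω, ‖y ω a‖ ^ 2 * ‖c a‖ ^ 2 ∂μ := by
        congr 1; ext ω
        rw [← star_sub, norm_star, linForm_eq_add c (y ω) a, add_sub_cancel_right, norm_mul]
        ring
    _ = (∫ ω, ‖y ω a‖ ^ 2 ∂μ) * ‖c a‖ ^ 2 := integral_mul_const _ _
    _ ≤ r ^ 2 * ‖c a‖ ^ 2 := by gcongr; exact h.second a

lemma integral_sq_linForm_update_le (h : IsCenteredFamily μ y r) (c : ι → ℂ) (a : ι) :
    ∫ ω, ‖linForm c (Function.update (y ω) a 0)‖ ^ 2 ∂μ ≤ r ^ 2 * ∑ b, ‖c b‖ ^ 2 := by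
  simp_rw [linForm_update]
  exact (h.integral_sq_linForm_le _).trans
    (mul_le_mul_of_nonneg_left (sum_update_sq_le c a) (sq_nonneg r))

lemma variance_nonneg (a : ι) : 0 ≤ ∫ ω, ‖y ω a‖ ^ 2 ∂μ :=
  integral_nonneg fun _ => sq_nonneg _

lemma memLp_centeredQuad (h : IsCenteredFamily μ y r) (v : ι → ℝ) (M : Matrix ι ι ℂ) :
    MemLp (fun ω => centeredQuad v M (y ω)) 2 μ :=
  (h.memLp_quadForm M).sub (memLp_const _)

lemma integral_sq_sq_add_le (h : IsCenteredFamily μ y r) (a : ι) {v : ℝ} (hv : 0 ≤ v)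
    (hvr : v ≤ r ^ 2) : ∫ ω, (‖y ω a‖ ^ 2 + v) ^ 2 ∂μ ≤ 4 * r ^ 4 := by
  have h4 := integrable_norm_pow_four (h.memLp a)
  calc ∫ ω, (‖y ω a‖ ^ 2 + v) ^ 2 ∂μ ≤ ∫ ω, (2 * ‖y ω a‖ ^ 4 + 2 * v ^ 2) ∂μ := by
        refine integral_mono ((memLp_two_norm_sq (h.memLp a)).add (memLp_const v)).integrable_sq
          ((h4.const_mul 2).add (integrable_const _)) fun ω => ?_
        change (‖y ω a‖ ^ 2 + v) ^ 2 ≤ 2 * ‖y ω a‖ ^ 4 + 2 * v ^ 2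
        nlinarith [sq_nonneg (‖y ω a‖ ^ 2 - v)]
    _ = 2 * ∫ ω, ‖y ω a‖ ^ 4 ∂μ + 2 * v ^ 2 := by
        rw [integral_add (h4.const_mul 2) (integrable_const _), integral_const_mul]; simp
    _ ≤ 4 * r ^ 4 := by nlinarith [h.fourth a]

lemma memLp_linForm_add (h : IsCenteredFamily μ y r) (c c' : ι → ℂ) (a : ι) :
    MemLp (fun ω => ‖linForm c (Function.update (y ω) a 0)‖
      + ‖linForm c' (Function.update (y ω) a 0)‖) 4 μ :=
  (h.memLp_linForm_update c a).norm.add (h.memLp_linForm_update c' a).norm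

lemma integral_sq_linForm_add_le (h : IsCenteredFamily μ y r) {c c' : ι → ℂ} (a : ι) {ρ : ℝ}
    (hc : ∑ b, ‖c b‖ ^ 2 ≤ ρ) (hc' : ∑ b, ‖c' b‖ ^ 2 ≤ ρ) :
    ∫ ω, (‖linForm c (Function.update (y ω) a 0)‖
      + ‖linForm c' (Function.update (y ω) a 0)‖) ^ 2 ∂μ ≤ 4 * r ^ 2 * ρ := by
  have i1 : ∀ c : ι → ℂ, Integrable (fun ω => ‖linForm c (Function.update (y ω) a 0)‖ ^ 2) μ :=
    fun c => ((h.memLp_linForm_update c a).mono_exponent (p := 2) (by norm_num)).norm.integrable_sq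
  calc _ ≤ ∫ ω, (2 * ‖linForm c (Function.update (y ω) a 0)‖ ^ 2
        + 2 * ‖linForm c' (Function.update (y ω) a 0)‖ ^ 2) ∂μ := by
        refine integral_mono ((h.memLp_linForm_add c c' a).mono_exponent
          (p := 2) (by norm_num)).integrable_sq
          (((i1 c).const_mul 2).add ((i1 c').const_mul 2)) fun ω => ?_
        exact (add_sq_le).trans (by linarith)
    _ = 2 * ∫ ω, ‖linForm c (Function.update (y ω) a 0)‖ ^ 2 ∂μ
        + 2 * ∫ ω, ‖linForm c' (Function.update (y ω) a 0)‖ ^ 2 ∂μ := by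
        rw [integral_add ((i1 c).const_mul 2) ((i1 c').const_mul 2), integral_const_mul,
          integral_const_mul]
    _ ≤ 4 * r ^ 2 * ρ := by
        have h1 := h.integral_sq_linForm_update_le c a
        have h2 := h.integral_sq_linForm_update_le c' a
        have h3 := mul_le_mul_of_nonneg_left hc (sq_nonneg r)
        have h4 := mul_le_mul_of_nonneg_left hc' (sq_nonneg r)
        nlinarith

lemma memLp_chaosMajorant (h : IsCenteredFamily μ y r) (v : ι → ℝ) (M : Matrix ι ι ℂ) (a : ι) :
    MemLp (fun ω => chaosMajorant v M a (y ω)) 2 μ := by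
  unfold chaosMajorant
  refine MemLp.add (((memLp_two_norm_sq (h.memLp a)).add (memLp_const _)).mul_const _) ?_
  have h1 := memLp_two_mul (h.memLp a).norm.ofReal
    (h.memLp_linForm_add (fun b => star (M a b)) (fun b => M b a) a).ofReal
  refine h1.norm.congr_norm ?_ (ae_of_all _ fun ω => ?_)
  · have h3 : Measurable fun x : ι → ℂ => ‖x a‖ * (‖linForm (fun b => star (M a b))
        (Function.update x a 0)‖ + ‖linForm (fun b => M b a) (Function.update x a 0)‖) :=
      (measurable_pi_apply a).norm.mul
        (((measurable_linForm _).comp (measurable_update_zero a)).norm.add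
          ((measurable_linForm _).comp (measurable_update_zero a)).norm)
    exact (h3.comp h.measurable).aestronglyMeasurable
  · simp only [norm_mul, RCLike.norm_ofReal, Real.norm_eq_abs,
      abs_abs]

/-- Coordinate `a` is independent of the linear forms in the others, so second moments multiply and
four moments of `y a` suffice. The constant is `2 * 4` from the diagonal part plus `2 * 4` from the
mixed part. -/
lemma integral_sq_chaosMajorant_le (h : IsCenteredFamily μ y r) {v : ι → ℝ} (hv0 : ∀ a, 0 ≤ v a)
    (hv : ∀ a, v a ≤ r ^ 2) {M : Matrix ι ι ℂ} {a : ι} {ρ : ℝ}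
    (hrow : ∑ b, ‖M a b‖ ^ 2 ≤ ρ) (hcol : ∑ b, ‖M b a‖ ^ 2 ≤ ρ) :
    ∫ ω, chaosMajorant v M a (y ω) ^ 2 ∂μ ≤ 16 * r ^ 4 * ρ := by
  set Λ : (ι → ℂ) → ℝ := fun x => ‖linForm (fun b => star (M a b)) x‖
    + ‖linForm (fun b => M b a) x‖ with hΛ
  have hΛm : Measurable Λ := (measurable_linForm _).norm.add (measurable_linForm _).norm
  have hΛ2 : MemLp (fun ω => Λ (Function.update (y ω) a 0)) 2 μ :=
    (h.memLp_linForm_add _ _ a).mono_exponent (by norm_num)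
  have hΛb : ∫ ω, Λ (Function.update (y ω) a 0) ^ 2 ∂μ ≤ 4 * r ^ 2 * ρ :=
    h.integral_sq_linForm_add_le a (by simpa using hrow) hcol
  have hMρ : ‖M a a‖ ^ 2 ≤ ρ := (Finset.single_le_sum (f := fun b => ‖M a b‖ ^ 2)
      (fun _ _ => by positivity) (Finset.mem_univ a)).trans hrow
  have hprod := h.integral_mul_update a (v := fun x => ‖x‖ ^ 2) (w := fun x => Λ x ^ 2)
    (by fun_prop) (hΛm.pow_const 2)
  have iprod := h.integrable_mul_update a (v := fun x => ‖x‖ ^ 2) (w := fun x => Λ x ^ 2)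
    (by fun_prop) (hΛm.pow_const 2) (h.integrable_sq a) hΛ2.integrable_sq
  have i1 : Integrable (fun ω => (‖y ω a‖ ^ 2 + v a) ^ 2) μ :=
    ((memLp_two_norm_sq (h.memLp a)).add (memLp_const (v a))).integrable_sq
  calc ∫ ω, chaosMajorant v M a (y ω) ^ 2 ∂μ
      ≤ ∫ ω, ((‖y ω a‖ ^ 2 + v a) ^ 2 * (2 * ‖M a a‖ ^ 2)
        + 2 * (‖y ω a‖ ^ 2 * Λ (Function.update (y ω) a 0) ^ 2)) ∂μ := by
        refine integral_mono (h.memLp_chaosMajorant v M a).integrable_sq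
          ((i1.mul_const _).add (iprod.const_mul 2)) fun ω => ?_
        unfold chaosMajorant
        refine add_sq_le.trans (le_of_eq ?_)
        simp only [hΛ]; ring
    _ = (∫ ω, (‖y ω a‖ ^ 2 + v a) ^ 2 ∂μ) * (2 * ‖M a a‖ ^ 2)
        + 2 * ((∫ ω, ‖y ω a‖ ^ 2 ∂μ) * ∫ ω, Λ (Function.update (y ω) a 0) ^ 2 ∂μ) := by
        rw [integral_add (i1.mul_const _) (iprod.const_mul 2), integral_mul_const,
          integral_const_mul, hprod]
    _ ≤ (4 * r ^ 4) * (2 * ρ) + 2 * (r ^ 2 * (4 * r ^ 2 * ρ)) := by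
        have := h.integral_sq_sq_add_le a (hv0 a) (hv a)
        have h3 := h.second a
        have h4 : 0 ≤ ∫ ω, Λ (Function.update (y ω) a 0) ^ 2 ∂μ :=
          integral_nonneg fun _ => by positivity
        gcongr
    _ = 16 * r ^ 4 * ρ := by ring

lemma memLp_chaosTerm (h : IsCenteredFamily μ y r) {v : ι → ℝ} (hv : ∀ a, 0 ≤ v a)
    (M : Matrix ι ι ℂ) (a : ι) : MemLp (fun ω => chaosTerm v M a (y ω)) 2 μ :=
  (h.memLp_chaosMajorant v M a).mono
    ((measurable_chaosTerm v M a).comp h.measurable).aestronglyMeasurable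
    (ae_of_all _ fun ω => (norm_chaosTerm_le hv M a _).trans (Real.le_norm_self _))

/-- Every `chaosTerm` is orthogonal to the functions of the remaining coordinates. -/
lemma chaosTerm_mul (h : IsCenteredFamily μ y r) (M : Matrix ι ι ℂ) (a : ι) {K : (ι → ℂ) → ℂ}
    (hK : Measurable K) (iK : Integrable (fun ω => K (Function.update (y ω) a 0)) μ)
    (iLK : Integrable (fun ω => star (linForm (fun b => star (M a b))
      (Function.update (y ω) a 0)) * K (Function.update (y ω) a 0)) μ) :
    Integrable (fun ω => chaosTerm (fun a => ∫ ω, ‖y ω a‖ ^ 2 ∂μ) M a (y ω)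
        * K (Function.update (y ω) a 0)) μ ∧
      ∫ ω, chaosTerm (fun a => ∫ ω, ‖y ω a‖ ^ 2 ∂μ) M a (y ω)
        * K (Function.update (y ω) a 0) ∂μ = 0 := by
  set v : ℝ := ∫ ω, ‖y ω a‖ ^ 2 ∂μ with hv
  have hLm : Measurable fun x => star (linForm (fun b => star (M a b)) x) :=
    measurable_star_complex.comp (measurable_linForm _)
  have m1 : Measurable fun x : ℂ => ((‖x‖ ^ 2 - v : ℝ) : ℂ) * M a a :=
    (Complex.measurable_ofReal.comp (by fun_prop)).mul_const _
  have i0 : Integrable (fun ω => ((‖y ω a‖ ^ 2 - v : ℝ) : ℂ)) μ :=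
    ((h.integrable_sq a).sub (integrable_const v)).ofReal
  have I1 := h.integrable_mul_update a (v := fun x => ((‖x‖ ^ 2 - v : ℝ) : ℂ) * M a a)
    (w := K) m1 hK (i0.mul_const _) iK
  have I2 := h.integrable_mul_update a (v := fun x => x)
    (w := fun x => star (linForm (fun b => star (M a b)) x) * K x) measurable_id (hLm.mul hK)
    (h.integrable_coord a) iLK
  have E1 := h.integral_mul_update a (v := fun x => ((‖x‖ ^ 2 - v : ℝ) : ℂ) * M a a)
    (w := K) m1 hK
  have E2 := h.integral_mul_update a (v := fun x => x)
    (w := fun x => star (linForm (fun b => star (M a b)) x) * K x) measurable_id (hLm.mul hK)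
  have e : ∀ ω, chaosTerm (fun a => ∫ ω, ‖y ω a‖ ^ 2 ∂μ) M a (y ω)
        * K (Function.update (y ω) a 0) = ((‖y ω a‖ ^ 2 - v : ℝ) : ℂ) * M a a
          * K (Function.update (y ω) a 0) + y ω a * (star (linForm (fun b => star (M a b))
            (Function.update (y ω) a 0)) * K (Function.update (y ω) a 0)) := by
    intro ω
    unfold chaosTerm
    change (((‖y ω a‖ ^ 2 - v : ℝ) : ℂ) * _ + _) * _ = _
    ring
  simp_rw [e]
  refine ⟨I1.add I2, ?_⟩
  rw [integral_add I1 I2, E1, E2, h.mean, zero_mul, add_zero, integral_mul_const,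
    integral_complex_ofReal, integral_sub (h.integrable_sq a) (integrable_const v)]
  simp [hv]

/-- The terms of the row decomposition need not be orthogonal to each other, but each is orthogonal
to functions of the other coordinates. With `Q` the centred form and `Q_a` the form without
coordinate `a`, this gives `𝔼 |Q|² ≤ ∑ 𝔼 |d_a| |Q - Q_a|`; both factors are below `chaosMajorant`.
-/
lemma integral_sq_centeredQuad_le (h : IsCenteredFamily μ y r) {M : Matrix ι ι ℂ} {ρ : ι → ℝ}
    (hrow : ∀ a, ∑ b, ‖M a b‖ ^ 2 ≤ ρ a) (hcol : ∀ a, ∑ b, ‖M b a‖ ^ 2 ≤ ρ a) :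
    ∫ ω, ‖centeredQuad (fun a => ∫ ω, ‖y ω a‖ ^ 2 ∂μ) M (y ω)‖ ^ 2 ∂μ
      ≤ 16 * r ^ 4 * ∑ a, ρ a := by
  set v : ι → ℝ := fun a => ∫ ω, ‖y ω a‖ ^ 2 ∂μ with hv
  have hv0 : ∀ a, 0 ≤ v a := fun a => variance_nonneg a
  have hH := h.memLp_centeredQuad v M
  have hHa : ∀ a, MemLp (fun ω => centeredQuad v M (Function.update (y ω) a 0)) 2 μ := by
    intro a
    have h1 := hH.norm.add (h.memLp_chaosMajorant v M a)
    refine h1.mono (((measurable_centeredQuad v M).comp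
      (h.measurable_update a))).aestronglyMeasurable (ae_of_all _ fun ω => ?_)
    refine le_trans ?_ (Real.le_norm_self _)
    have h2 := norm_centeredQuad_sub_update_le hv0 M a (y ω)
    have h3 := norm_sub_norm_le (centeredQuad v M (Function.update (y ω) a 0))
      (centeredQuad v M (y ω))
    rw [norm_sub_rev] at h3
    simp only [Pi.add_apply]
    linarith
  have hd := h.memLp_chaosTerm hv0 M
  have hL : ∀ a, MemLp (fun ω => star (linForm (fun b => star (M a b))
      (Function.update (y ω) a 0))) 2 μ :=
    fun a => ((h.memLp_linForm_update _ a).mono_exponent (by norm_num)).star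
  have orth := fun a => h.chaosTerm_mul M a (K := fun x => star (centeredQuad v M x))
    (measurable_star_complex.comp (measurable_centeredQuad v M))
    ((hHa a).star.integrable one_le_two) ((hL a).integrable_mul (hHa a).star)
  have key := norm_integral_sum_mul_le (μ := μ) (d := fun a ω => chaosTerm v M a (y ω))
    (K := fun ω => star (centeredQuad v M (y ω)))
    (K' := fun a ω => star (centeredQuad v M (Function.update (y ω) a 0)))
    (fun a => (hd a).integrable_mul hH.star) (fun a => (orth a).1) (fun a => (orth a).2)
  have e : ∫ ω, (∑ a, chaosTerm v M a (y ω)) * star (centeredQuad v M (y ω)) ∂μ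
      = ((∫ ω, ‖centeredQuad v M (y ω)‖ ^ 2 ∂μ : ℝ) : ℂ) := by
    rw [← integral_complex_ofReal]
    congr 1; ext ω
    rw [← centeredQuad_eq_sum, Complex.star_def, Complex.mul_conj']; push_cast; rfl
  rw [e, Complex.norm_real] at key
  refine (Real.le_norm_self _).trans (key.trans ?_)
  rw [Finset.mul_sum]
  refine Finset.sum_le_sum fun a _ => ?_
  refine le_trans ?_ (h.integral_sq_chaosMajorant_le hv0 h.second (hrow a) (hcol a))
  refine integral_mono ((hd a).norm.integrable_mul (hH.star.sub (hHa a).star).norm)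
    (h.memLp_chaosMajorant v M a).integrable_sq fun ω => ?_
  simp only [← star_sub, norm_star, sq]
  exact mul_le_mul (norm_chaosTerm_le hv0 M a _) (norm_centeredQuad_sub_update_le hv0 M a _)
    (norm_nonneg _) (chaosMajorant_nonneg hv0 M a _)

/-- `‖linForm c‖²` is the quadratic form of the rank one matrix `c_a conj(c_b)`, so its second
moment is controlled by the centred form and the mean. The constant is `34 = 2 * 16 + 2`. -/
lemma integral_four_linForm_le (h : IsCenteredFamily μ y r) (c : ι → ℂ) :
    ∫ ω, ‖linForm c (y ω)‖ ^ 4 ∂μ ≤ 34 * r ^ 4 * (∑ b, ‖c b‖ ^ 2) ^ 2 := by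
  set v : ι → ℝ := fun a => ∫ ω, ‖y ω a‖ ^ 2 ∂μ with hv
  have hv0 : ∀ a, 0 ≤ v a := fun a => variance_nonneg a
  set M : Matrix ι ι ℂ := Matrix.of fun a b => c a * star (c b) with hM
  set s := ∑ b, ‖c b‖ ^ 2 with hs
  have hs0 : 0 ≤ s := Finset.sum_nonneg fun _ _ => by positivity
  have hrow : ∀ a, ∑ b, ‖M a b‖ ^ 2 ≤ ‖c a‖ ^ 2 * s := fun a => by
    simp only [hM, Matrix.of_apply, norm_mul, norm_star, mul_pow, ← Finset.mul_sum]; exact le_rfl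
  have hcol : ∀ a, ∑ b, ‖M b a‖ ^ 2 ≤ ‖c a‖ ^ 2 * s := fun a => by
    simp only [hM, Matrix.of_apply, norm_mul, norm_star, mul_pow, ← Finset.sum_mul]
    rw [mul_comm]
  have h2 := h.integral_sq_centeredQuad_le hrow hcol
  rw [← Finset.sum_mul, ← hs, ← hv] at h2
  have e : ∀ x, quadForm M x = ((‖linForm c x‖ ^ 2 : ℝ) : ℂ) := by
    intro x
    have e1 : ((‖linForm c x‖ ^ 2 : ℝ) : ℂ) = linForm c x * star (linForm c x) := by
      rw [Complex.star_def, Complex.mul_conj']; push_cast; rfl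
    rw [e1]
    simp only [quadForm, linForm, hM, Matrix.of_apply, star_sum, Finset.sum_mul_sum, star_mul']
    exact Finset.sum_congr rfl fun a _ => Finset.sum_congr rfl fun b _ => by ring
  have hvs : ‖∑ a, (v a : ℂ) * M a a‖ ≤ r ^ 2 * s := by
    rw [hs, Finset.mul_sum]
    refine norm_sum_le_of_le _ fun a _ => ?_
    simp only [hM, Matrix.of_apply, norm_mul, norm_star, Complex.norm_real,
      Real.norm_of_nonneg (hv0 a), ← sq]
    gcongr
    exact h.second a
  have hH := h.memLp_centeredQuad v M
  calc ∫ ω, ‖linForm c (y ω)‖ ^ 4 ∂μ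
      ≤ ∫ ω, (2 * ‖centeredQuad v M (y ω)‖ ^ 2 + 2 * (r ^ 2 * s) ^ 2) ∂μ := by
        refine integral_mono (integrable_norm_pow_four (h.memLp_linForm c))
          ((hH.norm.integrable_sq.const_mul 2).add (integrable_const _)) fun ω => ?_
        have e1 : ‖quadForm M (y ω)‖ = ‖linForm c (y ω)‖ ^ 2 := by
          rw [e, Complex.norm_real, Real.norm_of_nonneg (by positivity)]
        have e2 : ‖quadForm M (y ω)‖ ≤ ‖centeredQuad v M (y ω)‖ + r ^ 2 * s := by
          have := norm_add_le (centeredQuad v M (y ω)) (∑ a, (v a : ℂ) * M a a)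
          rw [centeredQuad, sub_add_cancel] at this
          exact this.trans (add_le_add_right hvs _)
        rw [e1] at e2
        calc ‖linForm c (y ω)‖ ^ 4 = (‖linForm c (y ω)‖ ^ 2) ^ 2 := by ring
          _ ≤ (‖centeredQuad v M (y ω)‖ + r ^ 2 * s) ^ 2 := by gcongr
          _ ≤ _ := add_sq_le.trans (by simp only [mul_add]; exact le_rfl)
    _ = 2 * ∫ ω, ‖centeredQuad v M (y ω)‖ ^ 2 ∂μ + 2 * (r ^ 2 * s) ^ 2 := by
        rw [integral_add (hH.norm.integrable_sq.const_mul 2) (integrable_const _),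
          integral_const_mul]; simp
    _ ≤ 34 * r ^ 4 * s ^ 2 := by nlinarith

end IsCenteredFamily

end QuadraticChaos

/-! ### Mixed moments of a quadratic and a linear form -/

section QuadraticChaosThird

variable {ι : Type*} [Fintype ι] [DecidableEq ι]
variable {Ω : Type*} [MeasurableSpace Ω] {μ : Measure Ω}
  [IsProbabilityMeasure μ] {y : Ω → ι → ℂ} {r : ℝ}

namespace IsCenteredFamily

lemma integral_linForm (h : IsCenteredFamily μ y r) (c : ι → ℂ) :
    ∫ ω, linForm c (y ω) ∂μ = 0 := by
  unfold linForm
  rw [integral_finsetSum _ fun a _ => (h.integrable_coord a).mul_const _]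
  exact Finset.sum_eq_zero fun a _ => by rw [integral_mul_const, h.mean, zero_mul]

lemma integral_linForm_update (h : IsCenteredFamily μ y r) (c : ι → ℂ) (a : ι) :
    ∫ ω, linForm c (Function.update (y ω) a 0) ∂μ = 0 := by
  simp_rw [linForm_update]; exact h.integral_linForm _

lemma memLp_centeredQuad_update (h : IsCenteredFamily μ y r) {v : ι → ℝ} (hv0 : ∀ a, 0 ≤ v a)
    (M : Matrix ι ι ℂ) (a : ι) :
    MemLp (fun ω => centeredQuad v M (Function.update (y ω) a 0)) 2 μ := by
  have h1 := (h.memLp_centeredQuad v M).norm.add (h.memLp_chaosMajorant v M a)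
  refine h1.mono (((measurable_centeredQuad v M).comp
    (h.measurable_update a))).aestronglyMeasurable (ae_of_all _ fun ω => ?_)
  refine le_trans ?_ (Real.le_norm_self _)
  have h2 := norm_centeredQuad_sub_update_le hv0 M a (y ω)
  have h3 := norm_sub_norm_le (centeredQuad v M (Function.update (y ω) a 0))
    (centeredQuad v M (y ω))
  rw [norm_sub_rev] at h3
  simp only [Pi.add_apply]
  linarith

/-- The mixed moment of a centered quadratic form and a linear form only involves the third
moments of the entries. -/
lemma integral_centeredQuad_mul_linForm (h : IsCenteredFamily μ y r) (M : Matrix ι ι ℂ)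
    (c : ι → ℂ) :
    ∫ ω, centeredQuad (fun a => ∫ ω, ‖y ω a‖ ^ 2 ∂μ) M (y ω) * linForm c (y ω) ∂μ
      = ∑ a, (∫ ω, y ω a * (‖y ω a‖ ^ 2 : ℝ) ∂μ) * (M a a * c a) := by
  set v : ι → ℝ := fun a => ∫ ω, ‖y ω a‖ ^ 2 ∂μ with hv
  have hv0 : ∀ a, 0 ≤ v a := fun a => variance_nonneg a
  have hH := h.memLp_centeredQuad v M
  have hHa := h.memLp_centeredQuad_update hv0 M
  have hya := h.memLp_two
  have e : ∀ ω, centeredQuad v M (y ω) * linForm c (y ω)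
      = ∑ a, c a * (y ω a * centeredQuad v M (y ω)) := by
    intro ω; unfold linForm; rw [Finset.mul_sum]; exact Finset.sum_congr rfl fun a _ => by ring
  simp_rw [e]
  have iH : ∀ a, Integrable (fun ω => c a * (y ω a * centeredQuad v M (y ω))) μ :=
    fun a => ((hya a).integrable_mul hH).const_mul _
  rw [integral_finsetSum _ fun a _ => iH a]
  refine Finset.sum_congr rfl fun a _ => ?_
  rw [integral_const_mul]
  have i1 : Integrable (fun ω => y ω a * ((‖y ω a‖ ^ 2 : ℝ) : ℂ)) μ :=
    (hya a).integrable_mul (memLp_two_norm_sq (h.memLp a)).ofReal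
  have hL : ∀ c : ι → ℂ, MemLp (fun ω => linForm c (Function.update (y ω) a 0)) 2 μ := fun c =>
    (h.memLp_linForm_update c a).mono_exponent (by norm_num)
  have isq : Integrable (fun ω => y ω a * y ω a) μ := (hya a).integrable_mul (hya a)
  have isq' : Integrable (fun ω => y ω a * star (y ω a)) μ := (hya a).integrable_mul (hya a).star
  have m1 : Measurable fun x : ℂ => x * star x := measurable_id.mul measurable_star_complex
  have mL : Measurable fun x : ι → ℂ => star (linForm (fun b => star (M a b)) x) :=
    measurable_star_complex.comp (measurable_linForm _)
  have i2 := h.integrable_mul_update a (v := fun x => x * x)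
    (w := fun x => star (linForm (fun b => star (M a b)) x)) (by fun_prop) mL isq
    ((hL _).star.integrable one_le_two)
  have i3 := h.integrable_mul_update a (v := fun x => x * star x)
    (w := fun x => linForm (fun b => M b a) x) m1 (measurable_linForm _) isq'
    ((hL _).integrable one_le_two)
  have e2 : ∫ ω, y ω a * star (y ω a) * linForm (fun b => M b a) (Function.update (y ω) a 0) ∂μ
      = 0 := by
    rw [h.integral_mul_update a (v := fun x => x * star x)
      (w := fun x => linForm (fun b => M b a) x) m1 (measurable_linForm _),
      h.integral_linForm_update, mul_zero]
  have e1 : ∫ ω, y ω a * y ω a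
      * star (linForm (fun b => star (M a b)) (Function.update (y ω) a 0)) ∂μ = 0 := by
    rw [h.integral_mul_update a (v := fun x => x * x)
      (w := fun x => star (linForm (fun b => star (M a b)) x)) (by fun_prop) mL]
    have : ∫ ω, star (linForm (fun b => star (M a b)) (Function.update (y ω) a 0)) ∂μ
        = star (∫ ω, linForm (fun b => star (M a b)) (Function.update (y ω) a 0) ∂μ) :=
      integral_conj
    rw [this, h.integral_linForm_update, star_zero, mul_zero]
  have e0 : ∫ ω, y ω a * centeredQuad v M (Function.update (y ω) a 0) ∂μ = 0 := by
    rw [h.integral_mul_update a (v := fun x => x) (w := centeredQuad v M) measurable_id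
      (measurable_centeredQuad v M), h.mean, zero_mul]
  have i0 : Integrable (fun ω => y ω a * centeredQuad v M (Function.update (y ω) a 0)) μ :=
    (hya a).integrable_mul (hHa a)
  -- The quadratic form is expanded around its value without coordinate `a`. The middle two terms
  -- vanish in mean because the linear forms in the other coordinates are centred, the last because
  -- `y a` is; only `y a |y a|²` survives.
  have e3 : ∀ ω, y ω a * centeredQuad v M (y ω)
      = ((y ω a * ((‖y ω a‖ ^ 2 : ℝ) : ℂ)) * M a a
        + y ω a * y ω a * star (linForm (fun b => star (M a b)) (Function.update (y ω) a 0))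
        + y ω a * star (y ω a) * linForm (fun b => M b a) (Function.update (y ω) a 0))
        + y ω a * centeredQuad v M (Function.update (y ω) a 0) := by
    intro ω
    have := quadForm_update M (y ω) a
    unfold centeredQuad
    linear_combination (y ω a) * this
  simp_rw [e3]
  rw [integral_add (((i1.mul_const _).fun_add i2).fun_add i3) i0, integral_add ((i1.mul_const _).fun_add i2) i3,
    integral_add (i1.mul_const _) i2, e0, e1, e2, integral_mul_const]
  ring

lemma integral_mul_update_le (h : IsCenteredFamily μ y r) (a : ι) {v : ℂ → ℝ} {w : (ι → ℂ) → ℝ}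
    (hv : Measurable v) (hw : Measurable w) (v0 : ∀ x, 0 ≤ v x)
    (w0 : ∀ x, 0 ≤ w x) {A B : ℝ} (hA : ∫ ω, v (y ω a) ∂μ ≤ A)
    (hB : ∫ ω, w (Function.update (y ω) a 0) ∂μ ≤ B) :
    ∫ ω, v (y ω a) * w (Function.update (y ω) a 0) ∂μ ≤ A * B := by
  rw [h.integral_mul_update a hv hw]
  exact mul_le_mul hA hB (integral_nonneg fun _ => w0 _)
    ((integral_nonneg fun _ => v0 _).trans hA)

lemma integral_four_linForm_add_le (h : IsCenteredFamily μ y r) {c c' : ι → ℂ} (a : ι) {ρ : ℝ}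
    (hc : ∑ b, ‖c b‖ ^ 2 ≤ ρ) (hc' : ∑ b, ‖c' b‖ ^ 2 ≤ ρ) :
    ∫ ω, (‖linForm c (Function.update (y ω) a 0)‖
      + ‖linForm c' (Function.update (y ω) a 0)‖) ^ 4 ∂μ ≤ 544 * r ^ 4 * ρ ^ 2 := by
  have i1 : ∀ c : ι → ℂ, Integrable (fun ω => ‖linForm c (Function.update (y ω) a 0)‖ ^ 4) μ :=
    fun c => integrable_norm_pow_four (h.memLp_linForm_update c a)
  have hb : ∀ c : ι → ℂ, ∑ b, ‖c b‖ ^ 2 ≤ ρ →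
      ∫ ω, ‖linForm c (Function.update (y ω) a 0)‖ ^ 4 ∂μ ≤ 34 * r ^ 4 * ρ ^ 2 := by
    intro c hc
    simp_rw [linForm_update]
    refine (h.integral_four_linForm_le _).trans ?_
    gcongr
    exact (sum_update_sq_le c a).trans hc
  have pw : ∀ p q : ℝ, (p + q) ^ 4 ≤ 8 * p ^ 4 + 8 * q ^ 4 := by
    intro p q
    have h1 := add_sq_le (a := p) (b := q)
    have h2 : ((p + q) ^ 2) ^ 2 ≤ (2 * (p ^ 2 + q ^ 2)) ^ 2 := by gcongr
    nlinarith [sq_nonneg (p ^ 2 - q ^ 2)]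
  calc _ ≤ ∫ ω, (8 * ‖linForm c (Function.update (y ω) a 0)‖ ^ 4
        + 8 * ‖linForm c' (Function.update (y ω) a 0)‖ ^ 4) ∂μ :=
        integral_mono_of_nonneg (ae_of_all _ fun ω => by positivity)
          (((i1 c).const_mul 8).add ((i1 c').const_mul 8)) (ae_of_all _ fun ω => pw _ _)
    _ = 8 * ∫ ω, ‖linForm c (Function.update (y ω) a 0)‖ ^ 4 ∂μ
        + 8 * ∫ ω, ‖linForm c' (Function.update (y ω) a 0)‖ ^ 4 ∂μ := by
        rw [integral_add ((i1 c).const_mul 8) ((i1 c').const_mul 8), integral_const_mul,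
          integral_const_mul]
    _ ≤ _ := by linarith [hb c hc, hb c' hc']

/-- The fifth moment enters through this weight: it arises from two factors of size `|y a|² + v` and
the change `|y a| ‖c a‖` of the linear form. -/
lemma integral_fifth_weight_le (h : IsCenteredFamily μ y r) (a : ι)
    (i5 : Integrable (fun ω => ‖y ω a‖ ^ 5) μ) (h5 : ∫ ω, ‖y ω a‖ ^ 5 ∂μ ≤ r ^ 5) {v : ℝ}
    (hv0 : 0 ≤ v) (hv : v ≤ r ^ 2) :
    Integrable (fun ω => (‖y ω a‖ ^ 2 + v) ^ 2 * ‖y ω a‖) μ ∧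
      ∫ ω, (‖y ω a‖ ^ 2 + v) ^ 2 * ‖y ω a‖ ∂μ ≤ 4 * r ^ 5 := by
  have i1 := (h.integrable_coord a).norm
  have ib : Integrable (fun ω => 2 * ‖y ω a‖ ^ 5 + 2 * v ^ 2 * ‖y ω a‖) μ :=
    (i5.const_mul 2).add (i1.const_mul _)
  have pw : ∀ ω, (‖y ω a‖ ^ 2 + v) ^ 2 * ‖y ω a‖ ≤ 2 * ‖y ω a‖ ^ 5 + 2 * v ^ 2 * ‖y ω a‖ := by
    intro ω
    have := mul_le_mul_of_nonneg_right (add_sq_le (a := ‖y ω a‖ ^ 2) (b := v))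
      (norm_nonneg (y ω a))
    nlinarith
  have meas : Measurable fun ω => (‖y ω a‖ ^ 2 + v) ^ 2 * ‖y ω a‖ := by
    have := h.measurable_coord a
    fun_prop
  have i0 : Integrable (fun ω => (‖y ω a‖ ^ 2 + v) ^ 2 * ‖y ω a‖) μ :=
    ib.mono' meas.aestronglyMeasurable (ae_of_all _ fun ω => by
      rw [Real.norm_of_nonneg (by positivity)]; exact pw ω)
  refine ⟨i0, (integral_mono i0 ib pw).trans ?_⟩
  rw [integral_add (i5.const_mul 2) (i1.const_mul _), integral_const_mul, integral_const_mul]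
  have h1 := h.first a
  have h2 : v ^ 2 ≤ (r ^ 2) ^ 2 := by gcongr
  have h3 := mul_le_mul h2 h1 (integral_nonneg fun _ => norm_nonneg _) (by positivity)
  nlinarith

/-- With `Q` and `L` the two forms, Cauchy–Schwarz between `|Q|²` and `|L|` would ask for eighth
moments of the entries. The leave-one-out bound with `K = conj(Q) |L|` produces at most the fifth
power of a single entry. -/
lemma integral_sq_centeredQuad_mul_linForm_le (h : IsCenteredFamily μ y r)
    (i5 : ∀ a, Integrable (fun ω => ‖y ω a‖ ^ 5) μ) (h5 : ∀ a, ∫ ω, ‖y ω a‖ ^ 5 ∂μ ≤ r ^ 5)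
    {M : Matrix ι ι ℂ} {c : ι → ℂ} {t : ℝ} (ht : 0 ≤ t)
    (hrow : ∀ a, ∑ b, ‖M a b‖ ^ 2 ≤ t ^ 2) (hcol : ∀ a, ∑ b, ‖M b a‖ ^ 2 ≤ t ^ 2)
    (hc : ∑ b, ‖c b‖ ^ 2 ≤ t ^ 2) :
    Integrable (fun ω => ‖centeredQuad (fun a => ∫ ω, ‖y ω a‖ ^ 2 ∂μ) M (y ω)‖ ^ 2
        * ‖linForm c (y ω)‖) μ ∧
      ∫ ω, ‖centeredQuad (fun a => ∫ ω, ‖y ω a‖ ^ 2 ∂μ) M (y ω)‖ ^ 2 * ‖linForm c (y ω)‖ ∂μ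
      ≤ 104 * Fintype.card ι * r ^ 5 * t ^ 3 := by
  set v : ι → ℝ := fun a => ∫ ω, ‖y ω a‖ ^ 2 ∂μ with hv
  have hv0 : ∀ a, 0 ≤ v a := fun a => variance_nonneg a
  have hvr : ∀ a, v a ≤ r ^ 2 := h.second
  have hr := h.nonneg
  set n : ℝ := (Fintype.card ι : ℝ) with hn
  have hn0 : 0 ≤ n := by positivity
  set s : ℝ := Real.sqrt n with hs
  have hs0 : 0 ≤ s := Real.sqrt_nonneg n
  have hss : s ^ 2 = n := Real.sq_sqrt hn0
  have hMt : ∀ a, ‖M a a‖ ≤ t := fun a => le_of_sq_le_sq ((Finset.single_le_sum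
    (f := fun b => ‖M a b‖ ^ 2) (fun _ _ => by positivity) (Finset.mem_univ a)).trans (hrow a)) ht
  have hct : ∀ a, ‖c a‖ ≤ t := fun a => le_of_sq_le_sq ((Finset.single_le_sum
    (f := fun b => ‖c b‖ ^ 2) (fun _ _ => by positivity) (Finset.mem_univ a)).trans hc) ht
  set Λ : ι → (ι → ℂ) → ℝ := fun a x => ‖linForm (fun b => star (M a b)) x‖
    + ‖linForm (fun b => M b a) x‖ with hΛ
  have hΛ0 : ∀ a x, 0 ≤ Λ a x := fun a x => by simp only [hΛ]; positivity
  have hΛm : ∀ a, Measurable (Λ a) := fun a =>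
    (measurable_linForm _).norm.add (measurable_linForm _).norm
  have hYm : Measurable fun x => ‖linForm c x‖ := (measurable_linForm c).norm
  have hHm : Measurable fun x => ‖centeredQuad v M x‖ := (measurable_centeredQuad v M).norm
  have hH := h.memLp_centeredQuad v M
  have hHa := h.memLp_centeredQuad_update hv0 M
  have hYa := fun a => h.memLp_linForm_update c a
  have hYa2 : ∀ a, MemLp (fun ω => linForm c (Function.update (y ω) a 0)) 2 μ :=
    fun a => (hYa a).mono_exponent (by norm_num)
  have hΛ4 : ∀ a, MemLp (fun ω => Λ a (Function.update (y ω) a 0)) 4 μ :=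
    fun a => h.memLp_linForm_add _ _ a
  have hΛ2 : ∀ a, MemLp (fun ω => Λ a (Function.update (y ω) a 0)) 2 μ :=
    fun a => (hΛ4 a).mono_exponent (by norm_num)
  have hΛsq : ∀ a, MemLp (fun ω => Λ a (Function.update (y ω) a 0) ^ 2) 2 μ := fun a => by
    have := memLp_two_norm_sq (hΛ4 a).ofReal (μ := μ)
    simpa [RCLike.norm_ofReal, sq_abs] using this
  have bΛ2 : ∀ a, ∫ ω, Λ a (Function.update (y ω) a 0) ^ 2 ∂μ ≤ 4 * r ^ 2 * t ^ 2 :=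
    fun a => h.integral_sq_linForm_add_le a (by simpa using hrow a) (hcol a)
  -- The square form is what Cauchy–Schwarz needs below; `24 ^ 2 = 576` exceeds `544`.
  have bΛ4 : ∀ a, ∫ ω, (Λ a (Function.update (y ω) a 0) ^ 2) ^ 2 ∂μ ≤ (24 * r ^ 2 * t ^ 2) ^ 2 := by
    intro a
    have := h.integral_four_linForm_add_le (c := fun b => star (M a b)) a
      (by simpa using hrow a) (hcol a)
    simp_rw [← pow_mul]
    refine this.trans ?_
    have : 0 ≤ r ^ 4 * t ^ 4 := by positivity
    nlinarith
  have bY2 : ∀ a, ∫ ω, ‖linForm c (Function.update (y ω) a 0)‖ ^ 2 ∂μ ≤ (r * t) ^ 2 := fun a =>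
    (h.integral_sq_linForm_update_le c a).trans (by
      rw [mul_pow]; exact mul_le_mul_of_nonneg_left hc (sq_nonneg r))
  have bY : ∀ a, ∫ ω, ‖linForm c (Function.update (y ω) a 0)‖ ∂μ ≤ r * t := fun a =>
    integral_le_of_sq_le (hYa2 a).norm (by positivity) (bY2 a)
  have bΛY : ∀ a, ∫ ω, Λ a (Function.update (y ω) a 0) ^ 2
      * ‖linForm c (Function.update (y ω) a 0)‖ ∂μ ≤ 24 * r ^ 2 * t ^ 2 * (r * t) := fun a =>
    integral_mul_le_of_sq_le (hΛsq a) (hYa2 a).norm (by positivity) (by positivity) (bΛ4 a) (bY2 a)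
  -- Restoring coordinate `a` costs one majorant, which is absorbed since `1 ≤ n`; `64 = 2 * 16 + 2
  -- * 16`.
  have bH2 : ∀ a, ∫ ω, ‖centeredQuad v M (Function.update (y ω) a 0)‖ ^ 2 ∂μ
      ≤ (8 * r ^ 2 * s * t) ^ 2 := by
    intro a
    have h1 := h.integral_sq_centeredQuad_le hrow hcol
    rw [← hv, Finset.sum_const, Finset.card_univ, nsmul_eq_mul, ← hn] at h1
    have h2 := h.integral_sq_chaosMajorant_le hv0 hvr (hrow a) (hcol a)
    have h3 : (1 : ℝ) ≤ n := by
      rw [hn]; exact_mod_cast Fintype.card_pos_iff.mpr ⟨a⟩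
    have iM := (h.memLp_chaosMajorant v M a).integrable_sq
    calc _ ≤ ∫ ω, (2 * ‖centeredQuad v M (y ω)‖ ^ 2 + 2 * chaosMajorant v M a (y ω) ^ 2) ∂μ := by
          refine integral_mono (hHa a).norm.integrable_sq
            ((hH.norm.integrable_sq.const_mul 2).add (iM.const_mul 2)) fun ω => ?_
          have h2 := norm_centeredQuad_sub_update_le hv0 M a (y ω)
          have h3 := norm_sub_norm_le (centeredQuad v M (Function.update (y ω) a 0))
            (centeredQuad v M (y ω))
          rw [norm_sub_rev] at h3
          have h4 : ‖centeredQuad v M (Function.update (y ω) a 0)‖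
            ≤ ‖centeredQuad v M (y ω)‖ + chaosMajorant v M a (y ω) := by linarith
          change ‖centeredQuad v M (Function.update (y ω) a 0)‖ ^ 2 ≤ _
          calc _ ≤ (‖centeredQuad v M (y ω)‖ + chaosMajorant v M a (y ω)) ^ 2 := by gcongr
            _ ≤ _ := add_sq_le.trans (by simp only [mul_add]; exact le_rfl)
      _ = 2 * ∫ ω, ‖centeredQuad v M (y ω)‖ ^ 2 ∂μ + 2 * ∫ ω, chaosMajorant v M a (y ω) ^ 2 ∂μ := by
          rw [integral_add (hH.norm.integrable_sq.const_mul 2) (iM.const_mul 2),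
            integral_const_mul, integral_const_mul]
      _ ≤ 2 * (16 * r ^ 4 * (n * t ^ 2)) + 2 * (16 * r ^ 4 * (n * t ^ 2)) := by
          have : 16 * r ^ 4 * t ^ 2 ≤ 16 * r ^ 4 * (n * t ^ 2) := by
            have : 0 ≤ 16 * r ^ 4 * t ^ 2 := by positivity
            nlinarith
          linarith
      _ = (8 * r ^ 2 * s * t) ^ 2 := by rw [← hss]; ring
  have bH : ∀ a, ∫ ω, ‖centeredQuad v M (Function.update (y ω) a 0)‖ ∂μ ≤ 8 * r ^ 2 * s * t :=
    fun a => integral_le_of_sq_le (hHa a).norm (by positivity) (bH2 a)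
  have bΛH : ∀ a, ∫ ω, Λ a (Function.update (y ω) a 0)
      * ‖centeredQuad v M (Function.update (y ω) a 0)‖ ∂μ ≤ 2 * r * t * (8 * r ^ 2 * s * t) :=
    fun a => integral_mul_le_of_sq_le (hΛ2 a) (hHa a).norm (by positivity) (by positivity)
      ((bΛ2 a).trans (le_of_eq (by ring))) (bH2 a)
  -- the majorant of the leave-one-out terms
  set G : ι → Ω → ℝ := fun a ω =>
    2 * t ^ 2 * ((‖y ω a‖ ^ 2 + v a) ^ 2 * ‖linForm c (Function.update (y ω) a 0)‖)
    + 2 * (‖y ω a‖ ^ 2 * (Λ a (Function.update (y ω) a 0) ^ 2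
      * ‖linForm c (Function.update (y ω) a 0)‖))
    + 2 * t ^ 2 * ‖c a‖ * ((‖y ω a‖ ^ 2 + v a) ^ 2 * ‖y ω a‖)
    + 2 * ‖c a‖ * (‖y ω a‖ ^ 3 * Λ a (Function.update (y ω) a 0) ^ 2)
    + t * ‖c a‖ * ((‖y ω a‖ ^ 3 + v a * ‖y ω a‖) * ‖centeredQuad v M (Function.update (y ω) a 0)‖)
    + ‖c a‖ * (‖y ω a‖ ^ 2 * (Λ a (Function.update (y ω) a 0)
      * ‖centeredQuad v M (Function.update (y ω) a 0)‖)) with hG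
  have G_bound : ∀ a, Integrable (G a) μ ∧
      ∫ ω, G a ω ∂μ ≤ 72 * r ^ 5 * t ^ 3 + 32 * r ^ 5 * t ^ 2 * s * ‖c a‖ := by
    intro a
    have w5 := h.integral_fifth_weight_le a (i5 a) (h5 a) (hv0 a) (hvr a)
    have iq : Integrable (fun ω => (‖y ω a‖ ^ 2 + v a) ^ 2) μ :=
      ((memLp_two_norm_sq (h.memLp a)).add (memLp_const (v a))).integrable_sq
    have i3 : Integrable (fun ω => ‖y ω a‖ ^ 3 + v a * ‖y ω a‖) μ :=
      (h.integrable_third a).add ((h.integrable_coord a).norm.const_mul _)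
    have b3 : ∫ ω, (‖y ω a‖ ^ 3 + v a * ‖y ω a‖) ∂μ ≤ 2 * r ^ 3 := by
      rw [integral_add (h.integrable_third a) ((h.integrable_coord a).norm.const_mul _),
        integral_const_mul]
      have := mul_le_mul (hvr a) (h.first a) (integral_nonneg fun _ => norm_nonneg _) (sq_nonneg r)
      nlinarith [h.third a]
    have iΛY : Integrable (fun ω => Λ a (Function.update (y ω) a 0) ^ 2
      * ‖linForm c (Function.update (y ω) a 0)‖) μ := (hΛsq a).integrable_mul (hYa2 a).norm
    have iΛH : Integrable (fun ω => Λ a (Function.update (y ω) a 0)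
      * ‖centeredQuad v M (Function.update (y ω) a 0)‖) μ := (hΛ2 a).integrable_mul (hHa a).norm
    have va := hv0 a
    have I1 := h.integrable_mul_update a (v := fun x => (‖x‖ ^ 2 + v a) ^ 2)
      (w := fun x => ‖linForm c x‖) (by fun_prop) hYm iq ((hYa2 a).integrable one_le_two).norm
    have J1 := h.integral_mul_update_le a (v := fun x => (‖x‖ ^ 2 + v a) ^ 2)
      (w := fun x => ‖linForm c x‖) (by fun_prop) hYm
      (fun _ => by positivity) (fun _ => by positivity)
      (h.integral_sq_sq_add_le a (hv0 a) (hvr a)) (bY a)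
    have m2 : Measurable fun x => Λ a x ^ 2 * ‖linForm c x‖ := ((hΛm a).pow_const 2).mul hYm
    have I2 := h.integrable_mul_update a (v := fun x => ‖x‖ ^ 2)
      (w := fun x => Λ a x ^ 2 * ‖linForm c x‖) (by fun_prop) m2 (h.integrable_sq a) iΛY
    have J2 := h.integral_mul_update_le a (v := fun x => ‖x‖ ^ 2)
      (w := fun x => Λ a x ^ 2 * ‖linForm c x‖) (by fun_prop) m2
      (fun _ => by positivity) (fun _ => by positivity) (h.second a) (bΛY a)
    have I4 := h.integrable_mul_update a (v := fun x => ‖x‖ ^ 3)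
      (w := fun x => Λ a x ^ 2) (by fun_prop) ((hΛm a).pow_const 2) (h.integrable_third a)
      (hΛ2 a).integrable_sq
    have J4 := h.integral_mul_update_le a (v := fun x => ‖x‖ ^ 3)
      (w := fun x => Λ a x ^ 2) (by fun_prop) ((hΛm a).pow_const 2)
      (fun _ => by positivity) (fun _ => by positivity) (h.third a) (bΛ2 a)
    have I5 := h.integrable_mul_update a (v := fun x => ‖x‖ ^ 3 + v a * ‖x‖)
      (w := fun x => ‖centeredQuad v M x‖) (by fun_prop) hHm i3
      ((hHa a).integrable one_le_two).norm
    have J5 := h.integral_mul_update_le a (v := fun x => ‖x‖ ^ 3 + v a * ‖x‖)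
      (w := fun x => ‖centeredQuad v M x‖) (by fun_prop) hHm
      (fun _ => by positivity) (fun _ => by positivity) b3
      (bH a)
    have m6 : Measurable fun x => Λ a x * ‖centeredQuad v M x‖ := (hΛm a).mul hHm
    have I6 := h.integrable_mul_update a (v := fun x => ‖x‖ ^ 2)
      (w := fun x => Λ a x * ‖centeredQuad v M x‖) (by fun_prop) m6 (h.integrable_sq a) iΛH
    have J6 := h.integral_mul_update_le a (v := fun x => ‖x‖ ^ 2)
      (w := fun x => Λ a x * ‖centeredQuad v M x‖) (by fun_prop) m6
      (fun _ => by positivity) (fun x => mul_nonneg (hΛ0 a x) (norm_nonneg _)) (h.second a) (bΛH a)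
    have K1 := I1.const_mul (2 * t ^ 2)
    have K2 := I2.const_mul 2
    have K3 := w5.1.const_mul (2 * t ^ 2 * ‖c a‖)
    have K4 := I4.const_mul (2 * ‖c a‖)
    have K5 := I5.const_mul (t * ‖c a‖)
    have K6 := I6.const_mul ‖c a‖
    refine ⟨((((K1.add K2).add K3).add K4).add K5).add K6, ?_⟩
    simp only [hG]
    rw [integral_add ((((K1.fun_add K2).fun_add K3).fun_add K4).fun_add K5) K6,
      integral_add (((K1.fun_add K2).fun_add K3).fun_add K4) K5,
      integral_add ((K1.fun_add K2).fun_add K3) K4,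
      integral_add (K1.fun_add K2) K3, integral_add K1 K2]
    simp only [integral_const_mul]
    have q0 := norm_nonneg (c a)
    have q1 := hct a
    calc _ ≤ 2 * t ^ 2 * (4 * r ^ 4 * (r * t)) + 2 * (r ^ 2 * (24 * r ^ 2 * t ^ 2 * (r * t)))
          + 2 * t ^ 2 * ‖c a‖ * (4 * r ^ 5) + 2 * ‖c a‖ * (r ^ 3 * (4 * r ^ 2 * t ^ 2))
          + t * ‖c a‖ * (2 * r ^ 3 * (8 * r ^ 2 * s * t))
          + ‖c a‖ * (r ^ 2 * (2 * r * t * (8 * r ^ 2 * s * t))) := by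
          gcongr
          exact w5.2
      _ = 56 * r ^ 5 * t ^ 3 + 16 * r ^ 5 * t ^ 2 * ‖c a‖ + 32 * r ^ 5 * t ^ 2 * s * ‖c a‖ := by
          ring
      _ ≤ 56 * r ^ 5 * t ^ 3 + 16 * r ^ 5 * t ^ 2 * t + 32 * r ^ 5 * t ^ 2 * s * ‖c a‖ := by
          gcongr
      _ = _ := by ring
  set K : (ι → ℂ) → ℂ := fun x => star (centeredQuad v M x) * ((‖linForm c x‖ : ℝ) : ℂ) with hK
  have hKm : Measurable K := (measurable_star_complex.comp (measurable_centeredQuad v M)).mul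
    (Complex.measurable_ofReal.comp hYm)
  have orth : ∀ a, Integrable (fun ω => chaosTerm v M a (y ω) * K (Function.update (y ω) a 0)) μ ∧
      ∫ ω, chaosTerm v M a (y ω) * K (Function.update (y ω) a 0) ∂μ = 0 := by
    intro a
    refine h.chaosTerm_mul M a hKm ((hHa a).star.integrable_mul (hYa2 a).norm.ofReal) ?_
    have h1 := (memLp_two_mul (h.memLp_linForm_update (fun b => star (M a b)) a).star
      (hYa a).norm.ofReal).integrable_mul (hHa a).star
    refine h1.congr (ae_of_all _ fun ω => ?_)
    simp only [hK, Pi.mul_apply, Pi.star_apply]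
    change _ * ((‖linForm c (Function.update (y ω) a 0)‖ : ℝ) : ℂ) * _ = _
    ring
  have pw : ∀ a ω, ‖chaosTerm v M a (y ω)‖ * ‖K (y ω) - K (Function.update (y ω) a 0)‖
      ≤ G a ω := by
    intro a ω
    set x := y ω with hx
    set x' := Function.update x a 0 with hx'
    set e := chaosMajorant v M a x with he
    have he0 : 0 ≤ e := chaosMajorant_nonneg hv0 M a x
    have h1 : ‖chaosTerm v M a x‖ ≤ e := norm_chaosTerm_le hv0 M a x
    have h2 : ‖centeredQuad v M x - centeredQuad v M x'‖ ≤ e :=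
      norm_centeredQuad_sub_update_le hv0 M a x
    have h3 : ‖linForm c x‖ ≤ ‖linForm c x'‖ + ‖x a‖ * ‖c a‖ := by
      rw [linForm_eq_add c x a, ← norm_mul, add_comm]; exact norm_add_le _ _
    have h3' : |‖linForm c x‖ - ‖linForm c x'‖| ≤ ‖x a‖ * ‖c a‖ := by
      refine (abs_norm_sub_norm_le _ _).trans (le_of_eq ?_)
      rw [linForm_eq_add c x a, add_sub_cancel_right, norm_mul]
    -- The change of a product is distributed so that the change of the quadratic form meets the
    -- full `L`, and the change of `L` meets the quadratic form without coordinate `a`. The latter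
    -- is then independent of `x a`.
    have h4 : ‖K x - K x'‖ ≤ e * ‖linForm c x‖ + ‖centeredQuad v M x'‖ * (‖x a‖ * ‖c a‖) := by
      have : K x - K x' = star (centeredQuad v M x - centeredQuad v M x')
          * ((‖linForm c x‖ : ℝ) : ℂ)
          + star (centeredQuad v M x') * ((‖linForm c x‖ - ‖linForm c x'‖ : ℝ) : ℂ) := by
        simp only [hK, star_sub]; push_cast; ring
      rw [this]
      refine (norm_add_le _ _).trans ?_
      rw [norm_mul, norm_mul, norm_star, norm_star, Complex.norm_real, Complex.norm_real,
        norm_norm, Real.norm_eq_abs]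
      gcongr
    have h5 : e ≤ (‖x a‖ ^ 2 + v a) * t + ‖x a‖ * Λ a x' := by
      simp only [he, chaosMajorant, hΛ]
      have := hv0 a
      gcongr
      exact hMt a
    have h6 : e ^ 2 ≤ 2 * (((‖x a‖ ^ 2 + v a) * t) ^ 2 + (‖x a‖ * Λ a x') ^ 2) :=
      le_trans (by gcongr) add_sq_le
    have va := hv0 a
    calc _ ≤ e * (e * (‖linForm c x'‖ + ‖x a‖ * ‖c a‖)
          + ‖centeredQuad v M x'‖ * (‖x a‖ * ‖c a‖)) := by
          gcongr
          exact h4.trans (by gcongr)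
      _ = e ^ 2 * (‖linForm c x'‖ + ‖x a‖ * ‖c a‖)
          + e * (‖centeredQuad v M x'‖ * (‖x a‖ * ‖c a‖)) := by ring
      _ ≤ 2 * (((‖x a‖ ^ 2 + v a) * t) ^ 2 + (‖x a‖ * Λ a x') ^ 2)
            * (‖linForm c x'‖ + ‖x a‖ * ‖c a‖)
          + ((‖x a‖ ^ 2 + v a) * t + ‖x a‖ * Λ a x')
            * (‖centeredQuad v M x'‖ * (‖x a‖ * ‖c a‖)) := by gcongr
      _ = G a ω := by simp only [hG, ← hx, ← hx']; ring
  have hdm := fun a => (measurable_chaosTerm v M a).comp h.measurable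
  have iK : ∀ a, Integrable (fun ω => chaosTerm v M a (y ω) * K (y ω)) μ := by
    intro a
    refine ((orth a).1.norm.add (G_bound a).1).mono'
      ((hdm a).mul (hKm.comp h.measurable)).aestronglyMeasurable (ae_of_all _ fun ω => ?_)
    have h1 := pw a ω
    rw [← norm_mul] at h1
    have h2 := norm_add_le (chaosTerm v M a (y ω) * K (Function.update (y ω) a 0))
      (chaosTerm v M a (y ω) * (K (y ω) - K (Function.update (y ω) a 0)))
    rw [← mul_add, add_sub_cancel] at h2
    simp only [Pi.add_apply]
    linarith
  have key := norm_integral_sum_mul_le (μ := μ) (d := fun a ω => chaosTerm v M a (y ω))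
    (K := fun ω => K (y ω)) (K' := fun a ω => K (Function.update (y ω) a 0)) iK
    (fun a => (orth a).1) (fun a => (orth a).2)
  have e0 : ∀ ω, (∑ a, chaosTerm v M a (y ω)) * K (y ω)
      = ((‖centeredQuad v M (y ω)‖ ^ 2 * ‖linForm c (y ω)‖ : ℝ) : ℂ) := by
    intro ω
    rw [← centeredQuad_eq_sum]
    simp only [hK]
    rw [← mul_assoc, Complex.star_def, Complex.mul_conj']; push_cast; rfl
  have isum : Integrable (fun ω => (∑ a, chaosTerm v M a (y ω)) * K (y ω)) μ := by
    simp_rw [Finset.sum_mul]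
    exact integrable_finsetSum _ fun a _ => iK a
  refine ⟨?_, ?_⟩
  · refine isum.norm.congr (ae_of_all _ fun ω => ?_)
    simp only [e0]
    rw [Complex.norm_real, Real.norm_of_nonneg (by positivity)]
  simp_rw [e0] at key
  rw [integral_complex_ofReal, Complex.norm_real] at key
  refine (Real.le_norm_self _).trans (key.trans ?_)
  -- The terms containing the reduced quadratic form carry `s = √n` each; summing `‖c a‖` costs only
  -- another `√n`, so the total stays linear in `n`.
  have hcs : ∑ a, ‖c a‖ ≤ s * t := by
    refine le_of_sq_le_sq ?_ (by positivity)
    calc (∑ a, ‖c a‖) ^ 2 ≤ n * ∑ a, ‖c a‖ ^ 2 := by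
          have := sq_sum_le_card_mul_sum_sq (s := (Finset.univ : Finset ι)) (f := fun a => ‖c a‖)
          rwa [Finset.card_univ] at this
      _ ≤ n * t ^ 2 := by gcongr
      _ = (s * t) ^ 2 := by rw [mul_pow, hss]
  calc _ ≤ ∑ a, (72 * r ^ 5 * t ^ 3 + 32 * r ^ 5 * t ^ 2 * s * ‖c a‖) := by
        refine Finset.sum_le_sum fun a _ => le_trans ?_ (G_bound a).2
        exact integral_mono_of_nonneg (ae_of_all _ fun ω => by positivity) (G_bound a).1
          (ae_of_all _ fun ω => pw a ω)
    _ = n * (72 * r ^ 5 * t ^ 3) + 32 * r ^ 5 * t ^ 2 * s * ∑ a, ‖c a‖ := by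
        rw [Finset.sum_add_distrib, Finset.sum_const, Finset.card_univ, nsmul_eq_mul,
          ← Finset.mul_sum]
    _ ≤ n * (72 * r ^ 5 * t ^ 3) + 32 * r ^ 5 * t ^ 2 * s * (s * t) := by gcongr
    _ = 104 * n * r ^ 5 * t ^ 3 := by rw [← hss]; ring

end IsCenteredFamily

end QuadraticChaosThird

/-! ### The Efron–Stein inequality -/

section EfronStein

lemma integrable_of_norm_le {α : Type*} [MeasurableSpace α] {ν : Measure α} [IsFiniteMeasure ν]
    {G : Type*} [NormedAddCommGroup G] {f : α → G} (hf : AEStronglyMeasurable f ν) {C : ℝ}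
    (hC : ∀ x, ‖f x‖ ≤ C) : Integrable f ν :=
  Integrable.of_bound hf C (ae_of_all _ hC)

/-- The splitting of a mean square into variance and squared bias. It yields both the minimality of
the mean and Jensen's inequality for the square. -/
lemma integral_norm_sub_sq {α : Type*} [MeasurableSpace α] {ν : Measure α} [IsProbabilityMeasure ν]
    {f : α → ℂ} (hf : MemLp f 2 ν) (c : ℂ) :
    ∫ x, ‖f x - c‖ ^ 2 ∂ν = ∫ x, ‖f x - ∫ x', f x' ∂ν‖ ^ 2 ∂ν + ‖(∫ x', f x' ∂ν) - c‖ ^ 2 := by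
  set m := ∫ x', f x' ∂ν with hm
  have hfi := hf.integrable one_le_two
  have i1 : Integrable (fun x => ‖f x - m‖ ^ 2) ν := (hf.sub (memLp_const m)).norm.integrable_sq
  have i2 : Integrable (fun x => ((f x - m) * star (m - c)).re) ν :=
    ((hfi.sub (integrable_const m)).mul_const _).re
  have pw : ∀ x, ‖f x - c‖ ^ 2
      = (‖f x - m‖ ^ 2 + ‖m - c‖ ^ 2) + 2 * ((f x - m) * star (m - c)).re := by
    intro x
    have : f x - c = (f x - m) + (m - c) := by ring
    rw [this, Complex.sq_norm, Complex.normSq_add, ← Complex.sq_norm, ← Complex.sq_norm]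
    rfl
  simp_rw [pw]
  rw [integral_add (i1.fun_add (integrable_const _)) (i2.const_mul 2),
    integral_add i1 (integrable_const _), integral_const_mul]
  have e : ∫ x, ((f x - m) * star (m - c)).re ∂ν = 0 := by
    have h1 : ∫ x, (f x - m) * star (m - c) ∂ν = 0 := by
      rw [integral_mul_const, integral_sub hfi (integrable_const m)]
      simp [hm]
    have h2 := integral_re ((hfi.sub (integrable_const m)).mul_const (star (m - c)))
    change ∫ x, ((f x - m) * star (m - c)).re ∂ν = (∫ x, (f x - m) * star (m - c) ∂ν).re at h2
    rw [h2, h1, Complex.zero_re]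
  rw [e]
  simp

lemma integral_norm_sub_integral_sq_le {α : Type*} [MeasurableSpace α] {ν : Measure α}
    [IsProbabilityMeasure ν] {f : α → ℂ} (hf : MemLp f 2 ν) (c : ℂ) :
    ∫ x, ‖f x - ∫ x', f x' ∂ν‖ ^ 2 ∂ν ≤ ∫ x, ‖f x - c‖ ^ 2 ∂ν := by
  rw [integral_norm_sub_sq hf c]
  exact le_add_of_nonneg_right (by positivity)

lemma norm_integral_sq_le {α : Type*} [MeasurableSpace α] {ν : Measure α}
    [IsProbabilityMeasure ν] {f : α → ℂ} (hf : MemLp f 2 ν) :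
    ‖∫ x, f x ∂ν‖ ^ 2 ≤ ∫ x, ‖f x‖ ^ 2 ∂ν := by
  have := integral_norm_sub_sq hf 0
  simp only [sub_zero] at this
  rw [this]
  exact le_add_of_nonneg_left (integral_nonneg fun _ => by positivity)

/-- The Efron–Stein inequality on a finite product of probability spaces. -/
lemma efron_stein_pi {E : Type*} [MeasurableSpace E] {n : ℕ} (ν : Fin n → Measure E)
    [∀ k, IsProbabilityMeasure (ν k)] {f : (Fin n → E) → ℂ} {g : Fin n → (Fin n → E) → ℂ} {C : ℝ}
    (hf : Measurable f) (hfC : ∀ x, ‖f x‖ ≤ C) (hg : ∀ k, Measurable (g k))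
    (hgC : ∀ k x, ‖g k x‖ ≤ C) (hgk : ∀ k x e, g k (Function.update x k e) = g k x) :
    ∫ x, ‖f x - ∫ x', f x' ∂(Measure.pi ν)‖ ^ 2 ∂(Measure.pi ν)
      ≤ ∑ k, ∫ x, ‖f x - g k x‖ ^ 2 ∂(Measure.pi ν) := by
  induction n with
  | zero =>
    have h0 : ∀ x, f x = f default := fun x => congrArg f (Subsingleton.elim _ _)
    simp_rw [h0]
    simp
  | succ n ih =>
    set π := Measure.pi fun k : Fin n => ν k.succ with hπ
    have hcons : ∀ p : E × (Fin n → E), (MeasurableEquiv.piFinSuccAbove (fun _ => E) 0).symm p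
        = (Fin.cons p.1 p.2 : Fin (n + 1) → E) := fun p => by
      rw [MeasurableEquiv.piFinSuccAbove_symm_apply]
      simp only [Fin.insertNthEquiv, Fin.insertNth_zero]
      rfl
    have mp : MeasurePreserving (MeasurableEquiv.piFinSuccAbove (fun _ => E) 0).symm
        ((ν 0).prod π) (Measure.pi ν) := by
      have h1 := (measurePreserving_piFinSuccAbove ν 0).symm
      simp only [Fin.zero_succAbove] at h1
      exact h1
    have conv : ∀ {G : Type} [NormedAddCommGroup G] [NormedSpace ℝ G] (φ : (Fin (n + 1) → E) → G),
        ∫ x, φ x ∂(Measure.pi ν) = ∫ p, φ (Fin.cons p.1 p.2) ∂((ν 0).prod π) := by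
      intro G _ _ φ
      rw [← mp.integral_comp']
      simp_rw [hcons]
    have mcons : Measurable fun p : E × (Fin n → E) => (Fin.cons p.1 p.2 : Fin (n + 1) → E) :=
      (funext hcons : ⇑(MeasurableEquiv.piFinSuccAbove (fun _ => E) 0).symm = _) ▸ mp.measurable
    set F : E × (Fin n → E) → ℂ := fun p => f (Fin.cons p.1 p.2) with hF
    set G : Fin (n + 1) → E × (Fin n → E) → ℂ := fun k p => g k (Fin.cons p.1 p.2) with hG
    have mF : Measurable F := hf.comp mcons
    have mG : ∀ k, Measurable (G k) := fun k => (hg k).comp mcons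
    have bF : ∀ p, ‖F p‖ ≤ C := fun p => hfC _
    have bG : ∀ k p, ‖G k p‖ ≤ C := fun k p => hgC _ _
    have fubini : ∀ {φ : E × (Fin n → E) → ℝ} {D : ℝ}, Measurable φ → (∀ p, ‖φ p‖ ≤ D) →
        ∫ p, φ p ∂((ν 0).prod π) = ∫ y, ∫ x, φ (x, y) ∂(ν 0) ∂π := fun {φ D} hφ hD =>
      integral_prod_symm _ (integrable_of_norm_le hφ.aestronglyMeasurable hD)
    set A : (Fin n → E) → ℂ := fun y => ∫ x, F (x, y) ∂(ν 0) with hA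
    set B : Fin n → (Fin n → E) → ℂ := fun k y => ∫ x, G k.succ (x, y) ∂(ν 0) with hB
    have mint : ∀ {φ : E × (Fin n → E) → ℂ}, Measurable φ →
        Measurable fun y => ∫ x, φ (x, y) ∂(ν 0) := fun {φ} hφ =>
      (hφ.stronglyMeasurable.integral_prod_left' (μ := ν 0)).measurable
    have bint : ∀ {φ : E × (Fin n → E) → ℂ}, (∀ p, ‖φ p‖ ≤ C) →
        ∀ y, ‖∫ x, φ (x, y) ∂(ν 0)‖ ≤ C := fun {φ} hφ y => by
      have := norm_integral_le_of_norm_le_const (μ := ν 0) (ae_of_all _ fun x => hφ (x, y))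
      simpa using this
    have hm : ∫ x', f x' ∂(Measure.pi ν) = ∫ y, A y ∂π := by
      rw [conv]
      exact integral_prod_symm _ (integrable_of_norm_le mF.aestronglyMeasurable bF)
    set m := ∫ y, A y ∂π with hm'
    have lp : ∀ {φ : E × (Fin n → E) → ℂ}, Measurable φ → (∀ p, ‖φ p‖ ≤ C + C) → ∀ y,
        MemLp (fun x => φ (x, y)) 2 (ν 0) := fun {φ} hφ hb y =>
      MemLp.of_bound (hφ.comp measurable_prodMk_right).aestronglyMeasurable (C + C)
        (ae_of_all _ fun x => hb _)
    have C0 : ∀ p : E × (Fin n → E), 0 ≤ C := fun p => (norm_nonneg _).trans (bF p)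
    have lpF : ∀ y, MemLp (fun x => F (x, y)) 2 (ν 0) := lp mF fun p => by
      have := C0 p; linarith [bF p]
    have bsub : ∀ k p, ‖F p - G k p‖ ≤ C + C := fun k p =>
      (norm_sub_le _ _).trans (add_le_add (bF p) (bG k p))
    have bsq : ∀ {w : ℂ}, ‖w‖ ≤ C + C → ‖‖w‖ ^ 2‖ ≤ (C + C) ^ 2 := fun {w} hw => by
      rw [norm_pow, norm_norm]; gcongr
    have mm : ‖m‖ ≤ C := by
      have := norm_integral_le_of_norm_le_const (μ := π) (ae_of_all _ fun y => bint bF y)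
      simpa using this
    have mSq : ∀ k, Measurable fun p => ‖F p - G k p‖ ^ 2 := fun k =>
      ((mF.sub (mG k)).norm.pow_const 2)
    have isub : ∀ k, Integrable (fun y => ∫ x, ‖F (x, y) - G k (x, y)‖ ^ 2 ∂(ν 0)) π := fun k =>
      (integrable_of_norm_le (mSq k).aestronglyMeasurable
        (fun p => bsq (bsub k p)) : Integrable _ ((ν 0).prod π)).integral_prod_right
    have iAm : Integrable (fun y => ‖A y - m‖ ^ 2) π :=
      integrable_of_norm_le (((mint mF).sub_const m).norm.pow_const 2).aestronglyMeasurable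
        fun y => bsq ((norm_sub_le _ _).trans (add_le_add (bint bF y) mm))
    rw [conv, hm]
    -- For fixed `y` the mean square about `m` splits into the variance in the first coordinate and
    -- `‖A y - m‖²`. As `g 0` is constant in the first coordinate, that variance is at most the mean
    -- square distance to it.
    have lhs : ∫ p, ‖F p - m‖ ^ 2 ∂((ν 0).prod π)
        ≤ ∫ y, (∫ x, ‖F (x, y) - G 0 (x, y)‖ ^ 2 ∂(ν 0) + ‖A y - m‖ ^ 2) ∂π := by
      have hb : ∀ p, ‖F p - m‖ ≤ C + C := fun p =>
        (norm_sub_le _ _).trans (add_le_add (bF p) mm)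
      have ms : Measurable fun p => ‖F p - m‖ ^ 2 := (mF.sub_const m).norm.pow_const 2
      rw [fubini ms fun p => bsq (hb p)]
      refine integral_mono (integrable_of_norm_le ms.aestronglyMeasurable
        (fun p => bsq (hb p)) : Integrable _ ((ν 0).prod π)).integral_prod_right
        ((isub 0).add iAm) fun y => ?_
      rw [integral_norm_sub_sq (lpF y) m]
      refine add_le_add_left ?_ _
      rcases isEmpty_or_nonempty E with hE | ⟨⟨e⟩⟩
      · simp [integral_of_isEmpty]
      · have hc : ∀ x, G 0 (x, y) = G 0 (e, y) := fun x => by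
          have := hgk 0 (Fin.cons e y) x
          rw [Fin.update_cons_zero] at this
          exact this
        simp_rw [hc]
        exact integral_norm_sub_integral_sq_le (lpF y) _
    -- Averaging over the first coordinate preserves independence from coordinate `k`, so the
    -- induction hypothesis applies to the averaged functions.
    have step : ∫ y, ‖A y - m‖ ^ 2 ∂π ≤ ∑ k, ∫ y, ‖A y - B k y‖ ^ 2 ∂π := by
      refine ih (fun k => ν k.succ) (mint mF) (bint bF) (fun k => mint (mG _))
        (fun k => bint (bG _)) fun k y e => ?_
      simp only [hB, hG]
      congr 1; ext x
      rw [Fin.cons_update, hgk]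
    have jensen : ∀ k, ∫ y, ‖A y - B k y‖ ^ 2 ∂π
        ≤ ∫ p, ‖F p - G k.succ p‖ ^ 2 ∂((ν 0).prod π) := by
      intro k
      rw [fubini (mSq k.succ) fun p => bsq (bsub _ p)]
      refine integral_mono (integrable_of_norm_le
        (((mint mF).sub (mint (mG k.succ))).norm.pow_const 2).aestronglyMeasurable
        fun y => bsq ((norm_sub_le _ _).trans (add_le_add (bint bF y) (bint (bG _) y))))
        (isub _) fun y => ?_
      have lG : MemLp (fun x => G k.succ (x, y)) 2 (ν 0) := lp (mG _) (fun p => by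
        have := C0 p; linarith [bG k.succ p]) y
      have e : A y - B k y = ∫ x, (F (x, y) - G k.succ (x, y)) ∂(ν 0) :=
        (integral_sub ((lpF y).integrable one_le_two) (lG.integrable one_le_two)).symm
      change ‖A y - B k y‖ ^ 2 ≤ _
      rw [e]
      exact norm_integral_sq_le ((lpF y).sub lG)
    refine lhs.trans ?_
    rw [integral_add (isub 0) iAm, Fin.sum_univ_succ]
    simp_rw [conv]
    refine add_le_add (le_of_eq ?_) (step.trans (Finset.sum_le_sum fun k _ => jensen k))
    exact (fubini (mSq 0) fun p => bsq (bsub _ p)).symm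

/-- The Efron–Stein inequality for a bounded function of independent random variables. -/
lemma efron_stein {Ω E : Type*} [MeasurableSpace Ω] [MeasurableSpace E] {μ : Measure Ω}
    [IsProbabilityMeasure μ] {n : ℕ} {B : Fin n → Ω → E} (hB : ∀ k, Measurable (B k))
    (hind : iIndepFun B μ) {f : (Fin n → E) → ℂ} {g : Fin n → (Fin n → E) → ℂ} {C : ℝ}
    (hf : Measurable f) (hfC : ∀ x, ‖f x‖ ≤ C) (hg : ∀ k, Measurable (g k))
    (hgC : ∀ k x, ‖g k x‖ ≤ C) (hgk : ∀ k x e, g k (Function.update x k e) = g k x) :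
    ∫ ω, ‖f (fun k => B k ω) - ∫ ω', f (fun k => B k ω') ∂μ‖ ^ 2 ∂μ
      ≤ ∑ k, ∫ ω, ‖f (fun k => B k ω) - g k (fun k => B k ω)‖ ^ 2 ∂μ := by
  have mB : Measurable fun ω k => B k ω := measurable_pi_lambda _ hB
  have hmap := (iIndepFun_iff_map_fun_eq_pi_map fun k => (hB k).aemeasurable).1 hind
  have : ∀ k, IsProbabilityMeasure (μ.map (B k)) := fun k =>
    Measure.isProbabilityMeasure_map (hB k).aemeasurable
  have key := efron_stein_pi (fun k => μ.map (B k)) hf hfC hg hgC hgk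
  rw [← hmap] at key
  rw [integral_map mB.aemeasurable hf.aestronglyMeasurable,
    integral_map mB.aemeasurable ((hf.sub_const _).norm.pow_const 2).aestronglyMeasurable] at key
  refine key.trans (le_of_eq (Finset.sum_congr rfl fun k _ => ?_))
  exact integral_map mB.aemeasurable ((hf.sub (hg k)).norm.pow_const 2).aestronglyMeasurable

end EfronStein

/-! ### Integrating out one of two independent random variables -/

section Independent

variable {Ω α β : Type*} [MeasurableSpace Ω] [MeasurableSpace α] [MeasurableSpace β]
  {μ : Measure Ω} [IsProbabilityMeasure μ] {U : Ω → α} {V : Ω → β}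

/-- A bound that holds with `V` frozen passes to the joint expectation. The argument uses
nonnegative Lebesgue integrals, since integrability of `F (U, V)` is part of the conclusion. -/
lemma integral_le_of_indepFun (h : IndepFun U V μ) (hU : Measurable U) (hV : Measurable V)
    {F : α → β → ℝ} (hF : Measurable fun p : α × β => F p.1 p.2) (hF0 : ∀ x y, 0 ≤ F x y) {C : ℝ}
    (hC : 0 ≤ C) (hint : ∀ ω, Integrable (fun ω' => F (U ω') (V ω)) μ)
    (hb : ∀ ω, ∫ ω', F (U ω') (V ω) ∂μ ≤ C) :
    Integrable (fun ω => F (U ω) (V ω)) μ ∧ ∫ ω, F (U ω) (V ω) ∂μ ≤ C := by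
  have : IsProbabilityMeasure (μ.map U) := Measure.isProbabilityMeasure_map hU.aemeasurable
  have : IsProbabilityMeasure (μ.map V) := Measure.isProbabilityMeasure_map hV.aemeasurable
  have hmap := (indepFun_iff_map_prod_eq_prod_map_map hU.aemeasurable hV.aemeasurable).1 h
  have mE : Measurable fun p : α × β => ENNReal.ofReal (F p.1 p.2) := hF.ennreal_ofReal
  have mUV : Measurable fun ω => (U ω, V ω) := hU.prodMk hV
  have l : ∫⁻ ω, ENNReal.ofReal (F (U ω) (V ω)) ∂μ ≤ ENNReal.ofReal C := by
    calc ∫⁻ ω, ENNReal.ofReal (F (U ω) (V ω)) ∂μ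
        = ∫⁻ p, ENNReal.ofReal (F p.1 p.2) ∂(μ.map fun ω => (U ω, V ω)) :=
          (lintegral_map mE mUV).symm
      _ = ∫⁻ y, ∫⁻ x, ENNReal.ofReal (F x y) ∂(μ.map U) ∂(μ.map V) := by
          rw [hmap, lintegral_prod_symm' _ mE]
      _ = ∫⁻ ω, ∫⁻ x, ENNReal.ofReal (F x (V ω)) ∂(μ.map U) ∂μ :=
          lintegral_map mE.lintegral_prod_left' hV
      _ = ∫⁻ ω, ∫⁻ ω', ENNReal.ofReal (F (U ω') (V ω)) ∂μ ∂μ := by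
          refine lintegral_congr fun ω => ?_
          exact lintegral_map (mE.comp measurable_prodMk_right) hU
      _ ≤ ∫⁻ _, ENNReal.ofReal C ∂μ := by
          refine lintegral_mono fun ω => ?_
          rw [← ofReal_integral_eq_lintegral_ofReal (hint ω) (ae_of_all _ fun _ => hF0 _ _)]
          exact ENNReal.ofReal_le_ofReal (hb ω)
      _ = ENNReal.ofReal C := by simp
  have mm : AEStronglyMeasurable (fun ω => F (U ω) (V ω)) μ :=
    (hF.comp mUV).aestronglyMeasurable
  have i : Integrable (fun ω => F (U ω) (V ω)) μ :=
    (lintegral_ofReal_ne_top_iff_integrable mm (ae_of_all _ fun _ => hF0 _ _)).1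
      (ne_top_of_le_ne_top ENNReal.ofReal_ne_top l)
  refine ⟨i, ?_⟩
  rw [← ofReal_integral_eq_lintegral_ofReal i (ae_of_all _ fun _ => hF0 _ _)] at l
  exact (ENNReal.ofReal_le_ofReal_iff hC).1 l

lemma integral_eq_of_indepFun (h : IndepFun U V μ) (hU : Measurable U) (hV : Measurable V)
    {F : α → β → ℂ} (hF : Measurable fun p : α × β => F p.1 p.2)
    (hint : Integrable (fun ω => F (U ω) (V ω)) μ) :
    ∫ ω, F (U ω) (V ω) ∂μ = ∫ ω, ∫ ω', F (U ω') (V ω) ∂μ ∂μ := by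
  have : IsProbabilityMeasure (μ.map U) := Measure.isProbabilityMeasure_map hU.aemeasurable
  have : IsProbabilityMeasure (μ.map V) := Measure.isProbabilityMeasure_map hV.aemeasurable
  have hmap := (indepFun_iff_map_prod_eq_prod_map_map hU.aemeasurable hV.aemeasurable).1 h
  have mUV : Measurable fun ω => (U ω, V ω) := hU.prodMk hV
  have hint' : Integrable (fun p : α × β => F p.1 p.2) ((μ.map U).prod (μ.map V)) := by
    rw [← hmap]
    exact (integrable_map_measure hF.aestronglyMeasurable mUV.aemeasurable).2 hint
  calc ∫ ω, F (U ω) (V ω) ∂μ = ∫ p, F p.1 p.2 ∂(μ.map fun ω => (U ω, V ω)) :=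
        (integral_map mUV.aemeasurable hF.aestronglyMeasurable).symm
    _ = ∫ y, ∫ x, F x y ∂(μ.map U) ∂(μ.map V) := by
        rw [hmap]; exact integral_prod_symm _ hint'
    _ = ∫ ω, ∫ x, F x (V ω) ∂(μ.map U) ∂μ :=
        integral_map hV.aemeasurable
          (hF.stronglyMeasurable.integral_prod_left' (μ := μ.map U)).aestronglyMeasurable
    _ = ∫ ω, ∫ ω', F (U ω') (V ω) ∂μ ∂μ := by
        congr 1; ext ω
        exact integral_map hU.aemeasurable (hF.comp measurable_prodMk_right).aestronglyMeasurable

end Independent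

/-! ### Grouping independent random variables -/

section Grouping

variable {Ω : Type*} [MeasurableSpace Ω] {μ : Measure Ω} [IsProbabilityMeasure μ]

/-- Independence says that the joint law is a product measure, and a product over pairs is a product
of products. -/
lemma iIndepFun_curry {ι : Type*} {κ : ι → Type*} {β : Type*} [MeasurableSpace β]
    {X : (i : ι) → κ i → Ω → β} (mX : ∀ i j, Measurable (X i j))
    (h : iIndepFun (fun (p : (i : ι) × κ i) ω => X p.1 p.2 ω) μ) :
    iIndepFun (fun i ω (j : κ i) => X i j ω) μ := by
  have : ∀ i j, IsProbabilityMeasure (μ.map (X i j)) :=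
    fun i j => Measure.isProbabilityMeasure_map (mX i j).aemeasurable
  have hsub : ∀ i, iIndepFun (fun (j : κ i) ω => X i j ω) μ := fun i =>
    h.precomp (g := fun j : κ i => (⟨i, j⟩ : (i : ι) × κ i)) fun a b hab => by simpa using hab
  rw [iIndepFun_iff_map_fun_eq_infinitePi_map (by fun_prop)] at h ⊢
  have hlaw : ∀ i, μ.map (fun ω (j : κ i) => X i j ω)
      = Measure.infinitePi fun j => μ.map (X i j) := fun i =>
    (iIndepFun_iff_map_fun_eq_infinitePi_map (by fun_prop)).1 (hsub i)
  simp_rw [hlaw]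
  rw [← Measure.infinitePi_map_piCurry (fun i j => μ.map (X i j))]
  have e : (fun ω i j => X i j ω) = (MeasurableEquiv.piCurry fun i (_ : κ i) => β) ∘
      (fun ω (p : (i : ι) × κ i) => X p.1 p.2 ω) := by
    ext; simp [Sigma.curry]
  rw [e, ← Measure.map_map (by fun_prop) (by fun_prop), h]

/-- Functions of disjoint groups of independent random variables are independent; the groups are
the fibres of `key`. -/
lemma iIndepFun_of_fibers {ι κ β γ : Type*} [MeasurableSpace β] [MeasurableSpace γ]
    {X : ι → Ω → β} (mX : ∀ i, Measurable (X i)) (h : iIndepFun X μ) (key : ι → κ)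
    (φ : ∀ k, ({i // key i = k} → β) → γ) (hφ : ∀ k, Measurable (φ k)) :
    iIndepFun (fun k ω => φ k fun i => X i ω) μ := by
  have h1 : iIndepFun (fun (p : (k : κ) × {i // key i = k}) ω => X p.2 ω) μ :=
    h.precomp (Equiv.sigmaFiberEquiv key).injective
  exact (iIndepFun_curry (X := fun k (i : {i // key i = k}) => X i) (fun _ i => mX i) h1).comp φ hφ

end Grouping

/-! ### Measurability of resolvents and forms -/

section Measurability

variable {n : Type*} [Fintype n] [DecidableEq n]

/-- Cramer's rule: the inverse is the adjugate divided by the determinant. The identity holds for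
singular matrices too, where both sides are zero, so no Hermitian hypothesis is needed. -/
lemma measurable_resolvent (z : ℂ) (i j : n) :
    Measurable fun m : n → n → ℂ => resolventMatrix (Matrix.of m) z i j := by
  have hc : Continuous fun m : n → n → ℂ => z • (1 : Matrix n n ℂ) - Matrix.of m := by
    refine Continuous.sub continuous_const ?_
    exact continuous_id
  have h1 : Measurable fun m : n → n → ℂ => (z • (1 : Matrix n n ℂ) - Matrix.of m).det :=
    hc.matrix_det.measurable
  have h2 : Measurable fun m : n → n → ℂ => (z • (1 : Matrix n n ℂ) - Matrix.of m).adjugate i j :=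
    (hc.matrix_adjugate.matrix_elem i j).measurable
  have e : (fun m : n → n → ℂ => resolventMatrix (Matrix.of m) z i j)
      = fun m => (z • (1 : Matrix n n ℂ) - Matrix.of m).det⁻¹
        * (z • (1 : Matrix n n ℂ) - Matrix.of m).adjugate i j := by
    ext m
    rw [resolventMatrix, Matrix.inv_def, Matrix.smul_apply, Ring.inverse_eq_inv', smul_eq_mul]
  rw [e]
  exact h1.inv.mul h2

lemma measurable_zeroOut (k : n) :
    Measurable fun (m : n → n → ℂ) a b => zeroOut k (Matrix.of m) a b := by
  refine measurable_pi_lambda _ fun a => measurable_pi_lambda _ fun b => ?_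
  by_cases h : a = k ∨ b = k
  · simp only [zeroOut, Matrix.of_apply, if_pos h]; exact measurable_const
  · simp only [zeroOut, Matrix.of_apply, if_neg h]
    fun_prop

lemma Measurable.linForm {α : Type*} [MeasurableSpace α] {c y : α → n → ℂ}
    (hc : ∀ b, Measurable fun x => c x b) (hy : ∀ b, Measurable fun x => y x b) :
    Measurable fun x => _root_.linForm (c x) (y x) := by
  unfold _root_.linForm
  exact Finset.measurable_sum _ fun b _ => (hy b).mul (hc b)

lemma Measurable.centeredQuad {α : Type*} [MeasurableSpace α] (v : n → ℝ) {M : α → Matrix n n ℂ}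
    {y : α → n → ℂ} (hM : ∀ a b, Measurable fun x => M x a b)
    (hy : ∀ b, Measurable fun x => y x b) :
    Measurable fun x => _root_.centeredQuad v (M x) (y x) := by
  unfold _root_.centeredQuad quadForm
  exact (Finset.measurable_sum _ fun a _ => Finset.measurable_sum _ fun b _ =>
    ((hy a).mul (hM a b)).mul (measurable_star_complex.comp (hy b))).sub
    (Finset.measurable_sum _ fun a _ => (hM a a).const_mul _)

end Measurability

/-! ### Wigner matrices with entries of size `r` -/

/-- A random Hermitian matrix with independent centered entries on and above the diagonal, whose
off-diagonal entries have fourth moments at most `r ^ 4` and whose diagonal entries have second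
moments at most `r ^ 2`. -/
structure IsWignerType {N : ℕ} {Ω : Type u} [MeasurableSpace Ω] (μ : Measure Ω)
    (X : Ω → Matrix (Fin N) (Fin N) ℂ) (r : ℝ) : Prop where
  nonneg : 0 ≤ r
  isHermitian : ∀ ω, (X ω).IsHermitian
  measurable_entry : ∀ j k, Measurable fun ω => X ω j k
  indep : iIndepFun
    (fun (p : {p : Fin N × Fin N // p.1 ≤ p.2}) (ω : Ω) => X ω p.1.1 p.1.2) μ
  mean : ∀ j k, ∫ ω, X ω j k ∂μ = 0
  offdiag_memLp : ∀ j k, j ≠ k → MemLp (fun ω => X ω j k) 4 μ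
  offdiag_fourth : ∀ j k, j ≠ k → ∫ ω, ‖X ω j k‖ ^ 4 ∂μ ≤ r ^ 4
  diag_memLp : ∀ i, MemLp (fun ω => X ω i i) 2 μ
  diag_second : ∀ i, ∫ ω, ‖X ω i i‖ ^ 2 ∂μ ≤ r ^ 2

namespace IsWignerType

variable {N : ℕ} {Ω : Type u} [MeasurableSpace Ω] {μ : Measure Ω} [IsProbabilityMeasure μ]
  {X : Ω → Matrix (Fin N) (Fin N) ℂ} {r : ℝ}

lemma measurable_fun (h : IsWignerType μ X r) : Measurable fun ω a b => X ω a b :=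
  measurable_pi_lambda _ fun a => measurable_pi_lambda _ fun b => h.measurable_entry a b

lemma measurable_comp (h : IsWignerType μ X r) {φ : Matrix (Fin N) (Fin N) ℂ → ℂ}
    (hφ : Measurable fun m : Fin N → Fin N → ℂ => φ (Matrix.of m)) :
    Measurable fun ω => φ (X ω) := hφ.comp h.measurable_fun

lemma measurable_resolvent (h : IsWignerType μ X r) (z : ℂ) (i j : Fin N) :
    Measurable fun ω => resolventMatrix (X ω) z i j :=
  h.measurable_comp (φ := fun M => resolventMatrix M z i j) (_root_.measurable_resolvent z i j)

/-- `IsWignerType` contains no lower bound on variances, so it survives zeroing entries. Estimates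
proved for `X` thereby apply to the matrix without row and column `k`, with the same `r`. -/
lemma zeroOut (h : IsWignerType μ X r) (k : Fin N) :
    IsWignerType μ (fun ω => _root_.zeroOut k (X ω)) r := by
  have e : ∀ a b, (fun ω => _root_.zeroOut k (X ω) a b)
      = if a = k ∨ b = k then fun _ => 0 else fun ω => X ω a b := fun a b => by
    by_cases hab : a = k ∨ b = k <;> simp [_root_.zeroOut, hab]
  refine ⟨h.nonneg, fun ω => isHermitian_zeroOut (h.isHermitian ω) k, fun a b => ?_, ?_,
    fun a b => ?_, fun a b hab => ?_, fun a b hab => ?_, fun a => ?_, fun a => ?_⟩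
  · rw [e]; split_ifs
    exacts [measurable_const, h.measurable_entry a b]
  · have := h.indep.comp (fun p x => if p.1.1 = k ∨ p.1.2 = k then 0 else x) fun p => by
      by_cases hp : p.1.1 = k ∨ p.1.2 = k
      · simp only [if_pos hp]; exact measurable_const
      · simp only [if_neg hp]; exact measurable_id
    exact this
  · have := e a b
    split_ifs at this with hab
    · rw [this]; simp
    · rw [this]; exact h.mean a b
  · rw [e]; split_ifs
    exacts [memLp_const 0, h.offdiag_memLp a b hab]
  · have := e a b
    split_ifs at this with hk
    · simp_rw [congrFun this]; simp only [norm_zero]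
      have := h.nonneg
      simp only [ne_eq, OfNat.ofNat_ne_zero, not_false_eq_true, zero_pow, integral_zero]
      positivity
    · simp_rw [congrFun this]; exact h.offdiag_fourth a b hab
  · rw [e]; split_ifs
    exacts [memLp_const 0, h.diag_memLp a]
  · have := e a a
    split_ifs at this with hk
    · simp_rw [congrFun this]; simp only [norm_zero]
      have := h.nonneg
      simp only [ne_eq, OfNat.ofNat_ne_zero, not_false_eq_true, zero_pow, integral_zero]
      positivity
    · simp_rw [congrFun this]; exact h.diag_second a

lemma measurable_row (h : IsWignerType μ X r) (k : Fin N) : Measurable fun ω => X ω k :=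
  measurable_pi_lambda _ fun b => h.measurable_entry k b

/-- The entries of a row are independent. -/
lemma iIndepFun_row (h : IsWignerType μ X r) (k : Fin N) : iIndepFun (fun a ω => X ω k a) μ := by
  -- Each entry of row `k` is, up to conjugation, one entry of the upper triangle, and different
  -- columns use different entries.
  set g : Fin N → {p : Fin N × Fin N // p.1 ≤ p.2} := fun a =>
    if ha : a ≤ k then ⟨(a, k), ha⟩ else ⟨(k, a), (not_le.mp ha).le⟩ with hg
  have hinj : Function.Injective g := by
    intro a b hab
    simp only [hg] at hab
    split_ifs at hab with ha hb hb <;> simp only [Subtype.mk.injEq, Prod.mk.injEq] at hab <;> grind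
  have h1 := (h.indep.precomp hinj).comp (fun a x => if a ≤ k then star x else x) fun a => by
    by_cases ha : a ≤ k
    · simp only [if_pos ha]; exact measurable_star_complex
    · simp only [if_neg ha]; exact measurable_id
  convert h1 using 2 with a
  ext ω
  by_cases ha : a ≤ k
  · simp only [Function.comp, hg, dif_pos ha, if_pos ha]
    exact ((h.isHermitian ω).apply k a).symm
  · simp only [Function.comp, hg, dif_neg ha, if_neg ha]

lemma isCenteredFamily_offRow (h : IsWignerType μ X r) (k : Fin N) :
    IsCenteredFamily μ (fun ω => offRow k (X ω)) r := by
  have e : ∀ a, (fun ω => offRow k (X ω) a) = if a = k then fun _ => 0 else fun ω => X ω k a := by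
    intro a
    by_cases ha : a = k
    · subst ha; simp [offRow]
    · simp [offRow, ha]
  refine ⟨h.nonneg, measurable_pi_lambda _ fun a => ?_, ?_, fun a => ?_, fun a => ?_, fun a => ?_⟩
  · rw [e]; split_ifs
    exacts [measurable_const, h.measurable_entry k a]
  · have := (h.iIndepFun_row k).comp (fun a x => if a = k then 0 else x) fun a => by
      by_cases ha : a = k
      · simp only [if_pos ha]; exact measurable_const
      · simp only [if_neg ha]; exact measurable_id
    convert this using 2 with a
    rw [e]
    split_ifs with ha <;> ext ω <;> simp [ha]
  · rw [e]; split_ifs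
    exacts [by simp, h.mean k a]
  · rw [e]; split_ifs with ha
    exacts [memLp_const 0, h.offdiag_memLp k a (Ne.symm ha)]
  · have := e a
    split_ifs at this with hk
    · simp_rw [congrFun this]; simp only [norm_zero]
      have := h.nonneg
      simp only [ne_eq, OfNat.ofNat_ne_zero, not_false_eq_true, zero_pow, integral_zero]
      positivity
    · simp_rw [congrFun this]; exact h.offdiag_fourth k a (Ne.symm hk)

/-- A diagonal entry is independent of the rest of its row. -/
lemma indepFun_diag_offRow (h : IsWignerType μ X r) (k : Fin N) :
    IndepFun (fun ω => X ω k k) (fun ω => offRow k (X ω)) μ :=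
  indepFun_update (h.measurable_row k) (h.iIndepFun_row k) k

/-- A row is independent of the minor obtained by removing it. -/
lemma indepFun_row_minor (h : IsWignerType μ X r) (k : Fin N) :
    IndepFun (fun ω => X ω k) (fun ω a b => _root_.zeroOut k (X ω) a b) μ := by
  -- The upper triangle is divided into the positions touching `k`, which determine row `k`, and the
  -- others, which determine the zeroed matrix.
  set S : Finset {p : Fin N × Fin N // p.1 ≤ p.2} :=
    Finset.univ.filter fun p => p.1.1 = k ∨ p.1.2 = k with hS
  have h1 := h.indep.indepFun_finset S Sᶜ disjoint_compl_right
    fun p => h.measurable_entry p.1.1 p.1.2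
  set φ : (S → ℂ) → Fin N → ℂ := fun w a =>
    if ha : a ≤ k then star (w ⟨⟨(a, k), ha⟩, by simp [hS]⟩)
      else w ⟨⟨(k, a), (not_le.mp ha).le⟩, by simp [hS]⟩ with hφ
  set ψ : (↥Sᶜ → ℂ) → Fin N → Fin N → ℂ := fun w a b =>
    if hk : a = k ∨ b = k then 0 else
      if hab : a ≤ b then w ⟨⟨(a, b), hab⟩, by simpa [hS, not_or] using hk⟩
      else star (w ⟨⟨(b, a), (not_le.mp hab).le⟩, by simpa [hS, not_or, and_comm] using hk⟩) with hψ
  have mφ : Measurable φ := by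
    refine measurable_pi_lambda _ fun a => ?_
    by_cases ha : a ≤ k
    · simp only [hφ, dif_pos ha]
      exact measurable_star_complex.comp (measurable_pi_apply _)
    · simp only [hφ, dif_neg ha]
      exact measurable_pi_apply _
  have mψ : Measurable ψ := by
    refine measurable_pi_lambda _ fun a => measurable_pi_lambda _ fun b => ?_
    by_cases hk : a = k ∨ b = k
    · simp only [hψ, dif_pos hk]; exact measurable_const
    · by_cases hab : a ≤ b
      · simp only [hψ, dif_neg hk, dif_pos hab]; exact measurable_pi_apply _
      · simp only [hψ, dif_neg hk, dif_neg hab]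
        exact measurable_star_complex.comp (measurable_pi_apply _)
  refine (h1.comp mφ mψ).congr (ae_of_all _ fun ω => ?_) (ae_of_all _ fun ω => ?_)
  · funext a
    by_cases ha : a ≤ k
    · simp only [Function.comp, hφ, dif_pos ha]
      exact (h.isHermitian ω).apply k a
    · simp only [Function.comp, hφ, dif_neg ha]
  · funext a b
    by_cases hk : a = k ∨ b = k
    · simp only [Function.comp, hψ, dif_pos hk, _root_.zeroOut, Matrix.of_apply, if_pos hk]
    · by_cases hab : a ≤ b
      · simp only [Function.comp, hψ, dif_neg hk, dif_pos hab, _root_.zeroOut, Matrix.of_apply,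
          if_neg hk]
      · simp only [Function.comp, hψ, dif_neg hk, dif_neg hab, _root_.zeroOut, Matrix.of_apply,
          if_neg hk]
        exact (h.isHermitian ω).apply a b

/-- Conditioning on the minor: bounds for forms with deterministic coefficients become bounds for
forms whose coefficients are built from `R^(k)`. -/
lemma integral_le_of_row (h : IsWignerType μ X r) (k : Fin N)
    {F : (Fin N → ℂ) → Matrix (Fin N) (Fin N) ℂ → ℝ}
    (hF : Measurable fun p : (Fin N → ℂ) × (Fin N → Fin N → ℂ) => F p.1 (Matrix.of p.2))
    (hF0 : ∀ x M, 0 ≤ F x M) {C : ℝ} (hC : 0 ≤ C)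
    (hint : ∀ ω, Integrable (fun ω' => F (X ω' k) (_root_.zeroOut k (X ω))) μ)
    (hb : ∀ ω, ∫ ω', F (X ω' k) (_root_.zeroOut k (X ω)) ∂μ ≤ C) :
    Integrable (fun ω => F (X ω k) (_root_.zeroOut k (X ω))) μ ∧
      ∫ ω, F (X ω k) (_root_.zeroOut k (X ω)) ∂μ ≤ C :=
  integral_le_of_indepFun (h.indepFun_row_minor k) (h.measurable_row k) (h.zeroOut k).measurable_fun
    (F := fun x m => F x (Matrix.of m)) hF (fun _ _ => hF0 _ _) hC hint hb

lemma integral_eq_of_row (h : IsWignerType μ X r) (k : Fin N)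
    {F : (Fin N → ℂ) → Matrix (Fin N) (Fin N) ℂ → ℂ}
    (hF : Measurable fun p : (Fin N → ℂ) × (Fin N → Fin N → ℂ) => F p.1 (Matrix.of p.2))
    (hint : Integrable (fun ω => F (X ω k) (_root_.zeroOut k (X ω))) μ) :
    ∫ ω, F (X ω k) (_root_.zeroOut k (X ω)) ∂μ
      = ∫ ω, ∫ ω', F (X ω' k) (_root_.zeroOut k (X ω)) ∂μ ∂μ :=
  integral_eq_of_indepFun (h.indepFun_row_minor k) (h.measurable_row k) (h.zeroOut k).measurable_fun
    (F := fun x m => F x (Matrix.of m)) hF hint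

end IsWignerType

/-! ### The Efron–Stein inequality for functions of a Wigner matrix -/

/-- The Hermitian matrix whose columns above the diagonal are prescribed. -/
def assembleMatrix {N : ℕ} (b : Fin N → Fin N → ℂ) : Matrix (Fin N) (Fin N) ℂ :=
  Matrix.of fun i j => if i < j then b j i else if j < i then star (b i j) else ((b i i).re : ℂ)

/-- Taking real parts on the diagonal makes this true for every `b`. The everywhere-bounds required
by Efron–Stein then follow from resolvent bounds for Hermitian matrices. -/
lemma isHermitian_assembleMatrix {N : ℕ} (b : Fin N → Fin N → ℂ) :
    (assembleMatrix b).IsHermitian := by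
  refine Matrix.IsHermitian.ext fun i j => ?_
  simp only [assembleMatrix, Matrix.of_apply]
  rcases lt_trichotomy i j with hij | hij | hij
  · simp [hij, hij.not_gt]
  · subst hij; simp
  · simp [hij, hij.not_gt]

lemma measurable_assembleMatrix {N : ℕ} :
    Measurable fun (b : Fin N → Fin N → ℂ) i j => assembleMatrix b i j := by
  refine measurable_pi_lambda _ fun i => measurable_pi_lambda _ fun j => ?_
  simp only [assembleMatrix, Matrix.of_apply]
  split_ifs
  · fun_prop
  · exact measurable_star_complex.comp (by fun_prop)
  · exact Complex.measurable_ofReal.comp (Complex.measurable_re.comp (by fun_prop))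

lemma zeroOut_assembleMatrix_update {N : ℕ} (b : Fin N → Fin N → ℂ) (k : Fin N) (e : Fin N → ℂ) :
    zeroOut k (assembleMatrix (Function.update b k e)) = zeroOut k (assembleMatrix b) := by
  ext i j
  by_cases h : i = k ∨ j = k
  · simp [zeroOut, h]
  · obtain ⟨hi, hj⟩ := not_or.mp h
    simp [zeroOut, assembleMatrix, hi, hj]

namespace IsWignerType

variable {N : ℕ} {Ω : Type u} [MeasurableSpace Ω] {μ : Measure Ω} [IsProbabilityMeasure μ]
  {X : Ω → Matrix (Fin N) (Fin N) ℂ} {r : ℝ}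

/-- The columns cut off at the diagonal use each independent entry exactly once; they are the blocks
for Efron–Stein. -/
lemma iIndepFun_columns (h : IsWignerType μ X r) :
    iIndepFun (fun (k : Fin N) ω (j : Fin N) => if j ≤ k then X ω j k else 0) μ := by
  have h1 := iIndepFun_of_fibers (fun p => h.measurable_entry _ _) h.indep
    (fun p : {p : Fin N × Fin N // p.1 ≤ p.2} => p.1.2)
    (fun k w (j : Fin N) => if hj : j ≤ k then w ⟨⟨(j, k), hj⟩, rfl⟩ else 0) (fun k => by
      refine measurable_pi_lambda _ fun j => ?_
      by_cases hj : j ≤ k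
      · simp only [dif_pos hj]; exact measurable_pi_apply _
      · simp only [dif_neg hj]; exact measurable_const)
  convert h1 using 4 with k ω j
  split_ifs <;> rfl

lemma assembleMatrix_columns (h : IsWignerType μ X r) (ω : Ω) :
    assembleMatrix (fun k j => if j ≤ k then X ω j k else 0) = X ω := by
  ext i j
  simp only [assembleMatrix, Matrix.of_apply]
  split_ifs with h1 h2 h3 h4 h5
  · rfl
  · exact absurd h1.le h2
  · exact (h.isHermitian ω).apply i j
  · exact absurd h3.le h4
  · have : i = j := le_antisymm (not_lt.mp h3) (not_lt.mp h1)
    subst this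
    have := (h.isHermitian ω).apply i i
    exact Complex.conj_eq_iff_re.mp this
  · exact absurd le_rfl h5

/-- Changing block `k` alters only row and column `k`, so any function of the matrix with these set
to zero is a legitimate comparison. -/
lemma efron_stein (h : IsWignerType μ X r) {φ : Matrix (Fin N) (Fin N) ℂ → ℂ}
    {γ : Fin N → Matrix (Fin N) (Fin N) ℂ → ℂ} {C : ℝ}
    (hφ : Measurable fun m : Fin N → Fin N → ℂ => φ (Matrix.of m))
    (hφC : ∀ M : Matrix (Fin N) (Fin N) ℂ, M.IsHermitian → ‖φ M‖ ≤ C)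
    (hγ : ∀ k, Measurable fun m : Fin N → Fin N → ℂ => γ k (Matrix.of m))
    (hγC : ∀ k (M : Matrix (Fin N) (Fin N) ℂ), M.IsHermitian → ‖γ k M‖ ≤ C) :
    ∫ ω, ‖φ (X ω) - ∫ ω', φ (X ω') ∂μ‖ ^ 2 ∂μ
      ≤ ∑ k, ∫ ω, ‖φ (X ω) - γ k (_root_.zeroOut k (X ω))‖ ^ 2 ∂μ := by
  have key := _root_.efron_stein (B := fun (k : Fin N) ω (j : Fin N) => if j ≤ k then X ω j k else 0)
    (f := fun b => φ (assembleMatrix b))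
    (g := fun k b => γ k (_root_.zeroOut k (assembleMatrix b)))
    (fun k => measurable_pi_lambda _ fun j => by
      by_cases hj : j ≤ k
      · simp only [if_pos hj]; exact h.measurable_entry j k
      · simp only [if_neg hj]; exact measurable_const)
    h.iIndepFun_columns (hφ.comp measurable_assembleMatrix)
    (fun b => hφC _ (isHermitian_assembleMatrix b))
    (fun k => ((hγ k).comp (measurable_zeroOut k)).comp measurable_assembleMatrix)
    (fun k b => hγC k _ (isHermitian_zeroOut (isHermitian_assembleMatrix b) k))
    (fun k b e => by rw [zeroOut_assembleMatrix_update])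
  simp only [h.assembleMatrix_columns] at key
  exact key

end IsWignerType

/-! ### Schur's formula with random fluctuations -/

section Schur

variable {n : Type*} [Fintype n] [DecidableEq n]

/-- The leading part `z - ∑ v_a R_aa` of the inverse of a diagonal resolvent entry. -/
def schurDenom (v : n → ℝ) (M : Matrix n n ℂ) (z : ℂ) : ℂ :=
  z - ∑ a, (v a : ℂ) * resolventMatrix M z a a

/-- The fluctuating part of the inverse of the diagonal resolvent entry `k`. -/
def schurError (v : n → ℝ) (k : n) (X : Matrix n n ℂ) (z : ℂ) : ℂ :=
  X k k + centeredQuad v (resolventMatrix (zeroOut k X) z) (offRow k X)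

lemma im_mul_sum_nonpos {v : n → ℝ} (hv : ∀ a, 0 ≤ v a) {w : n → ℂ} {x : ℝ}
    (hw : ∀ a, x * (w a).im ≤ 0) : x * (∑ a, (v a : ℂ) * w a).im ≤ 0 := by
  rw [Complex.im_sum, Finset.mul_sum]
  refine Finset.sum_nonpos fun a _ => ?_
  rw [Complex.im_ofReal_mul]
  nlinarith [hw a, hv a]

lemma schurDenom_ne_zero {v : n → ℝ} (hv : ∀ a, 0 ≤ v a) {M : Matrix n n ℂ} (hM : M.IsHermitian)
    {z : ℂ} (hz : z.im ≠ 0) : schurDenom v M z ≠ 0 :=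
  sub_ne_zero_of_im hz (im_mul_sum_nonpos hv fun a => im_mul_im_resolvent_diag_nonpos hM hz a)

lemma norm_inv_schurDenom_le {v : n → ℝ} (hv : ∀ a, 0 ≤ v a) {M : Matrix n n ℂ}
    (hM : M.IsHermitian) {z : ℂ} (hz : z.im ≠ 0) : ‖(schurDenom v M z)⁻¹‖ ≤ |z.im|⁻¹ :=
  norm_inv_sub_le hz (im_mul_sum_nonpos hv fun a => im_mul_im_resolvent_diag_nonpos hM hz a)

/-- Schur's formula `R_kk (D - E) = 1` in a form that can be iterated: each substitution gains a
factor `E` and leaves `R_kk`, which is bounded, in the remainder. -/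
lemma resolvent_diag_eq {v : n → ℝ} (hv : ∀ a, 0 ≤ v a) {X : Matrix n n ℂ} (hX : X.IsHermitian)
    {z : ℂ} (hz : z.im ≠ 0) (k : n) :
    resolventMatrix X z k k = (schurDenom v (zeroOut k X) z)⁻¹
      + (schurDenom v (zeroOut k X) z)⁻¹ * (schurError v k X z * resolventMatrix X z k k) := by
  have h1 := resolvent_diag_mul hX hz k
  have hD := schurDenom_ne_zero hv (isHermitian_zeroOut hX k) hz
  have h2 : z - X k k - quadForm (resolventMatrix (zeroOut k X) z) (offRow k X)
      = schurDenom v (zeroOut k X) z - schurError v k X z := by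
    unfold schurDenom schurError centeredQuad; ring
  rw [h2] at h1
  field_simp
  linear_combination h1

lemma measurable_schurDenom (v : n → ℝ) (z : ℂ) :
    Measurable fun m : n → n → ℂ => schurDenom v (Matrix.of m) z := by
  unfold schurDenom
  exact measurable_const.sub
    (Finset.measurable_sum _ fun a _ => (measurable_resolvent z a a).const_mul _)

lemma norm_colForm (k : n) (X : Matrix n n ℂ) (z : ℂ) (i : n) :
    ‖colForm k X z i‖
      = ‖linForm (fun b => star (resolventMatrix (zeroOut k X) z i b)) (offRow k X)‖ := by
  have : colForm k X z i
      = star (linForm (fun b => star (resolventMatrix (zeroOut k X) z i b)) (offRow k X)) := by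
    unfold colForm linForm
    rw [star_sum]
    exact Finset.sum_congr rfl fun b _ => by rw [star_mul', star_star]
  rw [this, norm_star]

end Schur

namespace IsWignerType

variable {N : ℕ} {Ω : Type u} [MeasurableSpace Ω] {μ : Measure Ω} [IsProbabilityMeasure μ]
  {X : Ω → Matrix (Fin N) (Fin N) ℂ} {r : ℝ}

/-- The variances of the entries of row `k`, with `0` on the diagonal. -/
def rowVariance (μ : Measure Ω) (X : Ω → Matrix (Fin N) (Fin N) ℂ) (k a : Fin N) : ℝ :=
  ∫ ω, ‖offRow k (X ω) a‖ ^ 2 ∂μ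

lemma rowVariance_nonneg (k a : Fin N) : 0 ≤ rowVariance μ X k a :=
  IsCenteredFamily.variance_nonneg (y := fun ω => offRow k (X ω)) a

lemma rowVariance_le (h : IsWignerType μ X r) (k a : Fin N) : rowVariance μ X k a ≤ r ^ 2 :=
  (h.isCenteredFamily_offRow k).second a

lemma measurable_update_fst (k b : Fin N) :
    Measurable fun p : (Fin N → ℂ) × (Fin N → Fin N → ℂ) => Function.update p.1 k 0 b :=
  (measurable_pi_apply b).comp ((measurable_update_zero k).comp measurable_fst)

lemma measurable_offRow (h : IsWignerType μ X r) (k b : Fin N) :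
    Measurable fun ω => offRow k (X ω) b :=
  (h.isCenteredFamily_offRow k).measurable_coord b

lemma measurable_resolvent_snd (z : ℂ) (i j : Fin N) :
    Measurable fun p : (Fin N → ℂ) × (Fin N → Fin N → ℂ) =>
      resolventMatrix (Matrix.of p.2) z i j :=
  (_root_.measurable_resolvent z i j).comp measurable_snd

lemma measurable_schurDenom (h : IsWignerType μ X r) (v : Fin N → ℝ) (z : ℂ) :
    Measurable fun ω => schurDenom v (X ω) z :=
  h.measurable_comp (φ := fun M => schurDenom v M z) (_root_.measurable_schurDenom v z)

lemma measurable_schurError (h : IsWignerType μ X r) (v : Fin N → ℝ) (k : Fin N) (z : ℂ) :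
    Measurable fun ω => schurError v k (X ω) z :=
  (h.measurable_entry k k).add
    (Measurable.centeredQuad v (fun a b => (h.zeroOut k).measurable_resolvent z a b)
      fun b => h.measurable_offRow k b)

section RowForms

variable {c : Matrix (Fin N) (Fin N) ℂ → Fin N → ℂ}

lemma measurable_linForm_row (h : IsWignerType μ X r) (k : Fin N)
    (mc : ∀ b, Measurable fun m : Fin N → Fin N → ℂ => c (Matrix.of m) b) :
    Measurable fun ω => linForm (c (_root_.zeroOut k (X ω))) (offRow k (X ω)) :=
  Measurable.linForm (fun b => (h.zeroOut k).measurable_comp (φ := fun M => c M b) (mc b))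
    fun b => h.measurable_offRow k b

lemma fourth_linForm_row (h : IsWignerType μ X r) (k : Fin N) {t : ℝ}
    (mc : ∀ b, Measurable fun m : Fin N → Fin N → ℂ => c (Matrix.of m) b)
    (hc : ∀ M : Matrix (Fin N) (Fin N) ℂ, M.IsHermitian → ∑ b, ‖c M b‖ ^ 2 ≤ t ^ 2) :
    Integrable (fun ω => ‖linForm (c (_root_.zeroOut k (X ω))) (offRow k (X ω))‖ ^ 4) μ ∧
      ∫ ω, ‖linForm (c (_root_.zeroOut k (X ω))) (offRow k (X ω))‖ ^ 4 ∂μ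
        ≤ 34 * r ^ 4 * t ^ 4 := by
  have hy := h.isCenteredFamily_offRow k
  refine h.integral_le_of_row k (F := fun x M => ‖linForm (c M) (Function.update x k 0)‖ ^ 4)
    ((Measurable.linForm (fun b => (mc b).comp measurable_snd)
      fun b => measurable_update_fst k b).norm.pow_const 4)
    (fun _ _ => by positivity) (by positivity)
    (fun ω => integrable_norm_pow_four (hy.memLp_linForm _)) fun ω => ?_
  refine (hy.integral_four_linForm_le _).trans ?_
  have := hc _ (isHermitian_zeroOut (h.isHermitian ω) k)
  calc _ ≤ 34 * r ^ 4 * (t ^ 2) ^ 2 := by gcongr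
    _ = _ := by ring

lemma second_linForm_row (h : IsWignerType μ X r) (k : Fin N) {t : ℝ}
    (mc : ∀ b, Measurable fun m : Fin N → Fin N → ℂ => c (Matrix.of m) b)
    (hc : ∀ M : Matrix (Fin N) (Fin N) ℂ, M.IsHermitian → ∑ b, ‖c M b‖ ^ 2 ≤ t ^ 2) :
    MemLp (fun ω => linForm (c (_root_.zeroOut k (X ω))) (offRow k (X ω))) 2 μ ∧
      ∫ ω, ‖linForm (c (_root_.zeroOut k (X ω))) (offRow k (X ω))‖ ^ 2 ∂μ ≤ (r * t) ^ 2 := by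
  have hy := h.isCenteredFamily_offRow k
  have := h.integral_le_of_row k (F := fun x M => ‖linForm (c M) (Function.update x k 0)‖ ^ 2)
    ((Measurable.linForm (fun b => (mc b).comp measurable_snd)
      fun b => measurable_update_fst k b).norm.pow_const 2)
    (fun _ _ => by positivity) (C := (r * t) ^ 2) (by positivity)
    (fun ω => ((hy.memLp_linForm _).mono_exponent (p := 2) (by norm_num)).norm.integrable_sq)
    fun ω => (hy.integral_sq_linForm_le _).trans (by
      rw [mul_pow]
      exact mul_le_mul_of_nonneg_left (hc _ (isHermitian_zeroOut (h.isHermitian ω) k))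
        (sq_nonneg r))
  exact ⟨(memLp_two_iff_integrable_sq_norm
    (h.measurable_linForm_row k mc).aestronglyMeasurable).2 this.1, this.2⟩

end RowForms

/-! ### Sizes of the row forms, off-diagonal means, and variances -/

section Bounds

variable {z : ℂ} {t : ℝ}

lemma second_rowForm (h : IsWignerType μ X r) (k j : Fin N) (hz : z.im ≠ 0)
    (ht : |z.im|⁻¹ ≤ t) :
    MemLp (fun ω => rowForm k (X ω) z j) 2 μ ∧
      ∫ ω, ‖rowForm k (X ω) z j‖ ^ 2 ∂μ ≤ (r * t) ^ 2 :=
  h.second_linForm_row k (c := fun M b => resolventMatrix M z b j)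
    (fun b => _root_.measurable_resolvent z b j)
    fun _ hM => (sum_col_sq_le hM hz j).trans (by gcongr)

lemma fourth_rowForm (h : IsWignerType μ X r) (k j : Fin N) (hz : z.im ≠ 0)
    (ht : |z.im|⁻¹ ≤ t) :
    Integrable (fun ω => ‖rowForm k (X ω) z j‖ ^ 4) μ ∧
      ∫ ω, ‖rowForm k (X ω) z j‖ ^ 4 ∂μ ≤ 34 * r ^ 4 * t ^ 4 :=
  h.fourth_linForm_row k (c := fun M b => resolventMatrix M z b j)
    (fun b => _root_.measurable_resolvent z b j)
    fun _ hM => (sum_col_sq_le hM hz j).trans (by gcongr)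

lemma second_colForm (h : IsWignerType μ X r) (k i : Fin N) (hz : z.im ≠ 0)
    (ht : |z.im|⁻¹ ≤ t) :
    Integrable (fun ω => ‖colForm k (X ω) z i‖ ^ 2) μ ∧
      ∫ ω, ‖colForm k (X ω) z i‖ ^ 2 ∂μ ≤ (r * t) ^ 2 := by
  simp_rw [norm_colForm]
  have := h.second_linForm_row k (t := t) (c := fun M b => star (resolventMatrix M z i b))
    (fun b => measurable_star_complex.comp (_root_.measurable_resolvent z i b))
    fun _ hM => by simp only [norm_star]; exact (sum_row_sq_le hM hz i).trans (by gcongr)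
  exact ⟨this.1.norm.integrable_sq, this.2⟩

lemma fourth_colForm (h : IsWignerType μ X r) (k i : Fin N) (hz : z.im ≠ 0)
    (ht : |z.im|⁻¹ ≤ t) :
    Integrable (fun ω => ‖colForm k (X ω) z i‖ ^ 4) μ ∧
      ∫ ω, ‖colForm k (X ω) z i‖ ^ 4 ∂μ ≤ 34 * r ^ 4 * t ^ 4 := by
  simp_rw [norm_colForm]
  exact h.fourth_linForm_row k (t := t) (c := fun M b => star (resolventMatrix M z i b))
    (fun b => measurable_star_complex.comp (_root_.measurable_resolvent z i b))
    fun _ hM => by simp only [norm_star]; exact (sum_row_sq_le hM hz i).trans (by gcongr)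

lemma memLp_resolvent (h : IsWignerType μ X r) (i j : Fin N) (hz : z.im ≠ 0) {p : ENNReal} :
    MemLp (fun ω => resolventMatrix (X ω) z i j) p μ :=
  MemLp.of_bound (h.measurable_resolvent z i j).aestronglyMeasurable _
    (ae_of_all _ fun ω => norm_resolvent_le (h.isHermitian ω) hz i j)

/-- The diagonal entry contributes `2 r ^ 2` and the quadratic form `32 N r ^ 4 t ^ 2`; the
hypothesis `N * r ^ 2 ≤ c ^ 2` removes `N`, and `2 + 32 ≤ 36`. -/
lemma second_schurError (h : IsWignerType μ X r) (k : Fin N) (hz : z.im ≠ 0)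
    (ht : |z.im|⁻¹ ≤ t) (ht1 : 1 ≤ t) {c : ℝ} (hc1 : 1 ≤ c) (hN : N * r ^ 2 ≤ c ^ 2) :
    MemLp (fun ω => schurError (rowVariance μ X k) k (X ω) z) 2 μ ∧
      ∫ ω, ‖schurError (rowVariance μ X k) k (X ω) z‖ ^ 2 ∂μ ≤ (6 * c * r * t) ^ 2 := by
  set v := rowVariance μ X k with hv
  have hy := h.isCenteredFamily_offRow k
  have key := h.integral_le_of_row k
    (F := fun x M => ‖x k + centeredQuad v (resolventMatrix M z) (Function.update x k 0)‖ ^ 2)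
    ((((measurable_pi_apply k).comp measurable_fst).add
      (Measurable.centeredQuad v (fun a b => measurable_resolvent_snd z a b)
        fun b => measurable_update_fst k b)).norm.pow_const 2)
    (fun _ _ => by positivity) (C := (6 * c * r * t) ^ 2) (by positivity)
    (fun ω => ((h.diag_memLp k).add (hy.memLp_centeredQuad v _)).norm.integrable_sq) fun ω => ?_
  · exact ⟨(memLp_two_iff_integrable_sq_norm
      (h.measurable_schurError v k z).aestronglyMeasurable).2 key.1, key.2⟩
  · have hM := isHermitian_zeroOut (h.isHermitian ω) k
    have h1 := hy.integral_sq_centeredQuad_le (M := resolventMatrix (_root_.zeroOut k (X ω)) z)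
      (ρ := fun _ => t ^ 2) (fun a => (sum_row_sq_le hM hz a).trans (by gcongr))
      (fun a => (sum_col_sq_le hM hz a).trans (by gcongr))
    rw [Finset.sum_const, Finset.card_univ, Fintype.card_fin, nsmul_eq_mul] at h1
    have i1 := (h.diag_memLp k).norm.integrable_sq
    have i2 := (hy.memLp_centeredQuad v
      (resolventMatrix (_root_.zeroOut k (X ω)) z)).norm.integrable_sq
    calc _ ≤ ∫ ω', (2 * ‖X ω' k k‖ ^ 2
          + 2 * ‖centeredQuad v (resolventMatrix (_root_.zeroOut k (X ω)) z)
            (offRow k (X ω'))‖ ^ 2) ∂μ := by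
          refine integral_mono_of_nonneg (ae_of_all _ fun _ => by positivity)
            ((i1.const_mul 2).add (i2.const_mul 2)) (ae_of_all _ fun ω' => ?_)
          refine (pow_le_pow_left₀ (norm_nonneg _) (norm_add_le _ _) 2).trans ?_
          exact add_sq_le.trans (by simp only [mul_add]; exact le_rfl)
      _ = 2 * ∫ ω', ‖X ω' k k‖ ^ 2 ∂μ + 2 * ∫ ω', ‖centeredQuad v
          (resolventMatrix (_root_.zeroOut k (X ω)) z) (offRow k (X ω'))‖ ^ 2 ∂μ := by
          rw [integral_add (i1.const_mul 2) (i2.const_mul 2), integral_const_mul,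
            integral_const_mul]
      _ ≤ 2 * r ^ 2 + 2 * (16 * r ^ 4 * (N * t ^ 2)) := by
          have := h.diag_second k
          gcongr
          exact h1
      _ = 2 * r ^ 2 + 32 * (N * r ^ 2) * r ^ 2 * t ^ 2 := by ring
      _ ≤ 2 * r ^ 2 + 32 * c ^ 2 * r ^ 2 * t ^ 2 := by gcongr
      _ ≤ (6 * c * r * t) ^ 2 := by
          have h3 : 1 ≤ c ^ 2 * t ^ 2 := by
            have := one_le_pow₀ hc1 (n := 2)
            have := one_le_pow₀ ht1 (n := 2)
            nlinarith
          nlinarith [mul_le_mul_of_nonneg_left h3 (sq_nonneg r), sq_nonneg r]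

/-- The leading term of an off-diagonal resolvent entry has mean zero. -/
lemma integral_inv_schurDenom_mul_rowForm (h : IsWignerType μ X r) (k j : Fin N) (hz : z.im ≠ 0)
    {v : Fin N → ℝ} (hv : ∀ a, 0 ≤ v a) :
    Integrable (fun ω => (schurDenom v (_root_.zeroOut k (X ω)) z)⁻¹ * rowForm k (X ω) z j) μ ∧
      ∫ ω, (schurDenom v (_root_.zeroOut k (X ω)) z)⁻¹ * rowForm k (X ω) z j ∂μ = 0 := by
  have hy := h.isCenteredFamily_offRow k
  have i : Integrable
      (fun ω => (schurDenom v (_root_.zeroOut k (X ω)) z)⁻¹ * rowForm k (X ω) z j) μ :=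
    ((h.second_rowForm k j hz le_rfl).1.integrable one_le_two).bdd_mul
      ((h.zeroOut k).measurable_schurDenom v z).inv.aestronglyMeasurable
      (ae_of_all _ fun ω =>
        norm_inv_schurDenom_le hv (isHermitian_zeroOut (h.isHermitian ω) k) hz)
  refine ⟨i, ?_⟩
  have e := h.integral_eq_of_row k (F := fun x M => (schurDenom v M z)⁻¹
    * linForm (fun b => resolventMatrix M z b j) (Function.update x k 0))
    ((((_root_.measurable_schurDenom v z).comp measurable_snd).inv).mul
      (Measurable.linForm (fun b => measurable_resolvent_snd z b j)
        fun b => measurable_update_fst k b)) i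
  refine e.trans ?_
  have e0 : ∀ ω, ∫ ω', (schurDenom v (_root_.zeroOut k (X ω)) z)⁻¹
      * linForm (fun b => resolventMatrix (_root_.zeroOut k (X ω)) z b j)
        (Function.update (X ω' k) k 0) ∂μ = 0 := fun ω => by
    rw [integral_const_mul]
    have := hy.integral_linForm (fun b => resolventMatrix (_root_.zeroOut k (X ω)) z b j)
    unfold offRow at this
    rw [this, mul_zero]
  simp_rw [e0, integral_zero]

/-- One substitution of `resolvent_diag_eq` into `R_kj = R_kk Y`. The leading term has mean zero; in
the rest two bounded factors give `t ^ 2`, and Cauchy–Schwarz for the Schur error and the row form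
gives `6 c r t * r t`. -/
lemma norm_integral_resolvent_offdiag_le (h : IsWignerType μ X r) {k j : Fin N} (hj : j ≠ k)
    (hz : z.im ≠ 0) (ht : |z.im|⁻¹ ≤ t) (ht1 : 1 ≤ t) {c : ℝ} (hc1 : 1 ≤ c)
    (hN : N * r ^ 2 ≤ c ^ 2) :
    ‖∫ ω, resolventMatrix (X ω) z k j ∂μ‖ ≤ 6 * c * r ^ 2 * t ^ 4 := by
  have hr := h.nonneg
  set v := rowVariance μ X k with hv
  have hv0 : ∀ a, 0 ≤ v a := rowVariance_nonneg k
  obtain ⟨i0, e0⟩ := h.integral_inv_schurDenom_mul_rowForm k j hz hv0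
  obtain ⟨lE, bE⟩ := h.second_schurError k hz ht ht1 hc1 hN
  obtain ⟨lY, bY⟩ := h.second_rowForm k j hz ht
  set D := fun ω => (schurDenom v (_root_.zeroOut k (X ω)) z)⁻¹ with hD
  have bD : ∀ ω, ‖D ω‖ ≤ t := fun ω =>
    (norm_inv_schurDenom_le hv0 (isHermitian_zeroOut (h.isHermitian ω) k) hz).trans ht
  have e : ∀ ω, resolventMatrix (X ω) z k j = D ω * rowForm k (X ω) z j
      + D ω * (schurError v k (X ω) z * resolventMatrix (X ω) z k k) * rowForm k (X ω) z j := by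
    intro ω
    rw [resolvent_row (h.isHermitian ω) hz hj]
    conv_lhs => rw [resolvent_diag_eq hv0 (h.isHermitian ω) hz k]
    ring
  have iR := (h.memLp_resolvent k j hz (p := 1)).integrable le_rfl
  have i1 : Integrable (fun ω => D ω * (schurError v k (X ω) z * resolventMatrix (X ω) z k k)
      * rowForm k (X ω) z j) μ := by
    refine (iR.sub i0).congr (ae_of_all _ fun ω => ?_)
    simp only [Pi.sub_apply]
    rw [e ω]; ring
  have iEY := lE.norm.integrable_mul lY.norm
  calc ‖∫ ω, resolventMatrix (X ω) z k j ∂μ‖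
      = ‖∫ ω, D ω * (schurError v k (X ω) z * resolventMatrix (X ω) z k k)
        * rowForm k (X ω) z j ∂μ‖ := by
        rw [integral_congr_ae (ae_of_all _ e), integral_add i0 i1, e0, zero_add]
    _ ≤ ∫ ω, t ^ 2 * (‖schurError v k (X ω) z‖ * ‖rowForm k (X ω) z j‖) ∂μ := by
        refine norm_integral_le_of_norm_le (iEY.const_mul _) (ae_of_all _ fun ω => ?_)
        rw [norm_mul, norm_mul, norm_mul]
        have h1 := bD ω
        have h2 := (norm_resolvent_le (h.isHermitian ω) hz k k).trans ht
        calc _ ≤ t * (‖schurError v k (X ω) z‖ * t) * ‖rowForm k (X ω) z j‖ := by gcongr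
          _ = _ := by ring
    _ = t ^ 2 * ∫ ω, ‖schurError v k (X ω) z‖ * ‖rowForm k (X ω) z j‖ ∂μ := integral_const_mul _ _
    _ ≤ t ^ 2 * (6 * c * r * t * (r * t)) := by
        gcongr
        exact integral_mul_le_of_sq_le lE.norm lY.norm (by positivity) (by positivity) bE bY
    _ = _ := by ring

/-- The variance of a weighted trace of the resolvent. -/
lemma variance_weighted_trace_le (h : IsWignerType μ X r) (hz : z.im ≠ 0)
    (ht : |z.im|⁻¹ ≤ t) {c : ℝ} (hN : N * r ^ 2 ≤ c ^ 2) {v : Fin N → ℝ}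
    (hv0 : ∀ a, 0 ≤ v a) (hv : ∀ a, v a ≤ r ^ 2) :
    ∫ ω, ‖∑ a, (v a : ℂ) * resolventMatrix (X ω) z a a
      - ∫ ω', ∑ a, (v a : ℂ) * resolventMatrix (X ω') z a a ∂μ‖ ^ 2 ∂μ ≤ (c * r * t) ^ 2 := by
  have ht0 : 0 ≤ t := (inv_nonneg.mpr (abs_nonneg _)).trans ht
  have bs : ∀ (s : Finset (Fin N)) (M : Matrix (Fin N) (Fin N) ℂ), M.IsHermitian →
      ‖∑ a ∈ s, (v a : ℂ) * resolventMatrix M z a a‖ ≤ ∑ a : Fin N, v a * t := by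
    intro s M hM
    refine (norm_sum_le_of_le s fun a _ => ?_).trans
      (Finset.sum_le_sum_of_subset_of_nonneg (Finset.subset_univ s)
        fun a _ _ => mul_nonneg (hv0 a) ht0)
    rw [norm_mul, Complex.norm_real, Real.norm_of_nonneg (hv0 a)]
    exact mul_le_mul_of_nonneg_left ((norm_resolvent_le hM hz a a).trans ht) (hv0 a)
  have ms : ∀ s : Finset (Fin N), Measurable fun m : Fin N → Fin N → ℂ =>
      ∑ a ∈ s, (v a : ℂ) * resolventMatrix (Matrix.of m) z a a := fun s =>
    Finset.measurable_sum _ fun a _ => (_root_.measurable_resolvent z a a).const_mul _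
  refine (h.efron_stein (φ := fun M => ∑ a, (v a : ℂ) * resolventMatrix M z a a)
    (γ := fun k M => ∑ a ∈ Finset.univ.erase k, (v a : ℂ) * resolventMatrix M z a a)
    (ms _) (bs _) (fun k => ms _) (fun k => bs _)).trans ?_
  -- Removing row and column `k` moves the weighted trace by at most `r ^ 2 t`, deterministically.
  calc _ ≤ ∑ _k : Fin N, (r ^ 2 * t) ^ 2 := by
        refine Finset.sum_le_sum fun k _ => ?_
        have : ∀ ω, ‖∑ a, (v a : ℂ) * resolventMatrix (X ω) z a a
            - ∑ a ∈ Finset.univ.erase k, (v a : ℂ)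
              * resolventMatrix (_root_.zeroOut k (X ω)) z a a‖ ^ 2 ≤ (r ^ 2 * t) ^ 2 := fun ω => by
          gcongr
          exact (norm_weighted_trace_sub_le (h.isHermitian ω) hz k v hv0 hv).trans (by gcongr)
        refine (integral_mono_of_nonneg (ae_of_all _ fun _ => by positivity)
          (integrable_const _) (ae_of_all _ this)).trans ?_
        simp
    _ = N * r ^ 2 * (r ^ 2 * t ^ 2) := by simp; ring
    _ ≤ c ^ 2 * (r ^ 2 * t ^ 2) := by gcongr
    _ = _ := by ring

lemma variance_resolvent_le (h : IsWignerType μ X r) (i j : Fin N) (hz : z.im ≠ 0)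
    (ht : |z.im|⁻¹ ≤ t) (ht1 : 1 ≤ t) {c : ℝ} (hc1 : 1 ≤ c) (hN : N * r ^ 2 ≤ c ^ 2) :
    ∫ ω, ‖resolventMatrix (X ω) z i j - ∫ ω', resolventMatrix (X ω') z i j ∂μ‖ ^ 2 ∂μ
      ≤ (11 * c * r * t ^ 3) ^ 2 := by
  have hr := h.nonneg
  have ht0 : 0 ≤ t := zero_le_one.trans ht1
  have hv0 : ∀ k a, 0 ≤ rowVariance μ X k a := fun k a => rowVariance_nonneg k a
  -- For `k ≠ i, j` the comparison is `R^(k)_ij`. If exactly one index equals `k`, that entry is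
  -- zero. If both do, it would be `z⁻¹`, which need not be near `R_kk`, so the inverse Schur
  -- denominator is used instead.
  set γ : Fin N → Matrix (Fin N) (Fin N) ℂ → ℂ := fun k M =>
    if k = i then (if k = j then (schurDenom (rowVariance μ X k) M z)⁻¹ else 0)
    else (if k = j then 0 else resolventMatrix M z i j) with hγ
  have es := h.efron_stein (φ := fun M => resolventMatrix M z i j) (γ := γ) (C := t)
    (_root_.measurable_resolvent z i j) (fun M hM => (norm_resolvent_le hM hz i j).trans ht)
    (fun k => by
      simp only [hγ]
      split_ifs
      exacts [(_root_.measurable_schurDenom _ z).inv, measurable_const, measurable_const,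
        _root_.measurable_resolvent z i j])
    (fun k M hM => by
      simp only [hγ]
      split_ifs
      exacts [(norm_inv_schurDenom_le (hv0 k) hM hz).trans ht, by simpa, by simpa,
        (norm_resolvent_le hM hz i j).trans ht])
  refine es.trans ?_
  have bR : ∀ ω a b, ‖resolventMatrix (X ω) z a b‖ ≤ t := fun ω a b =>
    (norm_resolvent_le (h.isHermitian ω) hz a b).trans ht
  have hcr : 0 ≤ 36 * c ^ 2 * r ^ 2 * t ^ 6 := by positivity
  have small : t ^ 2 * (r * t) ^ 2 ≤ 36 * c ^ 2 * r ^ 2 * t ^ 6 := by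
    have h1 : t ^ 4 ≤ t ^ 6 := pow_le_pow_right₀ ht1 (by norm_num)
    have h2 : 1 ≤ c ^ 2 := one_le_pow₀ hc1
    calc t ^ 2 * (r * t) ^ 2 = 1 * r ^ 2 * t ^ 4 := by ring
      _ ≤ (36 * c ^ 2) * r ^ 2 * t ^ 6 := by gcongr; linarith
      _ = _ := by ring
  have bk : ∀ k, ∫ ω, ‖resolventMatrix (X ω) z i j - γ k (_root_.zeroOut k (X ω))‖ ^ 2 ∂μ
      ≤ 34 * r ^ 4 * t ^ 6 + ((if k = i then 36 * c ^ 2 * r ^ 2 * t ^ 6 else 0)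
        + (if k = j then 36 * c ^ 2 * r ^ 2 * t ^ 6 else 0)) := by
    intro k
    have nn : 0 ≤ 34 * r ^ 4 * t ^ 6 := by positivity
    by_cases hki : k = i
    · subst hki
      by_cases hkj : k = j
      · subst hkj
        simp only [hγ, if_true]
        obtain ⟨lE, bE⟩ := h.second_schurError k hz ht ht1 hc1 hN
        have pw : ∀ ω, ‖resolventMatrix (X ω) z k k
            - (schurDenom (rowVariance μ X k) (_root_.zeroOut k (X ω)) z)⁻¹‖ ^ 2
            ≤ t ^ 4 * ‖schurError (rowVariance μ X k) k (X ω) z‖ ^ 2 := by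
          intro ω
          have e := resolvent_diag_eq (hv0 k) (h.isHermitian ω) hz k
          have e' := sub_eq_of_eq_add' e
          rw [e', norm_mul, norm_mul]
          have h1 := (norm_inv_schurDenom_le (hv0 k)
            (isHermitian_zeroOut (h.isHermitian ω) k) hz).trans ht
          have h2 := bR ω k k
          calc _ ≤ (t * (‖schurError (rowVariance μ X k) k (X ω) z‖ * t)) ^ 2 := by gcongr
            _ = _ := by ring
        have h1 := integral_mono_of_nonneg (ae_of_all _ fun _ => by positivity)
          (lE.norm.integrable_sq.const_mul (t ^ 4)) (ae_of_all μ pw)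
        refine h1.trans ?_
        rw [integral_const_mul]
        have : t ^ 4 * ∫ ω, ‖schurError (rowVariance μ X k) k (X ω) z‖ ^ 2 ∂μ
          ≤ t ^ 4 * (6 * c * r * t) ^ 2 := by gcongr
        refine this.trans ?_
        nlinarith
      · simp only [hγ, if_true, if_neg hkj, sub_zero, add_zero]
        obtain ⟨lY, bY⟩ := h.second_rowForm k j hz ht
        have pw : ∀ ω, ‖resolventMatrix (X ω) z k j‖ ^ 2
            ≤ t ^ 2 * ‖rowForm k (X ω) z j‖ ^ 2 := by
          intro ω
          rw [resolvent_row (h.isHermitian ω) hz (Ne.symm hkj), norm_mul, mul_pow]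
          have := bR ω k k
          gcongr
        have h1 := integral_mono_of_nonneg (ae_of_all _ fun _ => by positivity)
          (lY.norm.integrable_sq.const_mul (t ^ 2)) (ae_of_all μ pw)
        refine h1.trans ?_
        rw [integral_const_mul]
        have : t ^ 2 * ∫ ω, ‖rowForm k (X ω) z j‖ ^ 2 ∂μ ≤ t ^ 2 * (r * t) ^ 2 := by gcongr
        linarith
    · by_cases hkj : k = j
      · subst hkj
        simp only [hγ, if_true, if_neg hki, sub_zero, zero_add]
        obtain ⟨lY, bY⟩ := h.second_colForm k i hz ht
        have pw : ∀ ω, ‖resolventMatrix (X ω) z i k‖ ^ 2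
            ≤ t ^ 2 * ‖colForm k (X ω) z i‖ ^ 2 := by
          intro ω
          rw [resolvent_col (h.isHermitian ω) hz (Ne.symm hki), norm_mul, mul_pow]
          have := bR ω k k
          gcongr
        have h1 := integral_mono_of_nonneg (ae_of_all _ fun _ => by positivity)
          (lY.const_mul (t ^ 2)) (ae_of_all μ pw)
        refine h1.trans ?_
        rw [integral_const_mul]
        have : t ^ 2 * ∫ ω, ‖colForm k (X ω) z i‖ ^ 2 ∂μ ≤ t ^ 2 * (r * t) ^ 2 := by gcongr
        linarith
      · simp only [hγ, if_neg hki, if_neg hkj, add_zero]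
        obtain ⟨i1, b1⟩ := h.fourth_rowForm k j hz ht
        obtain ⟨i2, b2⟩ := h.fourth_colForm k i hz ht
        have pw : ∀ ω, ‖resolventMatrix (X ω) z i j
            - resolventMatrix (_root_.zeroOut k (X ω)) z i j‖ ^ 2
            ≤ t ^ 2 * ((‖rowForm k (X ω) z j‖ ^ 4 + ‖colForm k (X ω) z i‖ ^ 4) / 2) := by
          intro ω
          rw [resolvent_sub_minor (h.isHermitian ω) hz (Ne.symm hkj),
            resolvent_col (h.isHermitian ω) hz (Ne.symm hki), norm_mul, norm_mul]
          have := bR ω k k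
          calc _ ≤ (t * ‖colForm k (X ω) z i‖ * ‖rowForm k (X ω) z j‖) ^ 2 := by gcongr
            _ = t ^ 2 * (‖colForm k (X ω) z i‖ ^ 2 * ‖rowForm k (X ω) z j‖ ^ 2) := by ring
            _ ≤ _ := by
              gcongr
              nlinarith [sq_nonneg (‖colForm k (X ω) z i‖ ^ 2 - ‖rowForm k (X ω) z j‖ ^ 2)]
        have h1 := integral_mono_of_nonneg (ae_of_all _ fun _ => by positivity)
          (((i1.add i2).div_const 2).const_mul (t ^ 2)) (ae_of_all μ pw)
        refine h1.trans ?_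
        rw [integral_const_mul]
        have e : ∫ ω, ((fun ω => ‖rowForm k (X ω) z j‖ ^ 4) + fun ω => ‖colForm k (X ω) z i‖ ^ 4) ω
            / 2 ∂μ = (∫ ω, ‖rowForm k (X ω) z j‖ ^ 4 ∂μ + ∫ ω, ‖colForm k (X ω) z i‖ ^ 4 ∂μ) / 2 := by
          rw [integral_div, integral_add' i1 i2]
        rw [e]
        calc _ ≤ t ^ 2 * ((34 * r ^ 4 * t ^ 4 + 34 * r ^ 4 * t ^ 4) / 2) := by gcongr
          _ = _ := by ring
  calc _ ≤ ∑ k : Fin N, (34 * r ^ 4 * t ^ 6 + ((if k = i then 36 * c ^ 2 * r ^ 2 * t ^ 6 else 0)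
        + (if k = j then 36 * c ^ 2 * r ^ 2 * t ^ 6 else 0))) := Finset.sum_le_sum fun k _ => bk k
    _ = 34 * (N * r ^ 2) * r ^ 2 * t ^ 6 + 72 * c ^ 2 * r ^ 2 * t ^ 6 := by
        rw [Finset.sum_add_distrib, Finset.sum_add_distrib]
        simp only [Finset.sum_const, Finset.card_univ, Fintype.card_fin, nsmul_eq_mul,
          Finset.sum_ite_eq', Finset.mem_univ, if_true]
        ring
    _ ≤ 34 * c ^ 2 * r ^ 2 * t ^ 6 + 72 * c ^ 2 * r ^ 2 * t ^ 6 := by gcongr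
    -- `34 + 72 = 106 ≤ 121`; a perfect square is convenient for later uses of Cauchy–Schwarz.
    _ ≤ (11 * c * r * t ^ 3) ^ 2 := by nlinarith

end Bounds

end IsWignerType

/-! ### Off-diagonal entries under a fifth moment bound -/

namespace IsWignerType

variable {N : ℕ} {Ω : Type u} [MeasurableSpace Ω] {μ : Measure Ω} [IsProbabilityMeasure μ]
  {X : Ω → Matrix (Fin N) (Fin N) ℂ} {r : ℝ} {z : ℂ} {t : ℝ}

/-- The third moments `𝔼 y |y|^2` of the entries of row `k`, with `0` on the diagonal. -/
def rowThird (μ : Measure Ω) (X : Ω → Matrix (Fin N) (Fin N) ℂ) (k a : Fin N) : ℂ :=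
  ∫ ω, offRow k (X ω) a * (‖offRow k (X ω) a‖ ^ 2 : ℝ) ∂μ

lemma norm_rowThird_le (h : IsWignerType μ X r) (k a : Fin N) : ‖rowThird μ X k a‖ ≤ r ^ 3 := by
  refine (norm_integral_le_integral_norm _).trans
    (le_trans (le_of_eq ?_) ((h.isCenteredFamily_offRow k).third a))
  refine integral_congr_ae (ae_of_all _ fun ω => ?_)
  simp only [norm_mul, Complex.norm_real]
  rw [Real.norm_of_nonneg (sq_nonneg ‖offRow k (X ω) a‖)]
  ring

/-- Given the minor, `X_kk` is centred and independent of the rest of its row. -/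
lemma integral_mul_diag_mul_rowForm (h : IsWignerType μ X r) (k j : Fin N) (hz : z.im ≠ 0)
    {A : Matrix (Fin N) (Fin N) ℂ → ℂ} {C : ℝ}
    (mA : Measurable fun m : Fin N → Fin N → ℂ => A (Matrix.of m))
    (bA : ∀ M : Matrix (Fin N) (Fin N) ℂ, M.IsHermitian → ‖A M‖ ≤ C) :
    Integrable (fun ω => A (_root_.zeroOut k (X ω)) * (X ω k k * rowForm k (X ω) z j)) μ ∧
      ∫ ω, A (_root_.zeroOut k (X ω)) * (X ω k k * rowForm k (X ω) z j) ∂μ = 0 := by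
  have hy := h.isCenteredFamily_offRow k
  have i : Integrable
      (fun ω => A (_root_.zeroOut k (X ω)) * (X ω k k * rowForm k (X ω) z j)) μ :=
    ((h.diag_memLp k).integrable_mul (h.second_rowForm k j hz le_rfl).1).bdd_mul
      ((h.zeroOut k).measurable_comp mA).aestronglyMeasurable
      (ae_of_all _ fun ω => bA _ (isHermitian_zeroOut (h.isHermitian ω) k))
  refine ⟨i, ?_⟩
  have e := h.integral_eq_of_row k (F := fun x M => A M
    * (x k * linForm (fun b => resolventMatrix M z b j) (Function.update x k 0)))
    ((mA.comp measurable_snd).mul (((measurable_pi_apply k).comp measurable_fst).mul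
      (Measurable.linForm (fun b => measurable_resolvent_snd z b j)
        fun b => measurable_update_fst k b))) i
  refine e.trans ?_
  have e0 : ∀ ω, ∫ ω', A (_root_.zeroOut k (X ω)) * (X ω' k k
      * linForm (fun b => resolventMatrix (_root_.zeroOut k (X ω)) z b j)
        (Function.update (X ω' k) k 0)) ∂μ = 0 := fun ω => by
    rw [integral_const_mul]
    have hi := (h.indepFun_diag_offRow k).comp measurable_id
      (measurable_linForm fun b => resolventMatrix (_root_.zeroOut k (X ω)) z b j)
    have := hi.integral_fun_mul_eq_mul_integral (h.measurable_entry k k).aestronglyMeasurable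
      ((measurable_linForm _).comp hy.measurable).aestronglyMeasurable
    have h0 : ∫ ω', (id ∘ fun ω => X ω k k) ω' ∂μ = 0 := h.mean k k
    rw [h0, zero_mul] at this
    exact mul_eq_zero_of_right _ this
  simp_rw [e0, integral_zero]

lemma integral_mul_centeredQuad_mul_rowForm (h : IsWignerType μ X r) (k j : Fin N)
    (hz : z.im ≠ 0) {A : Matrix (Fin N) (Fin N) ℂ → ℂ} {C : ℝ}
    (mA : Measurable fun m : Fin N → Fin N → ℂ => A (Matrix.of m))
    (bA : ∀ M : Matrix (Fin N) (Fin N) ℂ, M.IsHermitian → ‖A M‖ ≤ C)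
    (lH : MemLp (fun ω => centeredQuad (rowVariance μ X k)
      (resolventMatrix (_root_.zeroOut k (X ω)) z) (offRow k (X ω))) 2 μ) :
    Integrable (fun ω => A (_root_.zeroOut k (X ω)) * (centeredQuad (rowVariance μ X k)
        (resolventMatrix (_root_.zeroOut k (X ω)) z) (offRow k (X ω))
          * rowForm k (X ω) z j)) μ ∧
      ∫ ω, A (_root_.zeroOut k (X ω)) * (centeredQuad (rowVariance μ X k)
        (resolventMatrix (_root_.zeroOut k (X ω)) z) (offRow k (X ω)) * rowForm k (X ω) z j) ∂μ
      = ∫ ω, ∑ a, rowThird μ X k a * (A (_root_.zeroOut k (X ω))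
        * resolventMatrix (_root_.zeroOut k (X ω)) z a a
        * resolventMatrix (_root_.zeroOut k (X ω)) z a j) ∂μ := by
  have hy := h.isCenteredFamily_offRow k
  have i : Integrable (fun ω => A (_root_.zeroOut k (X ω)) * (centeredQuad (rowVariance μ X k)
        (resolventMatrix (_root_.zeroOut k (X ω)) z) (offRow k (X ω))
          * rowForm k (X ω) z j)) μ :=
    (lH.integrable_mul (h.second_rowForm k j hz le_rfl).1).bdd_mul
      ((h.zeroOut k).measurable_comp mA).aestronglyMeasurable
      (ae_of_all _ fun ω => bA _ (isHermitian_zeroOut (h.isHermitian ω) k))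
  refine ⟨i, ?_⟩
  have e := h.integral_eq_of_row k (F := fun x M => A M
    * (centeredQuad (rowVariance μ X k) (resolventMatrix M z) (Function.update x k 0)
      * linForm (fun b => resolventMatrix M z b j) (Function.update x k 0)))
    ((mA.comp measurable_snd).mul ((Measurable.centeredQuad _
      (fun a b => measurable_resolvent_snd z a b) fun b => measurable_update_fst k b).mul
      (Measurable.linForm (fun b => measurable_resolvent_snd z b j)
        fun b => measurable_update_fst k b))) i
  refine e.trans (integral_congr_ae (ae_of_all _ fun ω => ?_))
  have := hy.integral_centeredQuad_mul_linForm (resolventMatrix (_root_.zeroOut k (X ω)) z)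
    fun b => resolventMatrix (_root_.zeroOut k (X ω)) z b j
  refine (integral_const_mul _ _).trans ?_
  refine (congrArg _ this).trans ?_
  rw [Finset.mul_sum]
  exact Finset.sum_congr rfl fun a _ => by unfold rowThird; ring

/-- The covariance bound for the product of a bounded diagonal quantity and an off-diagonal
resolvent entry. -/
lemma norm_integral_inv_schurDenom_sq_mul_le (h : IsWignerType μ X r) {a j : Fin N} (haj : a ≠ j)
    (hz : z.im ≠ 0) (ht : |z.im|⁻¹ ≤ t) (ht1 : 1 ≤ t) {c : ℝ} (hc1 : 1 ≤ c)
    (hN : N * r ^ 2 ≤ c ^ 2) {v : Fin N → ℝ} (hv0 : ∀ a, 0 ≤ v a) (hv : ∀ a, v a ≤ r ^ 2) :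
    ‖∫ ω, (schurDenom v (X ω) z)⁻¹ ^ 2 * resolventMatrix (X ω) z a a
      * resolventMatrix (X ω) z a j ∂μ‖ ≤ 149 * c ^ 2 * r ^ 2 * t ^ 8 := by
  have hr := h.nonneg
  have ht0 : 0 ≤ t := zero_le_one.trans ht1
  have iR : ∀ b b', Integrable (fun ω => resolventMatrix (X ω) z b b') μ := fun b b' =>
    (h.memLp_resolvent b b' hz (p := 1)).integrable le_rfl
  have bR : ∀ ω b b', ‖resolventMatrix (X ω) z b b'‖ ≤ t := fun ω b b' =>
    (norm_resolvent_le (h.isHermitian ω) hz b b').trans ht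
  set S := fun ω => ∑ a, (v a : ℂ) * resolventMatrix (X ω) z a a with hS
  set m := ∫ ω, S ω ∂μ with hm
  set p := ∫ ω, resolventMatrix (X ω) z a a ∂μ with hp
  set q := ∫ ω, resolventMatrix (X ω) z a j ∂μ with hq
  set D := fun ω => (schurDenom v (X ω) z)⁻¹ with hD
  have lS : MemLp S 2 μ := memLp_finsetSum _ fun b _ => (h.memLp_resolvent b b hz).const_mul _
  have bD : ∀ ω, ‖D ω‖ ≤ t := fun ω => (norm_inv_schurDenom_le hv0 (h.isHermitian ω) hz).trans ht
  have hmim : z.im * m.im ≤ 0 := by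
    have e : m.im = ∫ ω, (S ω).im ∂μ :=
      (integral_im (𝕜 := ℂ) (lS.integrable one_le_two)).symm
    rw [e, ← integral_const_mul]
    exact integral_nonpos fun ω => im_mul_sum_nonpos hv0 fun b =>
      im_mul_im_resolvent_diag_nonpos (h.isHermitian ω) hz b
  have bD0 : ‖(z - m)⁻¹‖ ≤ t := (norm_inv_sub_le hz hmim).trans ht
  have bp : ‖p‖ ≤ t := by
    simpa using norm_integral_le_of_norm_le_const (μ := μ) (ae_of_all _ fun ω => bR ω a a)
  have bq : ‖q‖ ≤ 6 * c * r ^ 2 * t ^ 4 :=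
    h.norm_integral_resolvent_offdiag_le (Ne.symm haj) hz ht ht1 hc1 hN
  have mD : Measurable D := (h.measurable_schurDenom v z).inv
  have lf : MemLp (fun ω => D ω ^ 2 * resolventMatrix (X ω) z a a) 2 μ :=
    MemLp.of_bound ((mD.pow_const 2).mul (h.measurable_resolvent z a a)).aestronglyMeasurable
      (t ^ 2 * t) (ae_of_all _ fun ω => by
        rw [norm_mul, norm_pow]
        have := bD ω
        have := bR ω a a
        gcongr)
  have la := h.memLp_resolvent a a hz (p := 2)
  have lj := h.memLp_resolvent a j hz (p := 2)
  have lja : MemLp (fun ω => resolventMatrix (X ω) z a j - q) 2 μ := lj.sub (memLp_const q)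
  have laa : MemLp (fun ω => resolventMatrix (X ω) z a a - p) 2 μ := la.sub (memLp_const p)
  have lSm : MemLp (fun ω => S ω - m) 2 μ := lS.sub (memLp_const m)
  -- `f0` is the deterministic counterpart of `f = D ^ 2 R_aa`. In `f R_aj = (f - f0)(R_aj - q) + f0
  -- (R_aj - q) + f q` the first term is a product of two fluctuations, the second has mean zero,
  -- and the third is small because `q` is an off-diagonal mean.
  set f0 := (z - m)⁻¹ ^ 2 * p with hf0
  have pw : ∀ ω, ‖D ω ^ 2 * resolventMatrix (X ω) z a a - f0‖
      ≤ t ^ 2 * ‖resolventMatrix (X ω) z a a - p‖ + 2 * t ^ 4 * ‖S ω - m‖ := by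
    intro ω
    have n1 : schurDenom v (X ω) z ≠ 0 := schurDenom_ne_zero hv0 (h.isHermitian ω) hz
    have n2 : z - m ≠ 0 := sub_ne_zero_of_im hz hmim
    have e1 : D ω - (z - m)⁻¹ = D ω * (z - m)⁻¹ * (S ω - m) := by
      have : S ω = z - schurDenom v (X ω) z := by simp only [hS, schurDenom]; ring
      simp only [hD]
      rw [this]
      field_simp
      ring
    have e2 : D ω ^ 2 * resolventMatrix (X ω) z a a - f0
        = D ω ^ 2 * (resolventMatrix (X ω) z a a - p)
          + (D ω + (z - m)⁻¹) * (D ω * (z - m)⁻¹ * (S ω - m)) * p := by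
      rw [← e1, hf0]; ring
    rw [e2]
    have b1 := bD ω
    have b2 : ‖D ω + (z - m)⁻¹‖ ≤ 2 * t := (norm_add_le _ _).trans (by linarith)
    refine (norm_add_le _ _).trans (add_le_add ?_ ?_)
    · rw [norm_mul, norm_pow]; gcongr
    · rw [norm_mul, norm_mul, norm_mul, norm_mul]
      calc _ ≤ (2 * t) * (t * t * ‖S ω - m‖) * t := by gcongr
        _ = _ := by ring
  have vA := h.variance_resolvent_le a a hz ht ht1 hc1 hN
  have vJ := h.variance_resolvent_le a j hz ht ht1 hc1 hN
  have vS := h.variance_weighted_trace_le hz ht hN hv0 hv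
  have i1 : Integrable (fun ω => (D ω ^ 2 * resolventMatrix (X ω) z a a - f0)
      * (resolventMatrix (X ω) z a j - q)) μ := (lf.sub (memLp_const f0)).integrable_mul lja
  have i2 : Integrable (fun ω => f0 * (resolventMatrix (X ω) z a j - q)) μ :=
    (lja.integrable one_le_two).const_mul _
  have i3 : Integrable (fun ω => D ω ^ 2 * resolventMatrix (X ω) z a a * q) μ :=
    (lf.integrable one_le_two).mul_const _
  have e : ∀ ω, D ω ^ 2 * resolventMatrix (X ω) z a a * resolventMatrix (X ω) z a j
      = ((D ω ^ 2 * resolventMatrix (X ω) z a a - f0) * (resolventMatrix (X ω) z a j - q)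
        + f0 * (resolventMatrix (X ω) z a j - q))
        + D ω ^ 2 * resolventMatrix (X ω) z a a * q := fun ω => by ring
  have z2 : ∫ ω, f0 * (resolventMatrix (X ω) z a j - q) ∂μ = 0 := by
    rw [integral_const_mul, integral_sub (iR a j) (integrable_const q)]
    simp [hq]
  have b3 : ‖∫ ω, D ω ^ 2 * resolventMatrix (X ω) z a a * q ∂μ‖ ≤ 6 * c ^ 2 * r ^ 2 * t ^ 8 := by
    have : ∀ ω, ‖D ω ^ 2 * resolventMatrix (X ω) z a a * q‖ ≤ t ^ 3 * (6 * c * r ^ 2 * t ^ 4) := by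
      intro ω
      rw [norm_mul, norm_mul, norm_pow]
      have := bD ω
      have := bR ω a a
      calc _ ≤ t ^ 2 * t * (6 * c * r ^ 2 * t ^ 4) := by gcongr
        _ = _ := by ring
    have h1 := norm_integral_le_of_norm_le_const (μ := μ) (ae_of_all _ this)
    simp only [probReal_univ, mul_one] at h1
    refine h1.trans ?_
    have hc2 : c ≤ c ^ 2 := le_self_pow₀ hc1 two_ne_zero
    have ht7 : t ^ 7 ≤ t ^ 8 := pow_le_pow_right₀ ht1 (by norm_num)
    calc _ = 6 * c * r ^ 2 * t ^ 7 := by ring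
      _ ≤ _ := by gcongr
  -- The constant is `143 = 11 * 11 + 2 * 11`, from the variance of `R_aa` and that of the weighted
  -- trace, each paired with `R_aj`.
  have b1 : ‖∫ ω, (D ω ^ 2 * resolventMatrix (X ω) z a a - f0)
      * (resolventMatrix (X ω) z a j - q) ∂μ‖ ≤ 143 * c ^ 2 * r ^ 2 * t ^ 8 := by
    have j1 : Integrable (fun ω => t ^ 2 * (‖resolventMatrix (X ω) z a a - p‖
      * ‖resolventMatrix (X ω) z a j - q‖)) μ := (laa.norm.integrable_mul lja.norm).const_mul _
    have j2 : Integrable (fun ω => 2 * t ^ 4 * (‖S ω - m‖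
      * ‖resolventMatrix (X ω) z a j - q‖)) μ := (lSm.norm.integrable_mul lja.norm).const_mul _
    refine (norm_integral_le_of_norm_le (j1.fun_add j2) (ae_of_all _ fun ω => ?_)).trans ?_
    · rw [norm_mul]
      calc _ ≤ (t ^ 2 * ‖resolventMatrix (X ω) z a a - p‖ + 2 * t ^ 4 * ‖S ω - m‖)
            * ‖resolventMatrix (X ω) z a j - q‖ := by gcongr; exact pw ω
        _ = _ := by ring
    · rw [integral_add j1 j2, integral_const_mul, integral_const_mul]
      have c1 := integral_mul_le_of_sq_le laa.norm lja.norm (by positivity) (by positivity) vA vJ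
      have c2 := integral_mul_le_of_sq_le lSm.norm lja.norm
        (by have : 0 ≤ c := by linarith
            positivity) (by positivity) vS vJ
      calc _ ≤ t ^ 2 * ((11 * c * r * t ^ 3) * (11 * c * r * t ^ 3))
            + 2 * t ^ 4 * ((c * r * t) * (11 * c * r * t ^ 3)) := by gcongr
        _ = _ := by ring
  rw [integral_congr_ae (μ := μ) (ae_of_all _ e), integral_add (i1.fun_add i2) i3, integral_add i1 i2, z2, add_zero]
  refine (norm_add_le _ _).trans ?_
  linarith

/-- The diagonal entry is independent of the row form, so two of its moments suffice; the quadratic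
part is `integral_sq_centeredQuad_mul_linForm_le`. The constant is `210 = 2 * 1 + 2 * 104`. -/
lemma integral_sq_schurError_mul_rowForm_le (h : IsWignerType μ X r) (k j : Fin N)
    (hz : z.im ≠ 0) (ht : |z.im|⁻¹ ≤ t) (ht1 : 1 ≤ t) {c : ℝ} (hc1 : 1 ≤ c)
    (hN : N * r ^ 2 ≤ c ^ 2)
    (h5 : ∀ a, a ≠ k → Integrable (fun ω => ‖X ω k a‖ ^ 5) μ ∧ ∫ ω, ‖X ω k a‖ ^ 5 ∂μ ≤ r ^ 5) :
    Integrable (fun ω => ‖schurError (rowVariance μ X k) k (X ω) z‖ ^ 2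
        * ‖rowForm k (X ω) z j‖) μ ∧
      ∫ ω, ‖schurError (rowVariance μ X k) k (X ω) z‖ ^ 2 * ‖rowForm k (X ω) z j‖ ∂μ
        ≤ 210 * c ^ 2 * r ^ 3 * t ^ 3 := by
  have hr := h.nonneg
  have ht0 : 0 ≤ t := zero_le_one.trans ht1
  set v := rowVariance μ X k with hv
  have hy := h.isCenteredFamily_offRow k
  have o5 : ∀ a, Integrable (fun ω => ‖offRow k (X ω) a‖ ^ 5) μ ∧
      ∫ ω, ‖offRow k (X ω) a‖ ^ 5 ∂μ ≤ r ^ 5 := by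
    intro a
    by_cases ha : a = k
    · subst ha
      simp only [offRow, Function.update_self, norm_zero]
      exact ⟨by simp, by simpa using pow_nonneg hr 5⟩
    · simp only [offRow, Function.update_of_ne ha]
      exact h5 a ha
  have inner : ∀ ω, Integrable (fun ω' => ‖X ω' k k + centeredQuad v
        (resolventMatrix (_root_.zeroOut k (X ω)) z) (offRow k (X ω'))‖ ^ 2
        * ‖linForm (fun b => resolventMatrix (_root_.zeroOut k (X ω)) z b j)
          (offRow k (X ω'))‖) μ ∧
      ∫ ω', ‖X ω' k k + centeredQuad v
        (resolventMatrix (_root_.zeroOut k (X ω)) z) (offRow k (X ω'))‖ ^ 2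
        * ‖linForm (fun b => resolventMatrix (_root_.zeroOut k (X ω)) z b j)
          (offRow k (X ω'))‖ ∂μ ≤ 210 * c ^ 2 * r ^ 3 * t ^ 3 := by
    intro ω
    have hM := isHermitian_zeroOut (h.isHermitian ω) k
    set M := resolventMatrix (_root_.zeroOut k (X ω)) z with hMdef
    set Y := fun ω' => linForm (fun b => M b j) (offRow k (X ω')) with hY
    set H := fun ω' => centeredQuad v M (offRow k (X ω')) with hH
    have hle : |z.im|⁻¹ ^ 2 ≤ t ^ 2 := by gcongr
    obtain ⟨i1, b1⟩ := hy.integral_sq_centeredQuad_mul_linForm_le (fun a => (o5 a).1)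
      (fun a => (o5 a).2) ht0 (fun a => (sum_row_sq_le hM hz a).trans hle)
      (fun a => (sum_col_sq_le hM hz a).trans hle) ((sum_col_sq_le hM hz j).trans hle)
    rw [Fintype.card_fin] at b1
    have hi := (h.indepFun_diag_offRow k).comp (measurable_norm.pow_const 2)
      (measurable_linForm fun b => M b j).norm
    have lY : MemLp Y 2 μ := (hy.memLp_linForm _).mono_exponent (p := 2) (by norm_num)
    have m1 : Measurable fun ω' => ‖X ω' k k‖ ^ 2 := (h.measurable_entry k k).norm.pow_const 2
    have mY : Measurable Y := (measurable_linForm _).comp hy.measurable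
    have i2 : Integrable (fun ω' => ‖X ω' k k‖ ^ 2 * ‖Y ω'‖) μ :=
      hi.integrable_mul (h.diag_memLp k).norm.integrable_sq (lY.norm.integrable one_le_two)
    have b2 : ∫ ω', ‖X ω' k k‖ ^ 2 * ‖Y ω'‖ ∂μ ≤ r ^ 2 * (r * t) := by
      have := hi.integral_fun_mul_eq_mul_integral m1.aestronglyMeasurable
        mY.norm.aestronglyMeasurable
      refine (le_of_eq this).trans ?_
      refine mul_le_mul (h.diag_second k) ?_ (integral_nonneg fun _ => norm_nonneg _)
        (by positivity)
      refine integral_le_of_sq_le lY.norm (by positivity) ((hy.integral_sq_linForm_le _).trans ?_)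
      rw [mul_pow]
      exact mul_le_mul_of_nonneg_left ((sum_col_sq_le hM hz j).trans hle) (sq_nonneg r)
    have j2 := (i2.const_mul 2).fun_add (i1.const_mul 2)
    have pw : ∀ ω', ‖X ω' k k + H ω'‖ ^ 2 * ‖Y ω'‖
        ≤ 2 * (‖X ω' k k‖ ^ 2 * ‖Y ω'‖) + 2 * (‖H ω'‖ ^ 2 * ‖Y ω'‖) := by
      intro ω'
      have h1 : ‖X ω' k k + H ω'‖ ^ 2 ≤ 2 * ‖X ω' k k‖ ^ 2 + 2 * ‖H ω'‖ ^ 2 := by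
        have := norm_add_le (X ω' k k) (H ω')
        calc _ ≤ (‖X ω' k k‖ + ‖H ω'‖) ^ 2 := by gcongr
          _ ≤ _ := by nlinarith [sq_nonneg (‖X ω' k k‖ - ‖H ω'‖)]
      calc _ ≤ (2 * ‖X ω' k k‖ ^ 2 + 2 * ‖H ω'‖ ^ 2) * ‖Y ω'‖ := by gcongr
        _ = _ := by ring
    have mH : Measurable H := (measurable_centeredQuad _ _).comp hy.measurable
    refine ⟨Integrable.mono' j2 ((((h.measurable_entry k k).add mH).norm.pow_const 2).mul
      mY.norm).aestronglyMeasurable (ae_of_all _ fun ω' => ?_), ?_⟩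
    · rw [Real.norm_of_nonneg (by positivity)]
      exact pw ω'
    · refine (integral_mono_of_nonneg (ae_of_all _ fun _ => by positivity) j2
        (ae_of_all _ pw)).trans ?_
      rw [integral_add (i2.const_mul 2) (i1.const_mul 2), integral_const_mul, integral_const_mul]
      have hc2 : 1 ≤ c ^ 2 := one_le_pow₀ hc1
      have ht3 : t ≤ t ^ 3 := le_self_pow₀ ht1 (by norm_num)
      calc _ ≤ 2 * (r ^ 2 * (r * t)) + 2 * (104 * N * r ^ 5 * t ^ 3) := by gcongr
        _ = 2 * 1 * r ^ 3 * t + 208 * (N * r ^ 2) * r ^ 3 * t ^ 3 := by ring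
        _ ≤ 2 * c ^ 2 * r ^ 3 * t ^ 3 + 208 * c ^ 2 * r ^ 3 * t ^ 3 := by gcongr
        _ = _ := by ring
  exact h.integral_le_of_row k
    (F := fun x M => ‖x k + centeredQuad v (resolventMatrix M z) (Function.update x k 0)‖ ^ 2
      * ‖linForm (fun b => resolventMatrix M z b j) (Function.update x k 0)‖)
    (((((measurable_pi_apply k).comp measurable_fst).add
      (Measurable.centeredQuad v (fun a b => measurable_resolvent_snd z a b)
        fun b => measurable_update_fst k b)).norm.pow_const 2).mul
      (Measurable.linForm (fun b => measurable_resolvent_snd z b j)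
        fun b => measurable_update_fst k b).norm)
    (fun _ _ => by positivity) (by positivity) (fun ω => (inner ω).1) fun ω => (inner ω).2

lemma memLp_centeredQuad_row (h : IsWignerType μ X r) (k : Fin N)
    (hz : z.im ≠ 0) (ht : |z.im|⁻¹ ≤ t) (ht1 : 1 ≤ t) {c : ℝ} (hc1 : 1 ≤ c)
    (hN : N * r ^ 2 ≤ c ^ 2) :
    MemLp (fun ω => centeredQuad (rowVariance μ X k)
      (resolventMatrix (_root_.zeroOut k (X ω)) z) (offRow k (X ω))) 2 μ := by
  refine ((h.second_schurError k hz ht ht1 hc1 hN).1.sub (h.diag_memLp k)).ae_eq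
    (ae_of_all _ fun ω => ?_)
  simp [schurError]

/-- Under a fifth moment bound the mean of an off-diagonal resolvent entry is of third order. -/
lemma norm_integral_resolvent_offdiag_le_of_fifth (h : IsWignerType μ X r) {k j : Fin N}
    (hj : j ≠ k) (hz : z.im ≠ 0) (ht : |z.im|⁻¹ ≤ t) (ht1 : 1 ≤ t) {c : ℝ} (hc1 : 1 ≤ c)
    (hN : N * r ^ 2 ≤ c ^ 2)
    (h5 : ∀ a, a ≠ k → Integrable (fun ω => ‖X ω k a‖ ^ 5) μ ∧ ∫ ω, ‖X ω k a‖ ^ 5 ∂μ ≤ r ^ 5) :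
    ‖∫ ω, resolventMatrix (X ω) z k j ∂μ‖ ≤ 360 * c ^ 4 * r ^ 3 * t ^ 8 := by
  have hr := h.nonneg
  have ht0 : 0 ≤ t := zero_le_one.trans ht1
  set v := rowVariance μ X k with hv
  have hv0 : ∀ a, 0 ≤ v a := rowVariance_nonneg k
  set A : Matrix (Fin N) (Fin N) ℂ → ℂ := fun M => (schurDenom v M z)⁻¹ ^ 2 with hA
  have mA : Measurable fun m : Fin N → Fin N → ℂ => A (Matrix.of m) :=
    (_root_.measurable_schurDenom v z).inv.pow_const 2
  have bA : ∀ M : Matrix (Fin N) (Fin N) ℂ, M.IsHermitian → ‖A M‖ ≤ t ^ 2 := fun M hM => by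
    rw [hA, norm_pow]
    have := (norm_inv_schurDenom_le hv0 hM hz).trans ht
    gcongr
  obtain ⟨i0, e0⟩ := h.integral_inv_schurDenom_mul_rowForm k j hz hv0
  obtain ⟨i1, e1⟩ := h.integral_mul_diag_mul_rowForm k j hz mA bA
  obtain ⟨i2, e2⟩ := h.integral_mul_centeredQuad_mul_rowForm k j hz mA bA
    (h.memLp_centeredQuad_row k hz ht ht1 hc1 hN)
  obtain ⟨i3, b3⟩ := h.integral_sq_schurError_mul_rowForm_le k j hz ht ht1 hc1 hN h5
  set D := fun ω => (schurDenom v (_root_.zeroOut k (X ω)) z)⁻¹ with hD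
  set H := fun ω => centeredQuad v (resolventMatrix (_root_.zeroOut k (X ω)) z) (offRow k (X ω))
    with hH
  set Y := fun ω => rowForm k (X ω) z j with hY
  set E := fun ω => schurError v k (X ω) z with hE
  have bR : ∀ ω a b, ‖resolventMatrix (X ω) z a b‖ ≤ t := fun ω a b =>
    (norm_resolvent_le (h.isHermitian ω) hz a b).trans ht
  -- `resolvent_diag_eq` is used twice, and the first-order error is split into its diagonal entry
  -- and its quadratic form. The first two terms have mean zero.
  have e : ∀ ω, resolventMatrix (X ω) z k j = ((D ω * Y ω + A (_root_.zeroOut k (X ω))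
      * (X ω k k * Y ω)) + A (_root_.zeroOut k (X ω)) * (H ω * Y ω))
      + A (_root_.zeroOut k (X ω)) * (E ω ^ 2 * resolventMatrix (X ω) z k k * Y ω) := by
    intro ω
    rw [resolvent_row (h.isHermitian ω) hz hj]
    have h1 := resolvent_diag_eq hv0 (h.isHermitian ω) hz k
    have h2 : resolventMatrix (X ω) z k k = D ω + D ω * (E ω * (D ω + D ω * (E ω
        * resolventMatrix (X ω) z k k))) := by
      conv_lhs => rw [h1]
      conv_lhs => rw [h1]
    have h3 : A (_root_.zeroOut k (X ω)) = D ω ^ 2 := rfl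
    have h4 : E ω = X ω k k + H ω := rfl
    conv_lhs => rw [h2]
    rw [h3]
    simp only [hY]
    linear_combination (D ω ^ 2 * rowForm k (X ω) z j) * h4
  have iR := (h.memLp_resolvent k j hz (p := 1)).integrable le_rfl
  have i012 := (i0.fun_add i1).fun_add i2
  have i4 : Integrable (fun ω => A (_root_.zeroOut k (X ω))
      * (E ω ^ 2 * resolventMatrix (X ω) z k k * Y ω)) μ := by
    refine (iR.sub i012).congr (ae_of_all _ fun ω => ?_)
    simp only [Pi.sub_apply]
    rw [e ω]
    exact add_sub_cancel_left _ _
  have b4 : ‖∫ ω, A (_root_.zeroOut k (X ω)) * (E ω ^ 2 * resolventMatrix (X ω) z k k * Y ω) ∂μ‖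
      ≤ 210 * c ^ 4 * r ^ 3 * t ^ 8 := by
    refine (norm_integral_le_of_norm_le (i3.const_mul (t ^ 3)) (ae_of_all _ fun ω => ?_)).trans ?_
    · rw [norm_mul, norm_mul, norm_mul, norm_pow (E ω)]
      have h1 := bA _ (isHermitian_zeroOut (h.isHermitian ω) k)
      have h2 := bR ω k k
      calc _ ≤ t ^ 2 * (‖E ω‖ ^ 2 * t * ‖Y ω‖) :=
            mul_le_mul h1 (by gcongr) (by positivity) (by positivity)
        _ = _ := by ring
    · rw [integral_const_mul]
      have hc2 : c ^ 2 ≤ c ^ 4 := pow_le_pow_right₀ hc1 (by norm_num)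
      have ht6 : t ^ 6 ≤ t ^ 8 := pow_le_pow_right₀ ht1 (by norm_num)
      calc _ ≤ t ^ 3 * (210 * c ^ 2 * r ^ 3 * t ^ 3) := by gcongr
        _ = 210 * c ^ 2 * r ^ 3 * t ^ 6 := by ring
        _ ≤ _ := by gcongr
  have iT : ∀ a, Integrable (fun ω => A (_root_.zeroOut k (X ω))
        * resolventMatrix (_root_.zeroOut k (X ω)) z a a
        * resolventMatrix (_root_.zeroOut k (X ω)) z a j) μ := fun a => by
    refine integrable_of_norm_le (((((h.zeroOut k).measurable_comp mA).mul
      ((h.zeroOut k).measurable_resolvent z a a)).mul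
      ((h.zeroOut k).measurable_resolvent z a j)).aestronglyMeasurable) (C := t ^ 2 * t * t)
      fun ω => ?_
    have hM := isHermitian_zeroOut (h.isHermitian ω) k
    rw [norm_mul, norm_mul]
    have h1 := bA _ hM
    have h2 := (norm_resolvent_le hM hz a a).trans ht
    have h3 := (norm_resolvent_le hM hz a j).trans ht
    exact mul_le_mul (mul_le_mul h1 h2 (norm_nonneg _) (by positivity)) h3 (norm_nonneg _)
      (by positivity)
  -- For `a ≠ j` the covariance bound is applied to the zeroed matrix and gains `r ^ 2`, which pays
  -- for the sum over `a`. The single index `a = j` needs no gain.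
  have bT : ∀ a, ‖∫ ω, rowThird μ X k a * (A (_root_.zeroOut k (X ω))
        * resolventMatrix (_root_.zeroOut k (X ω)) z a a
        * resolventMatrix (_root_.zeroOut k (X ω)) z a j) ∂μ‖
      ≤ r ^ 3 * (149 * c ^ 2 * r ^ 2 * t ^ 8) + if a = j then r ^ 3 * t ^ 4 else 0 := by
    intro a
    rw [integral_const_mul, norm_mul]
    have h3 := h.norm_rowThird_le k a
    by_cases haj : a = j
    · subst haj
      rw [if_pos rfl]
      have : ∀ ω, ‖A (_root_.zeroOut k (X ω)) * resolventMatrix (_root_.zeroOut k (X ω)) z a a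
        * resolventMatrix (_root_.zeroOut k (X ω)) z a a‖ ≤ t ^ 4 := fun ω => by
        have hM := isHermitian_zeroOut (h.isHermitian ω) k
        rw [norm_mul, norm_mul]
        have h1 := bA _ hM
        have h2 := (norm_resolvent_le hM hz a a).trans ht
        calc _ ≤ t ^ 2 * t * t := mul_le_mul (mul_le_mul h1 h2 (norm_nonneg _) (by positivity)) h2
              (norm_nonneg _) (by positivity)
          _ = _ := by ring
      have h1 := norm_integral_le_of_norm_le_const (μ := μ) (ae_of_all _ this)
      simp only [probReal_univ, mul_one] at h1
      have h2 : 0 ≤ r ^ 3 * (149 * c ^ 2 * r ^ 2 * t ^ 8) := by positivity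
      have := mul_le_mul h3 h1 (norm_nonneg _) (by positivity)
      linarith
    · rw [if_neg haj, add_zero]
      have h1 := (h.zeroOut k).norm_integral_inv_schurDenom_sq_mul_le haj hz ht ht1 hc1 hN hv0
        (h.rowVariance_le k)
      exact mul_le_mul h3 h1 (norm_nonneg _) (by positivity)
  have b2 : ‖∫ ω, A (_root_.zeroOut k (X ω)) * (H ω * Y ω) ∂μ‖ ≤ 150 * c ^ 4 * r ^ 3 * t ^ 8 := by
    rw [e2, integral_finsetSum _ fun a _ => (iT a).const_mul _]
    refine (norm_sum_le_of_le _ fun a _ => bT a).trans ?_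
    rw [Finset.sum_add_distrib, Finset.sum_const, Finset.card_univ, Fintype.card_fin, nsmul_eq_mul,
      Finset.sum_ite_eq' Finset.univ j, if_pos (Finset.mem_univ j)]
    have ht4 : t ^ 4 ≤ t ^ 8 := pow_le_pow_right₀ ht1 (by norm_num)
    have hc4 : 1 ≤ c ^ 4 := one_le_pow₀ hc1
    calc _ = 149 * c ^ 2 * r ^ 3 * t ^ 8 * (N * r ^ 2) + 1 * (r ^ 3 * t ^ 4) := by ring
      _ ≤ 149 * c ^ 2 * r ^ 3 * t ^ 8 * c ^ 2 + c ^ 4 * (r ^ 3 * t ^ 8) := by gcongr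
      _ = _ := by ring
  rw [integral_congr_ae (μ := μ) (ae_of_all _ e), integral_add i012 i4, integral_add (i0.fun_add i1) i2, integral_add i0 i1, e0, e1,
    zero_add, zero_add]
  refine (norm_add_le _ _).trans ?_
  linarith

end IsWignerType

/-! ### The Stieltjes transform of the semicircle law -/

section Semicircle

lemma semicircleStieltjes_eq_intervalIntegral {σ : ℝ} (hσ : 0 < σ) (z : ℂ) :
    semicircleStieltjes σ z = ∫ x in (-2 * σ)..(2 * σ),
      (1 / (2 * Real.pi * σ ^ 2) * Real.sqrt (4 * σ ^ 2 - x ^ 2)) • (z - (x : ℂ))⁻¹ := by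
  have hm : Measurable (semicircleDensity σ) := by
    unfold semicircleDensity
    refine Measurable.indicator ?_ measurableSet_Icc
    fun_prop
  have hnn : ∀ x, 0 ≤ semicircleDensity σ x := fun x =>
    Set.indicator_nonneg (fun t _ => by positivity) x
  unfold semicircleStieltjes semicircleLaw
  rw [integral_withDensity_eq_integral_toReal_smul hm.ennreal_ofReal
    (ae_of_all _ fun _ => ENNReal.ofReal_lt_top)]
  rw [intervalIntegral.integral_of_le (by linarith), ← integral_Icc_eq_integral_Ioc,
    ← integral_indicator measurableSet_Icc]
  refine integral_congr_ae (ae_of_all _ fun x => ?_)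
  simp only [ENNReal.toReal_ofReal (hnn x)]
  unfold semicircleDensity
  by_cases hx : x ∈ Set.Icc (-2 * σ) (2 * σ)
  · rw [Set.indicator_of_mem hx, Set.indicator_of_mem hx]
  · rw [Set.indicator_of_notMem hx, Set.indicator_of_notMem hx, zero_smul]

lemma sub_ofReal_ne_zero {z : ℂ} (hz : z.im ≠ 0) (x : ℝ) : z - (x : ℂ) ≠ 0 := fun h =>
  hz (by simpa using congrArg Complex.im h)

/-- The substitution `x = 2 σ cos θ` turns the square root into `2 σ sin θ`. -/
lemma semicircleStieltjes_eq_integral_sin {σ : ℝ} (hσ : 0 < σ) {z : ℂ} (hz : z.im ≠ 0) :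
    semicircleStieltjes σ z = ∫ θ in (0 : ℝ)..Real.pi,
      ((2 / Real.pi * Real.sin θ ^ 2 : ℝ) : ℂ) * (z - ((2 * σ * Real.cos θ : ℝ) : ℂ))⁻¹ := by
  rw [semicircleStieltjes_eq_intervalIntegral hσ]
  set G : ℝ → ℂ := fun x =>
    (1 / (2 * Real.pi * σ ^ 2) * Real.sqrt (4 * σ ^ 2 - x ^ 2)) • (z - (x : ℂ))⁻¹ with hG
  have cG : Continuous G := by
    have h1 : Continuous fun x : ℝ =>
        1 / (2 * Real.pi * σ ^ 2) * Real.sqrt (4 * σ ^ 2 - x ^ 2) := by fun_prop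
    have h2 : Continuous fun x : ℝ => z - (x : ℂ) := by fun_prop
    exact h1.smul (h2.inv₀ (sub_ofReal_ne_zero hz))
  have hd : ∀ θ : ℝ, HasDerivAt (fun θ => 2 * σ * Real.cos θ) (2 * σ * -Real.sin θ) θ := fun θ =>
    (Real.hasDerivAt_cos θ).const_mul _
  have h := intervalIntegral.integral_deriv_smul_comp (a := 0) (b := Real.pi) (g := G)
    (fun θ _ => hd θ) (by fun_prop) cG
  have e1 : 2 * σ * Real.cos 0 = 2 * σ := by simp
  have e2 : 2 * σ * Real.cos Real.pi = -2 * σ := by simp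
  rw [e1, e2, intervalIntegral.integral_symm (-2 * σ)] at h
  rw [← neg_eq_iff_eq_neg.mpr h, ← intervalIntegral.integral_neg]
  refine intervalIntegral.integral_congr fun θ hθ => ?_
  rw [Set.uIcc_of_le Real.pi_pos.le] at hθ
  have hs := Real.sin_nonneg_of_mem_Icc hθ
  have e3 : Real.sqrt (4 * σ ^ 2 - (2 * σ * Real.cos θ) ^ 2) = 2 * σ * Real.sin θ := by
    have : 4 * σ ^ 2 - (2 * σ * Real.cos θ) ^ 2 = (2 * σ * Real.sin θ) ^ 2 := by
      linear_combination (4 * σ ^ 2) * (Real.sin_sq_add_cos_sq θ).symm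
    rw [this, Real.sqrt_sq (by positivity)]
  simp only [hG, Function.comp, e3]
  rw [Complex.real_smul, Complex.real_smul, ← mul_assoc, ← neg_mul, ← Complex.ofReal_mul,
    ← Complex.ofReal_neg]
  congr 2
  have := Real.pi_ne_zero
  field_simp

/-- The orthogonality relations of the sines needed for the generating function. -/
lemma integral_sin_mul_sin_succ (n : ℕ) :
    ∫ θ in (0 : ℝ)..Real.pi, Real.sin θ * Real.sin ((n + 1 : ℕ) * θ)
      = if n = 0 then Real.pi / 2 else 0 := by
  have hc : ∀ k : ℕ, k ≠ 0 → ∫ θ in (0 : ℝ)..Real.pi, Real.cos (k * θ) = 0 := fun k hk => by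
    rw [intervalIntegral.integral_comp_mul_left _ (Nat.cast_ne_zero.mpr hk), integral_cos]
    simp [Real.sin_nat_mul_pi]
  have e : ∀ θ : ℝ, Real.sin θ * Real.sin ((n + 1 : ℕ) * θ)
      = (Real.cos (n * θ) - Real.cos ((n + 2 : ℕ) * θ)) / 2 := fun θ => by
    have h1 : (n : ℝ) * θ = (n + 1 : ℕ) * θ - θ := by push_cast; ring
    have h2 : ((n + 2 : ℕ) : ℝ) * θ = (n + 1 : ℕ) * θ + θ := by push_cast; ring
    rw [h1, h2, Real.cos_sub, Real.cos_add]
    ring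
  simp_rw [e]
  rw [intervalIntegral.integral_div, intervalIntegral.integral_sub
    (by apply Continuous.intervalIntegrable; fun_prop)
    (by apply Continuous.intervalIntegrable; fun_prop), hc (n + 2) (by omega)]
  split_ifs with h
  · subst h; simp
  · rw [hc n h]; simp

/-- The truncated generating function of the sines, with explicit remainder; it telescopes by `sin
((m + 2) θ) + sin (m θ) = 2 cos θ sin ((m + 1) θ)`. -/
lemma sum_pow_mul_sin (w : ℂ) (θ : ℝ) (m : ℕ) :
    (∑ n ∈ Finset.range m, w ^ n * Complex.sin ((n + 1 : ℕ) * θ))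
        * (1 - 2 * w * Complex.cos θ + w ^ 2)
      = Complex.sin θ - w ^ m * Complex.sin ((m + 1 : ℕ) * θ)
        + w ^ (m + 1) * Complex.sin ((m : ℕ) * θ) := by
  induction m with
  | zero => simp
  | succ m ih =>
    rw [Finset.sum_range_succ, add_mul, ih]
    have h1 : Complex.sin ((m + 1 + 1 : ℕ) * θ) + Complex.sin ((m : ℕ) * θ)
        = 2 * Complex.cos θ * Complex.sin ((m + 1 : ℕ) * θ) := by
      have e1 : ((m + 1 + 1 : ℕ) : ℂ) * θ = (m + 1 : ℕ) * θ + θ := by push_cast; ring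
      have e2 : ((m : ℕ) : ℂ) * θ = (m + 1 : ℕ) * θ - θ := by push_cast; ring
      rw [e1, e2, Complex.sin_add, Complex.sin_sub]
      ring
    linear_combination w ^ (m + 1) * h1

lemma sq_le_norm_generating {w : ℂ} (hw : ‖w‖ < 1) (θ : ℝ) :
    (1 - ‖w‖) ^ 2 ≤ ‖1 - 2 * w * Complex.cos θ + w ^ 2‖ := by
  have e : 1 - 2 * w * Complex.cos θ + w ^ 2
      = (1 - w * Complex.exp (θ * Complex.I)) * (1 - w * Complex.exp (-θ * Complex.I)) := by
    rw [Complex.cos]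
    have : Complex.exp (θ * Complex.I) * Complex.exp (-θ * Complex.I) = 1 := by
      rw [← Complex.exp_add]; simp
    linear_combination (-w ^ 2) * this
  have hb : ∀ s : ℝ, 1 - ‖w‖ ≤ ‖1 - w * Complex.exp (s * Complex.I)‖ := fun s => by
    have := norm_sub_norm_le 1 (w * Complex.exp (s * Complex.I))
    rwa [norm_mul, Complex.norm_exp_ofReal_mul_I, mul_one, norm_one] at this
  rw [e, norm_mul, sq]
  have h2 := hb (-θ)
  push_cast at h2
  exact mul_le_mul (hb θ) h2 (by linarith) (norm_nonneg _)

/-- For `‖w‖ < 1` the quotient `sin θ / (1 - 2 w cos θ + w²)` equals `∑ w ^ n sin ((n + 1) θ)`.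
Against `sin θ` only the term `n = 0` survives, with value `π / 2`. -/
lemma integral_sin_sq_div_generating {w : ℂ} (hw : ‖w‖ < 1) :
    ∫ θ in (0 : ℝ)..Real.pi, Complex.sin θ ^ 2 * (1 - 2 * w * Complex.cos θ + w ^ 2)⁻¹
      = (Real.pi / 2 : ℂ) := by
  set Q : ℝ → ℂ := fun θ => 1 - 2 * w * Complex.cos θ + w ^ 2 with hQ
  have hpos : 0 < (1 - ‖w‖) ^ 2 := by have : 0 < 1 - ‖w‖ := by linarith
                                      positivity
  have hQ0 : ∀ θ, Q θ ≠ 0 := fun θ =>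
    norm_pos_iff.mp (hpos.trans_le (sq_le_norm_generating hw θ))
  have cQ : Continuous fun θ => (Q θ)⁻¹ := Continuous.inv₀ (by fun_prop) hQ0
  set J := ∫ θ in (0 : ℝ)..Real.pi, Complex.sin θ ^ 2 * (Q θ)⁻¹ with hJ
  set ρ : ℕ → ℝ → ℂ := fun m θ => Complex.sin θ * (w ^ m * Complex.sin ((m + 1 : ℕ) * θ)
    - w ^ (m + 1) * Complex.sin ((m : ℕ) * θ)) * (Q θ)⁻¹ with hρ
  have cρ : ∀ m, Continuous (ρ m) := fun m => by fun_prop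
  have hsum : ∀ m, J = ∑ n ∈ Finset.range m, w ^ n * (if n = 0 then (Real.pi / 2 : ℂ) else 0)
      + ∫ θ in (0 : ℝ)..Real.pi, ρ m θ := by
    intro m
    have e : ∀ θ : ℝ, Complex.sin θ ^ 2 * (Q θ)⁻¹
        = ∑ n ∈ Finset.range m, w ^ n
          * ((Real.sin θ * Real.sin ((n + 1 : ℕ) * θ) : ℝ) : ℂ) + ρ m θ := by
      intro θ
      have h1 := sum_pow_mul_sin w θ m
      have h2 : ∑ n ∈ Finset.range m, w ^ n * ((Real.sin θ * Real.sin ((n + 1 : ℕ) * θ) : ℝ) : ℂ)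
          = Complex.sin θ * ∑ n ∈ Finset.range m, w ^ n * Complex.sin ((n + 1 : ℕ) * θ) := by
        rw [Finset.mul_sum]
        refine Finset.sum_congr rfl fun n _ => ?_
        push_cast
        ring
      rw [h2]
      change _ * Q θ = _ at h1
      simp only [hρ]
      have h3 : Q θ * (Q θ)⁻¹ = 1 := mul_inv_cancel₀ (hQ0 θ)
      linear_combination (-(Complex.sin θ * (Q θ)⁻¹)) * h1
        + (Complex.sin θ * ∑ n ∈ Finset.range m, w ^ n * Complex.sin ((n + 1 : ℕ) * θ)) * h3
    rw [hJ]
    simp_rw [e]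
    rw [intervalIntegral.integral_add _ ((cρ m).intervalIntegrable _ _),
      intervalIntegral.integral_finsetSum]
    · congr 1
      refine Finset.sum_congr rfl fun n _ => ?_
      rw [intervalIntegral.integral_const_mul, intervalIntegral.integral_ofReal,
        integral_sin_mul_sin_succ]
      split_ifs <;> simp
    · intro n _
      apply Continuous.intervalIntegrable
      fun_prop
    · apply Continuous.intervalIntegrable
      fun_prop
  have hb : ∀ m, 1 ≤ m → ‖J - Real.pi / 2‖ ≤ 2 / (1 - ‖w‖) ^ 2 * Real.pi * ‖w‖ ^ m := by
    intro m hm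
    have h1 := hsum m
    rw [Finset.sum_eq_single_of_mem 0 (Finset.mem_range.mpr hm)
      (fun n _ hn => by rw [if_neg hn, mul_zero])] at h1
    simp only [pow_zero, one_mul, if_true] at h1
    rw [h1, add_sub_cancel_left]
    have hs : ∀ x : ℝ, ‖Complex.sin x‖ ≤ 1 := fun x => by
      rw [← Complex.ofReal_sin, Complex.norm_real]; exact Real.abs_sin_le_one x
    have pw : ∀ θ ∈ Set.uIoc 0 Real.pi, ‖ρ m θ‖ ≤ 2 * ‖w‖ ^ m / (1 - ‖w‖) ^ 2 := by
      intro θ _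
      have s1 := hs θ
      have s2 : ‖Complex.sin ((m + 1 : ℕ) * θ)‖ ≤ 1 := by exact_mod_cast hs ((m + 1 : ℕ) * θ)
      have s3 : ‖Complex.sin ((m : ℕ) * θ)‖ ≤ 1 := by exact_mod_cast hs ((m : ℕ) * θ)
      have hi : ‖(Q θ)⁻¹‖ ≤ ((1 - ‖w‖) ^ 2)⁻¹ := by
        rw [norm_inv]; exact inv_anti₀ hpos (sq_le_norm_generating hw θ)
      have hd : ‖w ^ m * Complex.sin ((m + 1 : ℕ) * θ)
          - w ^ (m + 1) * Complex.sin ((m : ℕ) * θ)‖ ≤ 2 * ‖w‖ ^ m := by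
        refine (norm_sub_le _ _).trans ?_
        rw [norm_mul, norm_mul, norm_pow, norm_pow]
        have : ‖w‖ ^ (m + 1) ≤ ‖w‖ ^ m := pow_le_pow_of_le_one (norm_nonneg _) hw.le (by omega)
        calc _ ≤ ‖w‖ ^ m * 1 + ‖w‖ ^ m * 1 := by gcongr
          _ = _ := by ring
      simp only [hρ]
      rw [norm_mul, norm_mul, div_eq_mul_inv]
      calc _ ≤ 1 * (2 * ‖w‖ ^ m) * ((1 - ‖w‖) ^ 2)⁻¹ := by gcongr
        _ = _ := by ring
    have := intervalIntegral.norm_integral_le_of_norm_le_const pw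
    rw [sub_zero, abs_of_pos Real.pi_pos] at this
    refine this.trans (le_of_eq ?_)
    ring
  have lim : Filter.Tendsto (fun m : ℕ => 2 / (1 - ‖w‖) ^ 2 * Real.pi * ‖w‖ ^ m) Filter.atTop
      (nhds 0) := by
    simpa using (tendsto_pow_atTop_nhds_zero_of_lt_one (norm_nonneg w) hw).const_mul
      (2 / (1 - ‖w‖) ^ 2 * Real.pi)
  have : ‖J - Real.pi / 2‖ ≤ 0 :=
    ge_of_tendsto lim ((Filter.eventually_ge_atTop 1).mono hb)
  exact sub_eq_zero.mp (norm_le_zero_iff.mp this)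

/-- The equation `u + u⁻¹ = z / σ` has two roots with product `1`. If a root lay on the unit circle,
`z` would be real; hence one root lies inside. -/
lemma exists_joukowsky {σ : ℝ} (hσ : 0 < σ) {z : ℂ} (hz : z.im ≠ 0) :
    ∃ w : ℂ, w ≠ 0 ∧ ‖w‖ < 1 ∧ z = σ * (w + w⁻¹) := by
  have hσ' : (σ : ℂ) ≠ 0 := Complex.ofReal_ne_zero.mpr hσ.ne'
  obtain ⟨s, hs⟩ := IsAlgClosed.exists_pow_nat_eq ((z / σ) ^ 2 - 4) (n := 2) (by norm_num)
  have hp : (z / σ + s) / 2 * ((z / σ - s) / 2) = 1 := by linear_combination (-1 / 4 : ℂ) * hs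
  have key : ∀ u v : ℂ, u * v = 1 → u + v = z / σ → ‖u‖ ≠ 1 ∧ z = σ * (u + u⁻¹) := by
    intro u v huv hz'
    have hv : v = u⁻¹ := eq_inv_of_mul_eq_one_right huv
    have e : z = σ * (u + u⁻¹) := by rw [← hv, hz']; field_simp
    refine ⟨fun h1 => hz ?_, e⟩
    have : u⁻¹ = star u := by
      rw [Complex.inv_def, Complex.normSq_eq_norm_sq, h1]; simp
    rw [e, this]
    simp
  obtain ⟨h1, e1⟩ := key _ _ hp (by ring)
  obtain ⟨h2, e2⟩ := key _ _ ((mul_comm _ _).trans hp) (by ring)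
  have hn := congrArg (fun x => ‖x‖) hp
  simp only [norm_mul, norm_one] at hn
  rcases lt_or_gt_of_ne h1 with h | h
  · exact ⟨_, left_ne_zero_of_mul_eq_one hp, h, e1⟩
  · refine ⟨_, right_ne_zero_of_mul_eq_one hp, ?_, e2⟩
    nlinarith [norm_nonneg ((z / σ - s) / 2)]

/-- In these coordinates `z - 2 σ cos θ = (σ / w)(1 - 2 w cos θ + w²)`, which is the denominator of
the generating function. -/
lemma semicircleStieltjes_eq {σ : ℝ} (hσ : 0 < σ) {z w : ℂ} (hz : z.im ≠ 0) (hw0 : w ≠ 0)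
    (hw : ‖w‖ < 1) (e : z = σ * (w + w⁻¹)) : semicircleStieltjes σ z = w / σ := by
  have hσ' : (σ : ℂ) ≠ 0 := Complex.ofReal_ne_zero.mpr hσ.ne'
  have hpi : (Real.pi : ℂ) ≠ 0 := Complex.ofReal_ne_zero.mpr Real.pi_ne_zero
  rw [semicircleStieltjes_eq_integral_sin hσ hz]
  have h1 : ∀ θ : ℝ, ((2 / Real.pi * Real.sin θ ^ 2 : ℝ) : ℂ)
      * (z - ((2 * σ * Real.cos θ : ℝ) : ℂ))⁻¹
      = (2 * w / (Real.pi * σ)) * (Complex.sin θ ^ 2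
        * (1 - 2 * w * Complex.cos θ + w ^ 2)⁻¹) := by
    intro θ
    have : z - ((2 * σ * Real.cos θ : ℝ) : ℂ)
        = σ / w * (1 - 2 * w * Complex.cos θ + w ^ 2) := by
      rw [e]; push_cast; field_simp; ring
    rw [this, mul_inv]
    push_cast
    field_simp
  simp_rw [h1]
  rw [intervalIntegral.integral_const_mul, integral_sin_sq_div_generating hw]
  field_simp

/-- The self-consistent equation of the semicircle law and the distance of `σ |g|` from `1`. -/
lemma semicircleStieltjes_spec {σ : ℝ} (hσ : 0 < σ) {z : ℂ} (hz : z.im ≠ 0) :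
    semicircleStieltjes σ z * (z - σ ^ 2 * semicircleStieltjes σ z) = 1 ∧
      |z.im| / (2 * (‖z‖ + σ)) ≤ 1 - σ * ‖semicircleStieltjes σ z‖ := by
  obtain ⟨w, hw0, hw, e⟩ := exists_joukowsky hσ hz
  have hσ' : (σ : ℂ) ≠ 0 := Complex.ofReal_ne_zero.mpr hσ.ne'
  rw [semicircleStieltjes_eq hσ hz hw0 hw e]
  have hn : 0 < ‖w‖ := norm_pos_iff.mpr hw0
  constructor
  · rw [e]; field_simp; ring
  · rw [norm_div, Complex.norm_real, Real.norm_of_nonneg hσ.le, mul_div_cancel₀ _ hσ.ne']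
    have him : |z.im| * ‖w‖ ≤ 2 * σ * (1 - ‖w‖) := by
      have h1 : z.im = σ * (w.im * (1 - ‖w‖⁻¹ ^ 2)) := by
        rw [e]
        simp only [Complex.im_ofReal_mul, Complex.add_im, Complex.inv_im,
          Complex.normSq_eq_norm_sq]
        field_simp
        ring
      have h2 : |z.im| = σ * (|w.im| * (‖w‖⁻¹ ^ 2 - 1)) := by
        have h3 : 1 ≤ ‖w‖⁻¹ := (one_le_inv₀ hn).mpr hw.le
        have h4 : 1 - ‖w‖⁻¹ ^ 2 ≤ 0 := by nlinarith
        rw [h1, abs_mul, abs_mul, abs_of_pos hσ, abs_of_nonpos h4]; ring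
      have h5 : |w.im| ≤ ‖w‖ := Complex.abs_im_le_norm w
      have h3 : 1 ≤ ‖w‖⁻¹ := (one_le_inv₀ hn).mpr hw.le
      have h6 : 0 ≤ ‖w‖⁻¹ ^ 2 - 1 := by nlinarith
      rw [h2]
      calc _ ≤ σ * (‖w‖ * (‖w‖⁻¹ ^ 2 - 1)) * ‖w‖ := by gcongr
        _ = σ * ((1 - ‖w‖) * (1 + ‖w‖)) := by field_simp; ring
        _ ≤ σ * ((1 - ‖w‖) * 2) := by
          have : 0 ≤ 1 - ‖w‖ := by linarith
          gcongr; linarith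
        _ = _ := by ring
    -- This lower bound on `‖w‖` removes it from `him`, leaving a bound for `1 - ‖w‖` in terms of
    -- `z` alone.
    have hlow : σ ≤ ‖w‖ * (‖z‖ + σ) := by
      have h1 : (σ : ℂ) = w * z - σ * w ^ 2 := by rw [e]; field_simp; ring
      have h2 : σ = ‖w * z - σ * w ^ 2‖ := by
        rw [← h1, Complex.norm_real, Real.norm_of_nonneg hσ.le]
      have h3 : ‖w * z - σ * w ^ 2‖ ≤ ‖w‖ * ‖z‖ + σ * ‖w‖ ^ 2 := by
        refine (norm_sub_le _ _).trans (le_of_eq ?_)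
        rw [norm_mul, norm_mul, norm_pow, Complex.norm_real, Real.norm_of_nonneg hσ.le]
      nlinarith [mul_nonneg hσ.le hn.le]
    have hzσ : 0 < ‖z‖ + σ := by positivity
    rw [div_le_iff₀ (by positivity)]
    have h1 : |z.im| * σ ≤ |z.im| * (‖w‖ * (‖z‖ + σ)) := by gcongr
    have h2 : |z.im| * ‖w‖ * (‖z‖ + σ) ≤ 2 * σ * (1 - ‖w‖) * (‖z‖ + σ) := by gcongr
    have h3 : |z.im| * σ ≤ (1 - ‖w‖) * (2 * (‖z‖ + σ)) * σ := by linarith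
    exact le_of_mul_le_mul_right h3 hσ

end Semicircle

/-! ### Stability of the self-consistent equation -/

section Stability

/-- The map `m ↦ (z - σ² m)⁻¹` sends its approximate fixed points into the disc of radius `σ⁻¹`. -/
lemma mul_norm_inv_sub_le_one {σ δ : ℝ} {z m h : ℂ} (hz : z.im ≠ 0)
    (hm : z.im * m.im ≤ 0) (hh : h * (z - σ ^ 2 * m) = 1) (hmh : ‖m - h‖ ≤ δ)
    (hδ : σ ^ 2 * δ ≤ |z.im|) : σ * ‖h‖ ≤ 1 := by
  have hh0 : h ≠ 0 := left_ne_zero_of_mul_eq_one hh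
  have hn : 0 < ‖h‖ ^ 2 := by have := norm_pos_iff.mpr hh0; positivity
  have him : h.im = -(‖h‖ ^ 2 * (z.im - σ ^ 2 * m.im)) := by
    have e : h = (‖h‖ ^ 2 : ℝ) * star (z - σ ^ 2 * m) := by
      have h1 : h * star h = (‖h‖ ^ 2 : ℝ) := by
        rw [Complex.star_def, Complex.mul_conj, Complex.normSq_eq_norm_sq]
      have h2 := congrArg star hh
      rw [star_mul', star_one] at h2
      rw [← h1, mul_assoc, h2, mul_one]
    have h3 := congrArg Complex.im e
    rw [Complex.im_ofReal_mul, Complex.star_def, Complex.conj_im] at h3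
    have h4 : ((z - σ ^ 2 * m : ℂ)).im = z.im - σ ^ 2 * m.im := by
      rw [← Complex.ofReal_pow, Complex.sub_im, Complex.im_ofReal_mul]
    rw [h4] at h3
    linarith
  have hd : |m.im - h.im| ≤ δ := by
    rw [← Complex.sub_im]; exact (Complex.abs_im_le_norm _).trans hmh
  have hσ2 := sq_nonneg σ
  -- `x`, `y`, `p` stand for `|Im z|`, `|Im h|`, `|Im m|`. Since `x ≥ σ² δ` and `p ≥ y - δ`, the
  -- identity for `y` gives `y ≥ ‖h‖² σ² y`, and `y > 0` can be cancelled.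
  have main : ∀ x y p : ℝ, 0 < x → 0 ≤ p → σ ^ 2 * δ ≤ x → p ≥ y - δ →
      y = ‖h‖ ^ 2 * (x + σ ^ 2 * p) → σ * ‖h‖ ≤ 1 := by
    intro x y p hx hp hxδ hpy hy
    have hy0 : 0 < y := by rw [hy]; positivity
    have h1 : ‖h‖ ^ 2 * (σ ^ 2 * y) ≤ y := by
      conv_rhs => rw [hy]
      gcongr
      nlinarith
    have h2 : (σ * ‖h‖) ^ 2 ≤ 1 := by
      have : (σ * ‖h‖) ^ 2 * y ≤ 1 * y := by linarith
      exact le_of_mul_le_mul_right this hy0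
    exact (abs_le_one_iff_mul_self_le_one.mpr (by linarith)).trans' (le_abs_self _)
  rcases lt_or_gt_of_ne hz with hneg | hpos
  · rw [abs_of_neg hneg] at hδ
    refine main (-z.im) h.im m.im (by linarith) (by nlinarith) hδ ?_ (by rw [him]; ring)
    have := (abs_le.mp hd).1
    linarith
  · rw [abs_of_pos hpos] at hδ
    refine main z.im (-h.im) (-m.im) hpos (by nlinarith) hδ ?_ (by rw [him]; ring)
    have := (abs_le.mp hd).2
    linarith

/-- The stability constant of the semicircle equation on the disc of radius `K`. -/
def stabilityConst (σ K : ℝ) : ℝ :=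
  (3 * K + 2 * σ) + (1 + K / σ) + (4 + (K + 1) / σ ^ 2 + 1 / σ) * σ ^ 2

lemma stabilityConst_nonneg {σ K : ℝ} (hσ : 0 < σ) (hK : 0 ≤ K) : 0 ≤ stabilityConst σ K := by
  unfold stabilityConst; positivity

/-- For small `δ`, `m ↦ (z - σ² m)⁻¹` contracts towards `g` by the factor `σ ‖g‖`, whose gap from
`1` is of order `|Im z|`. For large `δ`, the ratio `δ / |Im z|` exceeds `σ⁻²` and crude bounds
suffice. Thus only one power of `|Im z|` is lost. -/
lemma norm_sub_semicircle_le {σ K δ : ℝ} (hσ : 0 < σ) {z m ρ h : ℂ} (hz : z.im ≠ 0)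
    (hzK : ‖z‖ ≤ K) (hm : z.im * m.im ≤ 0) (hh : h * (z - σ ^ 2 * m) = 1)
    (hmh : ‖m - h‖ ≤ δ) (hρh : ‖ρ - h‖ ≤ δ) (hρ : ‖ρ‖ ≤ |z.im|⁻¹) :
    ‖ρ - semicircleStieltjes σ z‖ ≤ stabilityConst σ K * (δ / |z.im|) := by
  obtain ⟨hg1, hg2⟩ := semicircleStieltjes_spec hσ hz
  set g := semicircleStieltjes σ z with hg
  have hη : 0 < |z.im| := abs_pos.mpr hz
  have hηK : |z.im| ≤ K := (Complex.abs_im_le_norm z).trans hzK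
  have hK : 0 < K := hη.trans_le hηK
  have hδ0 : 0 ≤ δ := (norm_nonneg _).trans hmh
  have hσg : σ * ‖g‖ ≤ 1 := by
    have : 0 ≤ |z.im| / (2 * (‖z‖ + σ)) := by positivity
    linarith
  have hgσ : ‖g‖ ≤ 1 / σ := by rw [le_div_iff₀ hσ]; linarith
  set q := δ / |z.im| with hq
  have hq0 : 0 ≤ q := by positivity
  have hδq : δ = q * |z.im| := by rw [hq]; field_simp
  have n1 : 0 ≤ (3 * K + 2 * σ) * q := by positivity
  have n2 : 0 ≤ (1 + K / σ) * q := by positivity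
  have n3 : 0 ≤ (4 + (K + 1) / σ ^ 2 + 1 / σ) * σ ^ 2 * q := by positivity
  -- The three summands serve the three cases: `σ² δ ≤ |Im z|`; otherwise `1 ≤ δ`; otherwise `δ <
  -- 1`.
  have es : stabilityConst σ K * q = (3 * K + 2 * σ) * q + (1 + K / σ) * q
    + (4 + (K + 1) / σ ^ 2 + 1 / σ) * σ ^ 2 * q := by unfold stabilityConst; ring
  rw [es]
  by_cases hA : σ ^ 2 * δ ≤ |z.im|
  · have hσh := mul_norm_inv_sub_le_one hz hm hh hmh hA
    have e1 : h - g = σ ^ 2 * (h * g) * (m - g) := by linear_combination g * hh - h * hg1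
    have b0 : ‖(σ ^ 2 * (h * g) : ℂ)‖ ≤ σ * ‖g‖ := by
      rw [norm_mul, norm_mul, norm_pow, Complex.norm_real, Real.norm_of_nonneg hσ.le]
      calc σ ^ 2 * (‖h‖ * ‖g‖) = (σ * ‖h‖) * (σ * ‖g‖) := by ring
        _ ≤ 1 * (σ * ‖g‖) := by gcongr
        _ = _ := one_mul _
    have b1 : ‖h - g‖ ≤ σ * ‖g‖ * ‖m - g‖ := by
      rw [e1, norm_mul]; gcongr
    have b2 : ‖m - g‖ ≤ δ + σ * ‖g‖ * ‖m - g‖ := by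
      have : m - g = (m - h) + (h - g) := by ring
      calc ‖m - g‖ ≤ ‖m - h‖ + ‖h - g‖ := by rw [this]; exact norm_add_le _ _
        _ ≤ _ := add_le_add hmh b1
    have hzσ : 0 < 2 * (‖z‖ + σ) := by positivity
    have b3 : |z.im| * ‖m - g‖ ≤ 2 * (K + σ) * δ := by
      have h1 : |z.im| / (2 * (‖z‖ + σ)) * ‖m - g‖ ≤ δ := by
        calc _ ≤ (1 - σ * ‖g‖) * ‖m - g‖ := by gcongr
          _ ≤ δ := by linarith
      rw [div_mul_eq_mul_div, div_le_iff₀ hzσ] at h1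
      calc _ ≤ δ * (2 * (‖z‖ + σ)) := h1
        _ ≤ δ * (2 * (K + σ)) := by gcongr
        _ = _ := by ring
    have b4 : ‖m - g‖ ≤ 2 * (K + σ) * q := by
      rw [hq, ← mul_div_assoc, le_div_iff₀ hη]; linarith
    have b5 : ‖h - g‖ ≤ ‖m - g‖ := b1.trans (mul_le_of_le_one_left (norm_nonneg _) hσg)
    have b6 : δ ≤ K * q := by rw [hδq, mul_comm]; gcongr
    have : ρ - g = (ρ - h) + (h - g) := by ring
    rw [this]
    refine (norm_add_le _ _).trans ?_
    linarith
  · push Not at hA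
    by_cases hδ1 : 1 ≤ δ
    · have h1 : |z.im|⁻¹ ≤ q := by
        rw [hq, ← one_div]; gcongr
      have h2 : ‖g‖ ≤ K / σ * q := by
        have : 1 ≤ K * q := by
          calc (1 : ℝ) = |z.im| * |z.im|⁻¹ := (mul_inv_cancel₀ hη.ne').symm
            _ ≤ K * q := by gcongr
        calc ‖g‖ ≤ 1 / σ := hgσ
          _ ≤ (K * q) / σ := by gcongr
          _ = _ := by ring
      refine (norm_sub_le _ _).trans ?_
      linarith
    · push Not at hδ1
      have h1 : 1 ≤ σ ^ 2 * q := by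
        rw [hq, ← mul_div_assoc, le_div_iff₀ hη]; linarith
      -- If `σ² ‖m‖` exceeds `K + 1`, then `‖h‖ ≤ 1`, and `m` is within `δ < 1` of `h`.
      have hmn : ‖m‖ ≤ 2 + (K + 1) / σ ^ 2 := by
        by_cases hc : K + 1 ≤ σ ^ 2 * ‖m‖
        · have h2 : 1 ≤ ‖z - σ ^ 2 * m‖ := by
            have := norm_sub_norm_le (σ ^ 2 * m) z
            rw [norm_mul, norm_pow, Complex.norm_real, Real.norm_of_nonneg hσ.le,
              norm_sub_rev] at this
            linarith
          have h3 : ‖h‖ ≤ 1 := by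
            have h4 := congrArg (fun x => ‖x‖) hh
            simp only [norm_mul, norm_one] at h4
            nlinarith [norm_nonneg h]
          have h5 : ‖m‖ ≤ ‖m - h‖ + ‖h‖ := by simpa using norm_add_le (m - h) h
          have : 0 ≤ (K + 1) / σ ^ 2 := by positivity
          linarith
        · push Not at hc
          have : ‖m‖ ≤ (K + 1) / σ ^ 2 := by
            rw [le_div_iff₀ (by positivity)]; linarith
          linarith
      have h2 : ‖ρ‖ ≤ 4 + (K + 1) / σ ^ 2 := by
        have : ρ = (ρ - h) - (m - h) + m := by ring
        rw [this]
        have h3 := norm_add_le ((ρ - h) - (m - h)) m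
        have h4 := norm_sub_le (ρ - h) (m - h)
        linarith
      have h3 : ‖ρ - g‖ ≤ 4 + (K + 1) / σ ^ 2 + 1 / σ := by
        refine (norm_sub_le _ _).trans ?_
        linarith
      have h4 : 4 + (K + 1) / σ ^ 2 + 1 / σ
          ≤ (4 + (K + 1) / σ ^ 2 + 1 / σ) * (σ ^ 2 * q) :=
        le_mul_of_one_le_right (by positivity) h1
      linarith

end Stability

/-! ### Diagonal entries of the resolvent -/

lemma IsCenteredFamily.integral_centeredQuad {ι Ω : Type*} [Fintype ι] [DecidableEq ι]
    [MeasurableSpace Ω] {μ : Measure Ω} [IsProbabilityMeasure μ] {y : Ω → ι → ℂ} {r : ℝ}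
    (h : IsCenteredFamily μ y r) (M : Matrix ι ι ℂ) :
    ∫ ω, centeredQuad (fun a => ∫ ω, ‖y ω a‖ ^ 2 ∂μ) M (y ω) ∂μ = 0 := by
  have key := fun a => h.chaosTerm_mul M a (K := fun _ => 1) measurable_const
    (integrable_const 1) (by
      simp only [mul_one]
      exact ((h.memLp_linForm_update _ a).star.mono_exponent (p := 1) (by norm_num)).integrable
        le_rfl)
  simp only [mul_one] at key
  simp_rw [centeredQuad_eq_sum]
  rw [integral_finsetSum _ fun a _ => (key a).1]
  exact Finset.sum_eq_zero fun a _ => (key a).2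

namespace IsWignerType

variable {N : ℕ} {Ω : Type u} [MeasurableSpace Ω] {μ : Measure Ω} [IsProbabilityMeasure μ]
  {X : Ω → Matrix (Fin N) (Fin N) ℂ} {r : ℝ} {z : ℂ} {t : ℝ}

lemma integral_schurError (h : IsWignerType μ X r) (k : Fin N) (hz : z.im ≠ 0)
    (ht : |z.im|⁻¹ ≤ t) (ht1 : 1 ≤ t) {c : ℝ} (hc1 : 1 ≤ c) (hN : N * r ^ 2 ≤ c ^ 2) :
    ∫ ω, schurError (rowVariance μ X k) k (X ω) z ∂μ = 0 := by
  have hy := h.isCenteredFamily_offRow k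
  have iH := (h.memLp_centeredQuad_row k hz ht ht1 hc1 hN).integrable one_le_two
  unfold schurError
  rw [integral_add ((h.diag_memLp k).integrable one_le_two) iH, h.mean, zero_add]
  refine (h.integral_eq_of_row k (F := fun x M => centeredQuad (rowVariance μ X k)
    (resolventMatrix M z) (Function.update x k 0)) (Measurable.centeredQuad _
      (fun a b => measurable_resolvent_snd z a b) fun b => measurable_update_fst k b) iH).trans ?_
  have e0 : ∀ ω, ∫ ω', centeredQuad (rowVariance μ X k)
      (resolventMatrix (_root_.zeroOut k (X ω)) z) (Function.update (X ω' k) k 0) ∂μ = 0 :=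
    fun ω => hy.integral_centeredQuad _
  simp_rw [e0, integral_zero]

/-- When the off-diagonal entries have the same variance `s`, the mean of a diagonal resolvent entry
is close to `(z - s ∑ 𝔼 R_aa)⁻¹`. -/
lemma norm_integral_resolvent_diag_sub_le (h : IsWignerType μ X r) (k : Fin N) (hz : z.im ≠ 0)
    (ht : |z.im|⁻¹ ≤ t) (ht1 : 1 ≤ t) {c : ℝ} (hc1 : 1 ≤ c) (hN : N * r ^ 2 ≤ c ^ 2)
    {s : ℝ} (hs0 : 0 ≤ s) (hsr : s ≤ r ^ 2) (hs : ∀ a, a ≠ k → ∫ ω, ‖X ω k a‖ ^ 2 ∂μ = s) :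
    ‖∫ ω, resolventMatrix (X ω) z k k ∂μ
      - (z - ∫ ω, ∑ a, (s : ℂ) * resolventMatrix (X ω) z a a ∂μ)⁻¹‖
      ≤ 81 * c ^ 2 * r ^ 2 * t ^ 5 := by
  have hr := h.nonneg
  have ht0 : 0 ≤ t := zero_le_one.trans ht1
  set v := rowVariance μ X k with hv
  have hv0 : ∀ a, 0 ≤ v a := rowVariance_nonneg k
  obtain ⟨lE, bE⟩ := h.second_schurError k hz ht ht1 hc1 hN
  have eE := h.integral_schurError k hz ht ht1 hc1 hN
  set E := fun ω => schurError v k (X ω) z with hE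
  set T := fun ω => ∑ a, (s : ℂ) * resolventMatrix (X ω) z a a with hT
  set θ := ∫ ω, T ω ∂μ with hθ
  set R := fun ω => resolventMatrix (X ω) z k k with hR
  -- `V` is the effect of row and column `k` on the weighted trace: bounded by `r ^ 2 t`, hence of
  -- second order although not centred.
  set V := fun ω => (z - schurDenom v (_root_.zeroOut k (X ω)) z) - T ω with hV
  have lT : MemLp T 2 μ := memLp_finsetSum _ fun b _ => (h.memLp_resolvent b b hz).const_mul _
  have mV : Measurable V := ((measurable_const.sub ((h.zeroOut k).measurable_schurDenom v z))).sub
    (Finset.measurable_sum _ fun a _ => (h.measurable_resolvent z a a).const_mul _)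
  have bV : ∀ ω, ‖V ω‖ ≤ r ^ 2 * t := by
    intro ω
    have h1 := norm_weighted_trace_sub_le (h.isHermitian ω) hz k (fun _ => s) (fun _ => hs0)
      (fun _ => hsr)
    have h2 : z - schurDenom v (_root_.zeroOut k (X ω)) z = ∑ a ∈ Finset.univ.erase k,
        (s : ℂ) * resolventMatrix (_root_.zeroOut k (X ω)) z a a := by
      unfold schurDenom
      rw [sub_sub_cancel, ← Finset.add_sum_erase _ _ (Finset.mem_univ k)]
      have h3 : v k = 0 := by simp [hv, rowVariance, offRow]
      rw [h3, Complex.ofReal_zero, zero_mul, zero_add]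
      refine Finset.sum_congr rfl fun a ha => ?_
      have hak := Finset.ne_of_mem_erase ha
      have : v a = s := by simp [hv, rowVariance, offRow, hak, hs a hak]
      rw [this]
    simp only [hV]
    rw [h2, norm_sub_rev]
    exact h1.trans (by gcongr)
  have lV : MemLp V 2 μ := MemLp.of_bound mV.aestronglyMeasurable _ (ae_of_all _ bV)
  have hθim : z.im * θ.im ≤ 0 := by
    have e : θ.im = ∫ ω, (T ω).im ∂μ := (integral_im (𝕜 := ℂ) (lT.integrable one_le_two)).symm
    rw [e, ← integral_const_mul]
    exact integral_nonpos fun ω => im_mul_sum_nonpos (v := fun _ => s) (fun _ => hs0) fun b =>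
      im_mul_im_resolvent_diag_nonpos (h.isHermitian ω) hz b
  have n0 : z - θ ≠ 0 := sub_ne_zero_of_im hz hθim
  have bD0 : ‖(z - θ)⁻¹‖ ≤ t := (norm_inv_sub_le hz hθim).trans ht
  set D0 := (z - θ)⁻¹ with hD0
  set U := fun ω => E ω + (V ω + (T ω - θ)) with hU
  have lTθ : MemLp (fun ω => T ω - θ) 2 μ := lT.sub (memLp_const θ)
  have lU : MemLp U 2 μ := lE.add (lV.add lTθ)
  have e1 : ∀ ω, R ω = D0 + D0 * (U ω * R ω) := by
    intro ω
    have h1 := resolvent_diag_eq hv0 (h.isHermitian ω) hz k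
    have nD := schurDenom_ne_zero hv0 (isHermitian_zeroOut (h.isHermitian ω) k) hz
    have h2 : R ω * schurDenom v (_root_.zeroOut k (X ω)) z = 1 + E ω * R ω := by
      have h3 : R ω = _ := h1
      rw [h3, add_mul, inv_mul_cancel₀ nD, mul_right_comm, inv_mul_cancel₀ nD, one_mul, ← h1]
    have h4 : schurDenom v (_root_.zeroOut k (X ω)) z = (z - θ) - (V ω + (T ω - θ)) := by
      simp only [hV]; ring
    rw [h4] at h2
    have h5 : D0 * (z - θ) = 1 := inv_mul_cancel₀ n0
    simp only [hU]
    linear_combination D0 * h2 - R ω * h5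
  have bR : ∀ ω, ‖R ω‖ ≤ t := fun ω => (norm_resolvent_le (h.isHermitian ω) hz k k).trans ht
  -- In the second-order expansion around the deterministic `D0`, the linear term reduces in mean to
  -- `V`, because the Schur error and `T - θ` are centred.
  have e2 : ∀ ω, R ω = (D0 + D0 ^ 2 * U ω) + D0 ^ 2 * (U ω ^ 2 * R ω) := by
    intro ω
    conv_lhs => rw [e1 ω, e1 ω]
    ring
  have iU := lU.integrable one_le_two
  have iV := lV.integrable one_le_two
  have iTθ := lTθ.integrable one_le_two
  have i1 : Integrable (fun ω => D0 + D0 ^ 2 * U ω) μ := (integrable_const D0).add (iU.const_mul _)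
  have iR : Integrable R μ := (h.memLp_resolvent k k hz (p := 1)).integrable le_rfl
  have i2 : Integrable (fun ω => D0 ^ 2 * (U ω ^ 2 * R ω)) μ :=
    (iR.sub i1).congr (ae_of_all _ fun ω => by
      exact sub_eq_of_eq_add' (e2 ω))
  have eU : ∫ ω, U ω ∂μ = ∫ ω, V ω ∂μ := by
    have h0 : ∫ ω, (T ω - θ) ∂μ = 0 := by
      rw [integral_sub (lT.integrable one_le_two) (integrable_const θ)]; simp [hθ]
    simp only [hU]
    rw [integral_add (lE.integrable one_le_two) (iV.fun_add iTθ), integral_add iV iTθ, h0, add_zero]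
    exact (congrArg (· + _) eE).trans (zero_add _)
  have bEU : ‖∫ ω, U ω ∂μ‖ ≤ r ^ 2 * t := by
    rw [eU]
    simpa using norm_integral_le_of_norm_le_const (μ := μ) (ae_of_all _ bV)
  have vT := h.variance_weighted_trace_le hz ht hN (v := fun _ => s) (fun _ => hs0) (fun _ => hsr)
  have hrc : r ^ 2 ≤ c ^ 2 := by
    have : (1 : ℝ) ≤ N := by exact_mod_cast k.pos
    nlinarith [sq_nonneg r]
  -- `80 = 2 * 36 + 4 + 4`: Schur error, fluctuation of the trace, and `V`.
  have bU : ∫ ω, ‖U ω‖ ^ 2 ∂μ ≤ 80 * c ^ 2 * r ^ 2 * t ^ 2 := by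
    have jE := lE.norm.integrable_sq.const_mul 2
    have jT := lTθ.norm.integrable_sq.const_mul 4
    have pw : ∀ ω, ‖U ω‖ ^ 2 ≤ (2 * ‖E ω‖ ^ 2 + 4 * ‖T ω - θ‖ ^ 2) + 4 * (r ^ 2 * t) ^ 2 := by
      intro ω
      have h1 : ‖U ω‖ ≤ ‖E ω‖ + (r ^ 2 * t + ‖T ω - θ‖) :=
        (norm_add_le _ _).trans (add_le_add le_rfl
          ((norm_add_le _ _).trans (add_le_add (bV ω) le_rfl)))
      calc ‖U ω‖ ^ 2 ≤ (‖E ω‖ + (r ^ 2 * t + ‖T ω - θ‖)) ^ 2 := by gcongr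
        _ ≤ _ := by
          nlinarith [sq_nonneg (‖E ω‖ - (r ^ 2 * t + ‖T ω - θ‖)), sq_nonneg (r ^ 2 * t - ‖T ω - θ‖)]
    refine (integral_mono_of_nonneg (ae_of_all _ fun _ => by positivity)
      ((jE.fun_add jT).fun_add (integrable_const _)) (ae_of_all _ pw)).trans ?_
    rw [integral_add (jE.fun_add jT) (integrable_const _), integral_add jE jT, integral_const_mul,
      integral_const_mul, integral_const, probReal_univ, one_smul]
    calc _ ≤ 2 * (6 * c * r * t) ^ 2 + 4 * (c * r * t) ^ 2 + 4 * (r ^ 2 * t) ^ 2 := by gcongr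
      _ = 76 * c ^ 2 * r ^ 2 * t ^ 2 + 4 * r ^ 2 * r ^ 2 * t ^ 2 := by ring
      _ ≤ 76 * c ^ 2 * r ^ 2 * t ^ 2 + 4 * c ^ 2 * r ^ 2 * t ^ 2 := by gcongr
      _ = _ := by ring
  have b2 : ‖∫ ω, D0 ^ 2 * (U ω ^ 2 * R ω) ∂μ‖ ≤ 80 * c ^ 2 * r ^ 2 * t ^ 5 := by
    refine (norm_integral_le_of_norm_le (lU.norm.integrable_sq.const_mul (t ^ 3))
      (ae_of_all _ fun ω => ?_)).trans ?_
    · rw [norm_mul, norm_mul, norm_pow D0, norm_pow (U ω)]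
      have := bR ω
      calc _ ≤ t ^ 2 * (‖U ω‖ ^ 2 * t) := by gcongr
        _ = _ := by ring
    · rw [integral_const_mul]
      calc _ ≤ t ^ 3 * (80 * c ^ 2 * r ^ 2 * t ^ 2) := by gcongr
        _ = _ := by ring
  have b1 : ‖D0 ^ 2 * ∫ ω, U ω ∂μ‖ ≤ c ^ 2 * r ^ 2 * t ^ 5 := by
    rw [norm_mul, norm_pow]
    have hc2 : 1 ≤ c ^ 2 := one_le_pow₀ hc1
    have ht3 : t ^ 3 ≤ t ^ 5 := pow_le_pow_right₀ ht1 (by norm_num)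
    calc _ ≤ t ^ 2 * (r ^ 2 * t) := by gcongr
      _ = 1 * r ^ 2 * t ^ 3 := by ring
      _ ≤ _ := by gcongr
  have eR : ∫ ω, R ω ∂μ - D0 = D0 ^ 2 * ∫ ω, U ω ∂μ + ∫ ω, D0 ^ 2 * (U ω ^ 2 * R ω) ∂μ := by
    rw [integral_congr_ae (μ := μ) (ae_of_all _ e2), integral_add i1 i2,
      integral_add (integrable_const D0) (iU.const_mul _), integral_const_mul, integral_const,
      probReal_univ, one_smul]
    ring
  rw [eR]
  refine (norm_add_le _ _).trans ?_
  linarith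

/-- The mean of a diagonal resolvent entry is close to the Stieltjes transform of the semicircle
law. -/
lemma norm_integral_resolvent_diag_sub_semicircle_le (h : IsWignerType μ X r) (k : Fin N)
    (hz : z.im ≠ 0) (ht : |z.im|⁻¹ ≤ t) (ht1 : 1 ≤ t) {c : ℝ} (hc1 : 1 ≤ c)
    (hN : N * r ^ 2 ≤ c ^ 2) {σ K : ℝ} (hσ : 0 < σ) (hzK : ‖z‖ ≤ K)
    (hsr : σ ^ 2 / N ≤ r ^ 2) (hs : ∀ j a, j ≠ a → ∫ ω, ‖X ω j a‖ ^ 2 ∂μ = σ ^ 2 / N) :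
    ‖∫ ω, resolventMatrix (X ω) z k k ∂μ - semicircleStieltjes σ z‖
      ≤ stabilityConst σ K * (81 * c ^ 2 * r ^ 2 * t ^ 5 / |z.im|) := by
  have hN0 : (0 : ℝ) < N := by exact_mod_cast k.pos
  have hN0' : (N : ℂ) ≠ 0 := by exact_mod_cast hN0.ne'
  have iR : ∀ b, Integrable (fun ω => resolventMatrix (X ω) z b b) μ := fun b =>
    (h.memLp_resolvent b b hz (p := 1)).integrable le_rfl
  -- As all off-diagonal variances equal `σ² / N`, the same number `σ² m` appears in the equation of
  -- every row. Averaging over the rows makes `m` an approximate fixed point.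
  set m : ℂ := (N : ℂ)⁻¹ * ∑ b, ∫ ω, resolventMatrix (X ω) z b b ∂μ with hm
  have em : ∫ ω, ∑ a, ((σ ^ 2 / N : ℝ) : ℂ) * resolventMatrix (X ω) z a a ∂μ = σ ^ 2 * m := by
    rw [integral_finsetSum _ fun a _ => (iR a).const_mul _]
    simp_rw [integral_const_mul]
    rw [← Finset.mul_sum, hm]
    push_cast
    field_simp
  have key : ∀ b, ‖∫ ω, resolventMatrix (X ω) z b b ∂μ - (z - σ ^ 2 * m)⁻¹‖
      ≤ 81 * c ^ 2 * r ^ 2 * t ^ 5 := fun b => by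
    rw [← em]
    exact h.norm_integral_resolvent_diag_sub_le b hz ht ht1 hc1 hN (by positivity) hsr
      fun a ha => hs b a (Ne.symm ha)
  have hmim : z.im * m.im ≤ 0 := by
    have e : ∀ b, (∫ ω, resolventMatrix (X ω) z b b ∂μ).im
        = ∫ ω, (resolventMatrix (X ω) z b b).im ∂μ := fun b =>
      (integral_im (𝕜 := ℂ) (iR b)).symm
    have h1 := im_mul_sum_nonpos (v := fun _ : Fin N => (N : ℝ)⁻¹) (x := z.im)
      (w := fun b => ∫ ω, resolventMatrix (X ω) z b b ∂μ) (fun _ => by positivity) fun b => by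
        rw [e, ← integral_const_mul]
        exact integral_nonpos fun ω => im_mul_im_resolvent_diag_nonpos (h.isHermitian ω) hz b
    rw [← Finset.mul_sum] at h1
    rw [hm]
    push_cast at h1
    exact h1
  have hh : (z - σ ^ 2 * m)⁻¹ * (z - σ ^ 2 * m) = 1 := by
    refine inv_mul_cancel₀ (sub_ne_zero_of_im hz ?_)
    rw [← Complex.ofReal_pow, Complex.im_ofReal_mul]
    nlinarith [sq_nonneg σ]
  refine norm_sub_semicircle_le hσ hz hzK hmim hh ?_ (key k) ?_
  · have e : m - (z - σ ^ 2 * m)⁻¹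
        = (N : ℂ)⁻¹ * ∑ b, (∫ ω, resolventMatrix (X ω) z b b ∂μ - (z - σ ^ 2 * m)⁻¹) := by
      rw [Finset.sum_sub_distrib, mul_sub, ← hm, Finset.sum_const, Finset.card_univ,
        Fintype.card_fin, nsmul_eq_mul, inv_mul_cancel_left₀ hN0']
    rw [e, norm_mul, norm_inv, Complex.norm_natCast]
    calc _ ≤ (N : ℝ)⁻¹ * ∑ _b : Fin N, 81 * c ^ 2 * r ^ 2 * t ^ 5 := by
          gcongr
          exact norm_sum_le_of_le _ fun b _ => key b
      _ = _ := by simp; field_simp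
  · simpa using norm_integral_le_of_norm_le_const (μ := μ)
      (ae_of_all _ fun ω => norm_resolvent_le (h.isHermitian ω) hz k k)

end IsWignerType

/-! ### Normalised Wigner matrices -/

namespace IsWignerType

variable {N : ℕ} {Ω : Type u} [MeasurableSpace Ω] {μ : Measure Ω}
  {X : Ω → Matrix (Fin N) (Fin N) ℂ} {r : ℝ}

/-- It suffices to control the entries on and above the diagonal. -/
lemma of_upper (hr : 0 ≤ r) (hX : ∀ ω, (X ω).IsHermitian)
    (mX : ∀ j k, Measurable fun ω => X ω j k)
    (hind : iIndepFun (fun (p : {p : Fin N × Fin N // p.1 ≤ p.2}) (ω : Ω) => X ω p.1.1 p.1.2) μ)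
    (hmean : ∀ j k, j < k → ∫ ω, X ω j k ∂μ = 0)
    (hL : ∀ j k, j < k → MemLp (fun ω => X ω j k) 4 μ)
    (h4 : ∀ j k, j < k → ∫ ω, ‖X ω j k‖ ^ 4 ∂μ ≤ r ^ 4)
    (hL' : ∀ i, MemLp (fun ω => X ω i i) 2 μ) (hmean' : ∀ i, ∫ ω, X ω i i ∂μ = 0)
    (h2 : ∀ i, ∫ ω, ‖X ω i i‖ ^ 2 ∂μ ≤ r ^ 2) : IsWignerType μ X r := by
  have hs : ∀ j k ω, X ω j k = star (X ω k j) := fun j k ω => ((hX ω).apply j k).symm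
  refine ⟨hr, hX, mX, hind, fun j k => ?_, fun j k hjk => ?_, fun j k hjk => ?_, hL', h2⟩
  · rcases lt_trichotomy j k with h | h | h
    · exact hmean j k h
    · subst h; exact hmean' j
    · simp_rw [hs j k]
      have := integral_conj (μ := μ) (f := fun ω => X ω k j)
      rw [hmean k j h, map_zero] at this
      exact this
  · rcases lt_or_gt_of_ne hjk with h | h
    · exact hL j k h
    · simp_rw [hs j k]; exact (hL k j h).star
  · rcases lt_or_gt_of_ne hjk with h | h
    · exact h4 j k h
    · simp_rw [hs j k, norm_star]; exact h4 k j h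

lemma smul (h : IsWignerType μ X r) {a : ℝ} (ha : 0 ≤ a) :
    IsWignerType μ (fun ω => (a : ℂ) • X ω) (a * r) := by
  have en : ∀ (x : ℂ) (l : ℕ), ‖(a : ℂ) * x‖ ^ l = a ^ l * ‖x‖ ^ l := fun x l => by
    rw [norm_mul, Complex.norm_real, Real.norm_of_nonneg ha, mul_pow]
  refine ⟨mul_nonneg ha h.nonneg, fun ω => ?_, fun j k => (h.measurable_entry j k).const_mul _,
    h.indep.comp (fun _ x => (a : ℂ) * x) fun _ => measurable_id.const_mul _, fun j k => ?_,
    fun j k hjk => (h.offdiag_memLp j k hjk).const_mul _, fun j k hjk => ?_,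
    fun i => (h.diag_memLp i).const_mul _, fun i => ?_⟩
  · refine Matrix.IsHermitian.ext fun i j => ?_
    rw [Matrix.smul_apply, Matrix.smul_apply, star_smul, (h.isHermitian ω).apply]
    simp
  · simp only [Matrix.smul_apply, smul_eq_mul]
    rw [integral_const_mul, h.mean, mul_zero]
  · simp only [Matrix.smul_apply, smul_eq_mul, en]
    rw [integral_const_mul, mul_pow]
    exact mul_le_mul_of_nonneg_left (h.offdiag_fourth j k hjk) (by positivity)
  · simp only [Matrix.smul_apply, smul_eq_mul, en]
    rw [integral_const_mul, mul_pow]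
    exact mul_le_mul_of_nonneg_left (h.diag_second i) (by positivity)

end IsWignerType

section Wigner

variable {N : ℕ} {Ω : Type u} [MeasurableSpace Ω] {μ : Measure Ω} [IsProbabilityMeasure μ]
  {σ σ₁ m₄ c : ℝ}

lemma integral_norm_sq_of_upper {X : Ω → Matrix (Fin N) (Fin N) ℂ} (hX : ∀ ω, (X ω).IsHermitian)
    {s : ℝ} (h : ∀ j k, j < k → ∫ ω, ‖X ω j k‖ ^ 2 ∂μ = s) (j k : Fin N) (hjk : j ≠ k) :
    ∫ ω, ‖X ω j k‖ ^ 2 ∂μ = s := by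
  rcases lt_or_gt_of_ne hjk with hlt | hgt
  · exact h j k hlt
  · rw [← h k j hgt]
    simp_rw [← (hX _).apply j k, norm_star]

lemma IsRealSymmetricWigner.isWignerType {V : Ω → Matrix (Fin N) (Fin N) ℝ}
    (h : IsRealSymmetricWigner μ V σ σ₁ m₄) (hc : 0 ≤ c) (h4 : m₄ ≤ c ^ 4)
    (h2 : σ₁ ^ 2 ≤ c ^ 2) :
    IsWignerType μ (fun ω => (V ω).map fun x : ℝ => (x : ℂ)) c ∧
      ∀ j k, j ≠ k → ∫ ω, ‖((V ω).map fun x : ℝ => (x : ℂ)) j k‖ ^ 2 ∂μ = σ ^ 2 := by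
  have hH : ∀ ω, ((V ω).map fun x : ℝ => (x : ℂ)).IsHermitian := fun ω =>
    Matrix.IsHermitian.ext fun i j => by
      rw [Matrix.map_apply, Matrix.map_apply, Complex.star_def, Complex.conj_ofReal,
        (h.isSymm ω).apply]
  refine ⟨IsWignerType.of_upper hc hH
    (fun j k => Complex.measurable_ofReal.comp (h.measurable_entry j k))
    (h.indep.comp (fun _ x => (x : ℂ)) fun _ => Complex.measurable_ofReal)
    (fun j k hjk => ?_) (fun j k hjk => (h.offdiag_memLp j k hjk).ofReal) (fun j k hjk => ?_)
    (fun i => (h.diag_memLp i).ofReal) (fun i => ?_) (fun i => ?_), ?_⟩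
  · simp only [Matrix.map_apply]
    rw [integral_complex_ofReal, h.offdiag_mean j k hjk, Complex.ofReal_zero]
  · simp only [Matrix.map_apply, Complex.norm_real, Real.norm_eq_abs]
    exact (h.offdiag_fourth j k hjk).trans h4
  · simp only [Matrix.map_apply]
    rw [integral_complex_ofReal, h.diag_mean i, Complex.ofReal_zero]
  · simp only [Matrix.map_apply, Complex.norm_real, Real.norm_eq_abs]
    exact (h.diag_second i).trans h2
  · refine integral_norm_sq_of_upper hH fun j k hjk => ?_
    simp only [Matrix.map_apply, Complex.norm_real, Real.norm_eq_abs, sq_abs]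
    rw [← h.offdiag_variance j k hjk,
      variance_of_integral_eq_zero (h.measurable_entry j k).aemeasurable (h.offdiag_mean j k hjk)]

lemma IsHermitianWigner.isWignerType {W : Ω → Matrix (Fin N) (Fin N) ℂ}
    (h : IsHermitianWigner μ W σ σ₁ m₄) (hc : 0 ≤ c) (h4 : m₄ ≤ c ^ 4) (h2 : σ₁ ^ 2 ≤ c ^ 2) :
    IsWignerType μ W c ∧ ∀ j k, j ≠ k → ∫ ω, ‖W ω j k‖ ^ 2 ∂μ = σ ^ 2 := by
  have hL : ∀ j k, j < k → MemLp (fun ω => W ω j k) 2 μ := fun j k hjk =>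
    (h.offdiag_memLp j k hjk).mono_exponent (by norm_num)
  have hind : iIndepFun
      (fun (p : {p : Fin N × Fin N // p.1 ≤ p.2}) (ω : Ω) => W ω p.1.1 p.1.2) μ := by
    -- The real and the imaginary part of an entry are grouped in one fibre over its position, which
    -- turns the independence of parts into independence of complex entries.
    set key : {p : Fin N × Fin N // p.1 < p.2} ⊕ {p : Fin N × Fin N // p.1 < p.2} ⊕ Fin N →
        {p : Fin N × Fin N // p.1 ≤ p.2} :=
      Sum.elim (fun p => ⟨p.1, p.2.le⟩) (Sum.elim (fun p => ⟨p.1, p.2.le⟩)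
        fun i => ⟨(i, i), le_rfl⟩) with hkey
    have hdiag : ∀ p : {p : Fin N × Fin N // p.1 ≤ p.2}, ¬ p.1.1 < p.1.2 →
        key (Sum.inr (Sum.inr p.1.1)) = p := fun p hp => by
      obtain ⟨⟨i, j⟩, hij⟩ := p
      have : i = j := le_antisymm hij (not_lt.mp hp)
      subst this
      rfl
    set φ : ∀ p : {p : Fin N × Fin N // p.1 ≤ p.2}, ({i // key i = p} → ℝ) → ℂ := fun p w =>
      if hp : p.1.1 < p.1.2 then
        (w ⟨Sum.inl ⟨p.1, hp⟩, rfl⟩ : ℂ) + (w ⟨Sum.inr (Sum.inl ⟨p.1, hp⟩), rfl⟩ : ℂ) * Complex.I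
      else (w ⟨Sum.inr (Sum.inr p.1.1), hdiag p hp⟩ : ℂ) with hφ
    have mφ : ∀ p, Measurable (φ p) := by
      intro p
      by_cases hp : p.1.1 < p.1.2
      · simp only [hφ, dif_pos hp]
        exact (Complex.measurable_ofReal.comp (measurable_pi_apply _)).add
          ((Complex.measurable_ofReal.comp (measurable_pi_apply _)).mul_const _)
      · simp only [hφ, dif_neg hp]
        exact Complex.measurable_ofReal.comp (measurable_pi_apply _)
    have h1 := iIndepFun_of_fibers (by
      rintro (p | p | i)
      · exact Complex.measurable_re.comp (h.measurable_entry _ _)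
      · exact Complex.measurable_im.comp (h.measurable_entry _ _)
      · exact Complex.measurable_re.comp (h.measurable_entry _ _)) h.indep key φ mφ
    convert h1 using 3 with p ω
    by_cases hp : p.1.1 < p.1.2
    · simp only [hφ, dif_pos hp, Sum.elim_inl, Sum.elim_inr]
      exact (Complex.re_add_im _).symm
    · simp only [hφ, dif_neg hp, Sum.elim_inr]
      have : p.1.2 = p.1.1 := le_antisymm (not_lt.mp hp) p.2
      rw [this]
      exact (Complex.conj_eq_iff_re.mp ((h.isHermitian ω).apply _ _)).symm
  refine ⟨IsWignerType.of_upper hc h.isHermitian h.measurable_entry hind (fun j k hjk => ?_)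
    h.offdiag_memLp (fun j k hjk => (h.offdiag_fourth j k hjk).trans h4) h.diag_memLp h.diag_mean
    (fun i => (h.diag_second i).trans h2), integral_norm_sq_of_upper h.isHermitian
      fun j k hjk => ?_⟩
  · have i := (hL j k hjk).integrable one_le_two
    refine Complex.ext ?_ ?_
    · exact (integral_re (𝕜 := ℂ) i).symm.trans (h.offdiag_mean_re j k hjk)
    · exact (integral_im (𝕜 := ℂ) i).symm.trans (h.offdiag_mean_im j k hjk)
  · have v1 := (variance_of_integral_eq_zero (X := fun ω => (W ω j k).re)
      (Complex.measurable_re.comp (h.measurable_entry j k)).aemeasurable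
      (h.offdiag_mean_re j k hjk)).symm.trans (h.offdiag_variance_re j k hjk)
    have v2 := (variance_of_integral_eq_zero (X := fun ω => (W ω j k).im)
      (Complex.measurable_im.comp (h.measurable_entry j k)).aemeasurable
      (h.offdiag_mean_im j k hjk)).symm.trans (h.offdiag_variance_im j k hjk)
    simp_rw [Complex.sq_norm, Complex.normSq_apply, ← sq]
    refine (integral_add (hL j k hjk).re.integrable_sq (hL j k hjk).im.integrable_sq).trans ?_
    exact (congrArg₂ (· + ·) v1 v2).trans (by ring)

lemma IsWigner.isWignerType {W : Ω → Matrix (Fin N) (Fin N) ℂ} (h : IsWigner μ W σ σ₁ m₄)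
    (hc : 0 ≤ c) (h4 : m₄ ≤ c ^ 4) (h2 : σ₁ ^ 2 ≤ c ^ 2) :
    IsWignerType μ W c ∧ ∀ j k, j ≠ k → ∫ ω, ‖W ω j k‖ ^ 2 ∂μ = σ ^ 2 := by
  rcases h with ⟨V, hV, e⟩ | h
  · obtain rfl : W = fun ω => (V ω).map fun x : ℝ => (x : ℂ) := funext e
    exact hV.isWignerType hc h4 h2
  · exact h.isWignerType hc h4 h2

/-- The normalised matrix `N ^ (-1/2) W` has entries of size `c / √N`. -/
lemma IsWigner.isWignerType_smul {W : Ω → Matrix (Fin N) (Fin N) ℂ} (h : IsWigner μ W σ σ₁ m₄)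
    (hc : 0 ≤ c) (h4 : m₄ ≤ c ^ 4) (h2 : σ₁ ^ 2 ≤ c ^ 2) :
    IsWignerType μ (fun ω => ((1 / Real.sqrt N : ℝ) : ℂ) • W ω) (1 / Real.sqrt N * c) ∧
      ∀ j k, j ≠ k → ∫ ω, ‖(((1 / Real.sqrt N : ℝ) : ℂ) • W ω) j k‖ ^ 2 ∂μ = σ ^ 2 / N := by
  obtain ⟨h1, hv⟩ := h.isWignerType hc h4 h2
  refine ⟨h1.smul (by positivity), fun j k hjk => ?_⟩
  simp only [Matrix.smul_apply, smul_eq_mul, norm_mul, Complex.norm_real, mul_pow]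
  rw [integral_const_mul, hv j k hjk, Real.norm_of_nonneg (by positivity), div_pow,
    Real.sq_sqrt (by positivity)]
  ring

end Wigner

/-! ### Choice of constants and polynomials, and conclusion -/

lemma exists_positivePolynomial (l : ℕ) {C : ℝ} (hC : 0 < C) :
    ∃ P : Polynomial ℝ, IsPositivePolynomial l P ∧ ∀ x, P.eval x = C * (x + 1) ^ l := by
  -- With `t = |Im z|⁻¹ + 1` every estimate is a multiple of a power of `t`; by the binomial theorem
  -- all coefficients of that power are positive.
  refine ⟨Polynomial.C C * (Polynomial.X + 1) ^ l, ⟨?_, fun k hk => ?_⟩, fun x => by simp⟩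
  · rw [Polynomial.natDegree_C_mul hC.ne', Polynomial.natDegree_pow,
      ← Polynomial.C_1, Polynomial.natDegree_X_add_C, mul_one]
  · rw [Polynomial.coeff_C_mul, Polynomial.coeff_X_add_one_pow]
    have := Nat.choose_pos hk
    positivity

/-- A common bound for the parameters of a Wigner matrix. -/
def wignerBound (σ σ₁ m₄ m₅ : ℝ) : ℝ := 1 + |σ| + |σ₁| + |m₄| + |m₅|

lemma one_le_wignerBound (σ σ₁ m₄ m₅ : ℝ) : 1 ≤ wignerBound σ σ₁ m₄ m₅ := by
  unfold wignerBound
  linarith [abs_nonneg σ, abs_nonneg σ₁, abs_nonneg m₄, abs_nonneg m₅]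

lemma wignerBound_spec (σ σ₁ m₄ m₅ : ℝ) :
    σ ^ 2 ≤ wignerBound σ σ₁ m₄ m₅ ^ 2 ∧ σ₁ ^ 2 ≤ wignerBound σ σ₁ m₄ m₅ ^ 2 ∧
      m₄ ≤ wignerBound σ σ₁ m₄ m₅ ^ 4 ∧ m₅ ≤ wignerBound σ σ₁ m₄ m₅ ^ 5 := by
  have h1 := one_le_wignerBound σ σ₁ m₄ m₅
  have hσ : |σ| ≤ wignerBound σ σ₁ m₄ m₅ ∧ |σ₁| ≤ wignerBound σ σ₁ m₄ m₅ ∧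
      m₄ ≤ wignerBound σ σ₁ m₄ m₅ ∧ m₅ ≤ wignerBound σ σ₁ m₄ m₅ := by
    unfold wignerBound
    have := abs_nonneg σ
    have := abs_nonneg σ₁
    have := abs_nonneg m₄
    have := abs_nonneg m₅
    have := le_abs_self m₄
    have := le_abs_self m₅
    refine ⟨?_, ?_, ?_, ?_⟩ <;> linarith
  refine ⟨?_, ?_, hσ.2.2.1.trans (le_self_pow₀ h1 (by norm_num)),
    hσ.2.2.2.trans (le_self_pow₀ h1 (by norm_num))⟩
  · rw [← sq_abs σ]; gcongr; exact hσ.1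
  · rw [← sq_abs σ₁]; gcongr; exact hσ.2.1

end

theorem proposition3p1 (σ σ₁ m₄ : ℝ) (hσ : 0 < σ) :
    -- all expectations and variances below are finite
    (∀ (N : ℕ) (Ω : Type u) [MeasurableSpace Ω] (μ : Measure Ω) [IsProbabilityMeasure μ]
        (W : Ω → Matrix (Fin N) (Fin N) ℂ), IsWigner μ W σ σ₁ m₄ →
      ∀ (i j : Fin N) (z : ℂ), z.im ≠ 0 →
        MemLp (fun ω => wignerResolvent (W ω) z i j) 2 μ) ∧
    -- the mean of a diagonal entry, uniformly on bounded subsets of `ℂ \ ℝ`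
    (∀ B : Set ℂ, Bornology.IsBounded B → (∀ z ∈ B, z.im ≠ 0) →
      ∃ C : ℝ, ∀ (N : ℕ) (Ω : Type u) [MeasurableSpace Ω] (μ : Measure Ω) [IsProbabilityMeasure μ]
        (W : Ω → Matrix (Fin N) (Fin N) ℂ), IsWigner μ W σ σ₁ m₄ →
      ∀ (i : Fin N), ∀ z ∈ B,
        ‖(∫ ω, wignerResolvent (W ω) z i i ∂μ) - semicircleStieltjes σ z‖
          ≤ C * (1 / (|z.im| ^ 6 * (N : ℝ)))) ∧
    -- the mean of an off-diagonal entry, uniformly on `ℂ \ ℝ`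
    (∃ P₅ : Polynomial ℝ, IsPositivePolynomial 5 P₅ ∧
      ∀ (N : ℕ) (Ω : Type u) [MeasurableSpace Ω] (μ : Measure Ω) [IsProbabilityMeasure μ]
        (W : Ω → Matrix (Fin N) (Fin N) ℂ), IsWigner μ W σ σ₁ m₄ →
      ∀ (i j : Fin N), i ≠ j → ∀ z : ℂ, z.im ≠ 0 →
        ‖∫ ω, wignerResolvent (W ω) z i j ∂μ‖ ≤ P₅.eval (|z.im|⁻¹) / (N : ℝ)) ∧
    -- the variance of an arbitrary entry, uniformly on `ℂ \ ℝ`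
    (∃ P₆ : Polynomial ℝ, IsPositivePolynomial 6 P₆ ∧
      ∀ (N : ℕ) (Ω : Type u) [MeasurableSpace Ω] (μ : Measure Ω) [IsProbabilityMeasure μ]
        (W : Ω → Matrix (Fin N) (Fin N) ℂ), IsWigner μ W σ σ₁ m₄ →
      ∀ (i j : Fin N) (z : ℂ), z.im ≠ 0 →
        complexVariance (fun ω => wignerResolvent (W ω) z i j) μ
          ≤ P₆.eval (|z.im|⁻¹) / (N : ℝ)) ∧
    -- the improved bound under fifth (off-diagonal) and third (diagonal) moment bounds
    (∀ m₅ m₃ : ℝ, ∃ P₉ : Polynomial ℝ, IsPositivePolynomial 9 P₉ ∧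
      ∀ (N : ℕ) (Ω : Type u) [MeasurableSpace Ω] (μ : Measure Ω) [IsProbabilityMeasure μ]
        (W : Ω → Matrix (Fin N) (Fin N) ℂ), IsWigner μ W σ σ₁ m₄ →
      (∀ j k : Fin N, j ≠ k →
        MemLp (fun ω => W ω j k) 5 μ ∧ ∫ ω, ‖W ω j k‖ ^ 5 ∂μ ≤ m₅) →
      (∀ i : Fin N, MemLp (fun ω => W ω i i) 3 μ ∧ ∫ ω, ‖W ω i i‖ ^ 3 ∂μ ≤ m₃) →
      ∀ (i j : Fin N), i ≠ j → ∀ z : ℂ, z.im ≠ 0 →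
        ‖∫ ω, wignerResolvent (W ω) z i j ∂μ‖
          ≤ P₉.eval (|z.im|⁻¹) / (N : ℝ) ^ (3 / 2 : ℝ)) := by

  have inv_nn : ∀ z : ℂ, 0 ≤ |z.im|⁻¹ := fun z => by positivity
  have hsq : ∀ {N : ℕ} (_ : Fin N) (c : ℝ), (1 / Real.sqrt N * c) ^ 2 = c ^ 2 / N := by
    intro N i c
    rw [mul_pow, div_pow, Real.sq_sqrt (by positivity)]
    ring
  have hNr : ∀ {N : ℕ} (_ : Fin N) (c : ℝ), N * (1 / Real.sqrt N * c) ^ 2 ≤ c ^ 2 := by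
    intro N i c
    have : (0 : ℝ) < N := by exact_mod_cast i.pos
    rw [hsq i, mul_div_cancel₀ _ this.ne']
  obtain ⟨b1, b2, b3, -⟩ := wignerBound_spec σ σ₁ m₄ 0
  have hc1 := one_le_wignerBound σ σ₁ m₄ 0
  set c := wignerBound σ σ₁ m₄ 0 with hc
  have hc0 : 0 < c := by linarith
  refine ⟨?_, ?_, ?_, ?_, ?_⟩
  · intro N Ω _ μ _ W hW i j z hz
    exact (hW.isWignerType_smul hc0.le b3 b2).1.memLp_resolvent i j hz
  · intro B hB hBim
    obtain ⟨K, hK⟩ := hB.exists_norm_le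
    refine ⟨stabilityConst σ K * (81 * c ^ 4 * (1 + K) ^ 5), ?_⟩
    intro N Ω _ μ _ W hW i z hzB
    have hz := hBim z hzB
    have hη : 0 < |z.im| := abs_pos.mpr hz
    have hηK : |z.im| ≤ K := (Complex.abs_im_le_norm z).trans (hK z hzB)
    have hN0 : (0 : ℝ) < N := by exact_mod_cast i.pos
    obtain ⟨hX, hv⟩ := hW.isWignerType_smul hc0.le b3 b2
    have key := hX.norm_integral_resolvent_diag_sub_semicircle_le i hz (t := |z.im|⁻¹ + 1)
      (by linarith) (by linarith [inv_nn z]) hc1 (hNr i c) hσ (hK z hzB)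
      (by rw [hsq i]; gcongr) hv
    refine key.trans ?_
    have hS := stabilityConst_nonneg hσ (hη.le.trans hηK)
    rw [hsq i, mul_assoc (stabilityConst σ K)]
    refine mul_le_mul_of_nonneg_left ?_ hS
    -- On a bounded set `t` is comparable to `|Im z|⁻¹`. The fifth power of `t` and the stability
    -- factor then combine to `|Im z|⁻⁶`.
    have ht : |z.im|⁻¹ + 1 ≤ (1 + K) / |z.im| := by
      rw [le_div_iff₀ hη, add_mul, inv_mul_cancel₀ hη.ne']; linarith
    calc 81 * c ^ 2 * (c ^ 2 / N) * (|z.im|⁻¹ + 1) ^ 5 / |z.im|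
        ≤ 81 * c ^ 2 * (c ^ 2 / N) * ((1 + K) / |z.im|) ^ 5 / |z.im| := by gcongr
      _ = _ := by field_simp
  · obtain ⟨P, hP, hPe⟩ := exists_positivePolynomial 5 (C := 6 * c ^ 3) (by positivity)
    refine ⟨P, hP, ?_⟩
    intro N Ω _ μ _ W hW i j hij z hz
    have hN0 : (0 : ℝ) < N := by exact_mod_cast i.pos
    have hX := (hW.isWignerType_smul hc0.le b3 b2).1
    have ht1 : 1 ≤ |z.im|⁻¹ + 1 := by linarith [inv_nn z]
    refine (hX.norm_integral_resolvent_offdiag_le (Ne.symm hij) hz (t := |z.im|⁻¹ + 1)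
      (by linarith) ht1 hc1 (hNr i c)).trans ?_
    rw [hPe, hsq i]
    -- The estimate has power four; `1 ≤ t` raises it to the stated degree.
    have : (|z.im|⁻¹ + 1) ^ 4 ≤ (|z.im|⁻¹ + 1) ^ 5 := pow_le_pow_right₀ ht1 (by norm_num)
    calc 6 * c * (c ^ 2 / N) * (|z.im|⁻¹ + 1) ^ 4
        ≤ 6 * c * (c ^ 2 / N) * (|z.im|⁻¹ + 1) ^ 5 := by gcongr
      _ = _ := by field_simp
  · obtain ⟨P, hP, hPe⟩ := exists_positivePolynomial 6 (C := 121 * c ^ 4) (by positivity)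
    refine ⟨P, hP, ?_⟩
    intro N Ω _ μ _ W hW i j z hz
    have hN0 : (0 : ℝ) < N := by exact_mod_cast i.pos
    have hX := (hW.isWignerType_smul hc0.le b3 b2).1
    have ht1 : 1 ≤ |z.im|⁻¹ + 1 := by linarith [inv_nn z]
    refine (hX.variance_resolvent_le i j hz (t := |z.im|⁻¹ + 1)
      (by linarith) ht1 hc1 (hNr i c)).trans (le_of_eq ?_)
    rw [hPe, mul_pow, mul_pow (11 * c), hsq i]
    ring
  · intro m₅ m₃
    -- The common bound has to dominate `m₅` as well, so `c` is chosen afresh.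
    obtain ⟨-, b2, b3, b5⟩ := wignerBound_spec σ σ₁ m₄ m₅
    have hc1 := one_le_wignerBound σ σ₁ m₄ m₅
    clear_value c
    set c := wignerBound σ σ₁ m₄ m₅ with hc
    have hc0 : 0 < c := by linarith
    obtain ⟨P, hP, hPe⟩ := exists_positivePolynomial 9 (C := 360 * c ^ 7) (by positivity)
    refine ⟨P, hP, ?_⟩
    intro N Ω _ μ _ W hW hW5 _ i j hij z hz
    have hN0 : (0 : ℝ) < N := by exact_mod_cast i.pos
    have hX := (hW.isWignerType_smul hc0.le b3 b2).1
    have ht1 : 1 ≤ |z.im|⁻¹ + 1 := by linarith [inv_nn z]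
    set a := 1 / Real.sqrt N with ha
    have ha0 : 0 ≤ a := by positivity
    have h5 : ∀ k, k ≠ i → Integrable (fun ω => ‖((a : ℂ) • W ω) i k‖ ^ 5) μ ∧
        ∫ ω, ‖((a : ℂ) • W ω) i k‖ ^ 5 ∂μ ≤ (a * c) ^ 5 := by
      intro k hk
      obtain ⟨l5, e5⟩ := hW5 i k (Ne.symm hk)
      simp only [Matrix.smul_apply, smul_eq_mul, norm_mul, Complex.norm_real, mul_pow,
        Real.norm_of_nonneg ha0]
      refine ⟨(MemLp.integrable_norm_pow (p := 5) (by exact_mod_cast l5) (by norm_num)).const_mul _,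
        ?_⟩
      rw [integral_const_mul]
      exact mul_le_mul_of_nonneg_left (e5.trans b5) (by positivity)
    refine (hX.norm_integral_resolvent_offdiag_le_of_fifth (Ne.symm hij) hz (t := |z.im|⁻¹ + 1)
      (by linarith) ht1 hc1 (hNr i c) h5).trans ?_
    have h3 : (N : ℝ) ^ (3 / 2 : ℝ) = Real.sqrt N ^ 3 := by
      rw [Real.sqrt_eq_rpow, ← Real.rpow_natCast, ← Real.rpow_mul hN0.le]
      norm_num
    have hs : 0 < Real.sqrt N := Real.sqrt_pos.mpr hN0
    rw [hPe, h3]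
    -- The estimate has power eight and is raised to the stated degree; `(c / √N) ^ 3` supplies `N ^
    -- (-3/2)`.
    have : (|z.im|⁻¹ + 1) ^ 8 ≤ (|z.im|⁻¹ + 1) ^ 9 := pow_le_pow_right₀ ht1 (by norm_num)
    calc 360 * c ^ 4 * (a * c) ^ 3 * (|z.im|⁻¹ + 1) ^ 8
        ≤ 360 * c ^ 4 * (a * c) ^ 3 * (|z.im|⁻¹ + 1) ^ 9 := by gcongr
      _ = _ := by rw [ha]; field_simp
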